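/- Let $m\ge 1$ and $n\ge 0$. Let $\Lambda(m,n)=\Lambda(n)[[x_1,\dots,x_m]]$, where $\Lambda(n)$ is the complex Grassmann algebra on the odd generators $\xi_1,\dots,\xi_n$, with the topology in which the powers of the ideal $(x_1,\dots,x_m,\xi_1,\dots,\xi_n)$ form a fundamental system of neighbourhoods of $0$. Let $W(m,n)=\{\sum_i P_i\frac{\partial}{\partial x_i}+\sum_j Q_j\frac{\partial}{\partial \xi_j} \mid P_i,Q_j\in\Lambda(m,n)\}$ be the linearly compact Lie superalgebra of all continuous derivations of $\Lambda(m,n)$. For $0\le k\le n$ let $L_k=\prod_{j\ge 0}W(m,n)_j$ be the graded subalgebra of type $(1,\dots,1|1,\dots,1,0,\dots,0)$ with $k$ zeros, that is, $W(m,n)_j$ is the component of degree $j$ of the $\mathbb{Z}$-grading of $W(m,n)$ with $\deg x_i=-\deg\frac{\partial}{\partial x_i}=1$ for all $i$, $\deg \xi_j=-\deg\frac{\partial}{\partial \xi_j}=1$ for $j\le n-k$, and $\deg \xi_j=-\deg\frac{\partial}{\partial \xi_j}=0$ for $j>n-k$. Let $G$ be the group of inner automorphisms of $\mathrm{Der}\,W(m,n)$,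 acting on $W(m,n)$; it is generated by the automorphisms $\exp D$, where $D$ is an even continuous derivation of the Lie superalgebra $W(m,n)$ whose exponential series converges. Then $L_0,\dots,L_n$ are maximal open subalgebras of $W(m,n)$, and every maximal open ($\mathbb{Z}/2\mathbb{Z}$-graded) subalgebra of $W(m,n)$ is conjugate, by an element of $G$, to exactly one of $L_0,\dots,L_n$. (A maximal open subalgebra is an open subalgebra that is maximal among the proper subalgebras.) -/

import Mathlib

namespace SuperW

noncomputable section

/-- The superalgebra `Λ(m,n) = Λ(n)[[x₁,…,x_m]]`, where `Λ(n)` is the complex Grassmann algebra on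
`n` generators. -/
abbrev Lam (m n : ℕ) : Type := MvPowerSeries (Fin m) (ExteriorAlgebra ℂ (Fin n → ℂ))

/-- The generators `ξ_j` of the Grassmann algebra `Λ(n)`. -/
def grass (n : ℕ) (j : Fin n) : ExteriorAlgebra ℂ (Fin n → ℂ) :=
  ExteriorAlgebra.ι ℂ (Pi.single j 1)

/-- The indeterminates of `Λ(m,n)`: the even `x_i` and the odd `ξ_j`. -/
def gen (m n : ℕ) : Fin m ⊕ Fin n → Lam m n :=
  Sum.elim (fun i => MvPowerSeries.X i) (fun j => MvPowerSeries.C (grass n j))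

/-- The homogeneous component of `Λ(m,n)` of parity `p` (`x_i` is even, `ξ_j` is odd). -/
def parityPart (m n : ℕ) (p : ZMod 2) : Submodule ℂ (Lam m n) where
  carrier := {f | ∀ d, MvPowerSeries.coeff d f ∈
    CliffordAlgebra.evenOdd (0 : QuadraticForm ℂ (Fin n → ℂ)) p}
  zero_mem' := fun d => by simp
  add_mem' := fun hf hg d => by
    rw [map_add]
    exact Submodule.add_mem _ (hf d) (hg d)
  smul_mem' := fun c f hf d => Submodule.smul_mem _ c (hf d)

/-- The ideal `(x₁,…,x_m,ξ₁,…,ξ_n)`; its powers are the fundamental system of neighbourhoods of `0`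
of the formal topology of `Λ(m,n)`. (Each generator commutes or anticommutes with each homogeneous
element, so the left ideal that they generate is two-sided.) -/
def maxIdeal (m n : ℕ) : Ideal (Lam m n) := Ideal.span (Set.range (gen m n))

/-- The sign `(-1)^{pq}`. -/
def sgn (p q : ZMod 2) : ℂ := (-1) ^ (p.val * q.val)

theorem sgn_values : sgn 0 0 = 1 ∧ sgn 0 1 = 1 ∧ sgn 1 0 = 1 ∧ sgn 1 1 = -1 := by
  refine ⟨?_, ?_, ?_, ?_⟩ <;> simp [sgn, ZMod.val_one]

/-- The continuous derivations of parity `p` of the superalgebra `Λ(m,n)`. -/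
def W (m n : ℕ) (p : ZMod 2) : Submodule ℂ (Module.End ℂ (Lam m n)) where
  carrier := {X |
    (∀ q, ∀ f ∈ parityPart m n q, X f ∈ parityPart m n (p + q)) ∧
    (∀ q, ∀ f ∈ parityPart m n q, ∀ g, X (f * g) = X f * g + sgn p q • (f * X g)) ∧
    (∀ N : ℕ, ∃ M : ℕ, ∀ f ∈ maxIdeal m n ^ M, X f ∈ maxIdeal m n ^ N)}
  zero_mem' := ⟨fun q f _ => by simp, fun q f _ g => by simp, fun N => ⟨0, fun f _ => by simp⟩⟩
  add_mem' := by
    rintro X Y ⟨hX, hX', hX''⟩ ⟨hY, hY', hY''⟩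
    refine ⟨fun q f hf => Submodule.add_mem _ (hX q f hf) (hY q f hf), fun q f hf g => ?_,
      fun N => ?_⟩
    · simp only [LinearMap.add_apply, hX' q f hf g, hY' q f hf g, add_mul, mul_add, smul_add]
      abel
    · obtain ⟨M, hM⟩ := hX'' N
      obtain ⟨M', hM'⟩ := hY'' N
      exact ⟨max M M', fun f hf => add_mem
        (hM f (Ideal.pow_le_pow_right (le_max_left _ _) hf))
        (hM' f (Ideal.pow_le_pow_right (le_max_right _ _) hf))⟩
  smul_mem' := by
    rintro c X ⟨hX, hX', hX''⟩
    refine ⟨fun q f hf => Submodule.smul_mem _ c (hX q f hf), fun q f hf g => ?_, fun N => ?_⟩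
    · simp only [LinearMap.smul_apply, hX' q f hf g, smul_add, smul_mul_assoc]
      rw [smul_comm c, mul_smul_comm]
    · obtain ⟨M, hM⟩ := hX'' N
      refine ⟨M, fun f hf => ?_⟩
      rw [LinearMap.smul_apply, ← one_mul (X f), ← smul_mul_assoc]
      exact Ideal.mul_mem_left _ _ (hM f hf)

theorem bracket_mem {m n : ℕ} {p q : ZMod 2} {X Y : Module.End ℂ (Lam m n)}
    (hX : X ∈ W m n p) (hY : Y ∈ W m n q) : X * Y - sgn p q • (Y * X) ∈ W m n (p + q) := by
  obtain ⟨hX, hX', hX''⟩ := hX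
  obtain ⟨hY, hY', hY''⟩ := hY
  refine ⟨fun r f hf => ?_, fun r f hf g => ?_, fun N => ?_⟩
  · refine Submodule.sub_mem _ ?_ (Submodule.smul_mem _ _ ?_)
    · rw [add_assoc]
      exact hX _ _ (hY _ _ hf)
    · rw [add_comm p q, add_assoc]
      exact hY _ _ (hX _ _ hf)
  · have e1 := hX' _ _ (hY r f hf) g
    have e2 := hX' r f hf (Y g)
    have e3 := hY' _ _ (hX r f hf) g
    have e4 := hY' r f hf (X g)
    simp only [LinearMap.sub_apply, LinearMap.smul_apply, Module.End.mul_apply, hX' r f hf g,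
      hY' r f hf g, map_add, map_smul, e1, e2, e3, e4]
    clear e1 e2 e3 e4
    have key : ∀ a b c d u v : Lam m n,
        a + sgn p (q + r) • b + sgn q r • (c + sgn p r • d) -
          sgn p q • (u + sgn q (p + r) • c + sgn p r • (b + sgn q r • v)) =
        (a - sgn p q • u) + sgn (p + q) r • (d - sgn p q • v) := by
      intro a b c d u v
      obtain ⟨h00, h01, h10, h11⟩ := sgn_values
      have h2 : ∀ z : ZMod 2, z = 0 ∨ z = 1 := by decide
      have h3 : (1 + 1 : ZMod 2) = 0 := by decide
      rcases h2 p with rfl | rfl <;> rcases h2 q with rfl | rfl <;> rcases h2 r with rfl | rfl <;>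
        simp only [add_zero, zero_add, h3, h00, h01, h10, h11, one_smul, neg_smul] <;> abel
    rw [key]
    simp only [sub_mul, mul_sub, smul_mul_assoc, mul_smul_comm]
  · obtain ⟨M, hM⟩ := hX'' N
    obtain ⟨M₁, hM₁⟩ := hY'' M
    obtain ⟨M', hM'⟩ := hY'' N
    obtain ⟨M₁', hM₁'⟩ := hX'' M'
    refine ⟨max M₁ M₁', fun f hf => ?_⟩
    refine sub_mem (hM _ (hM₁ f (Ideal.pow_le_pow_right (le_max_left _ _) hf))) ?_
    rw [LinearMap.smul_apply, ← one_mul ((Y * X) f), ← smul_mul_assoc]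
    exact Ideal.mul_mem_left _ _ (hM' _ (hM₁' f (Ideal.pow_le_pow_right (le_max_right _ _) hf)))

/-- The Lie superbracket `[X,Y] = XY - (-1)^{p(X)p(Y)} YX` of homogeneous elements of
`W(m,n) = W(m,n)₀ ⊕ W(m,n)₁`. -/
def bracket {m n : ℕ} {p q : ZMod 2} (X : W m n p) (Y : W m n q) : W m n (p + q) :=
  ⟨X.1 * Y.1 - sgn p q • (Y.1 * X.1), bracket_mem X.2 Y.2⟩

/-- A `ℤ/2ℤ`-graded subspace `L = L₀ ⊕ L₁` of `W(m,n)`, given by its homogeneous components. -/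
abbrev GradedSubspace (m n : ℕ) : Type := (p : ZMod 2) → Submodule ℂ (W m n p)

/-- The fundamental system of neighbourhoods of `0` of `W(m,n) ≅ Λ(m,n)^{m+n}`: the vector fields
`∑ P_i ∂/∂x_i + ∑ Q_j ∂/∂ξ_j` all of whose coefficients `P_i = X(x_i)`, `Q_j = X(ξ_j)` lie in
`(x₁,…,x_m,ξ₁,…,ξ_n)^N`. -/
def nhd (m n N : ℕ) (p : ZMod 2) : Set (W m n p) :=
  {X | ∀ s, X.1 (gen m n s) ∈ maxIdeal m n ^ N}

/-- `L` is a subalgebra of the Lie superalgebra `W(m,n)`. -/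
def IsSubalg {m n : ℕ} (L : GradedSubspace m n) : Prop :=
  ∀ (p q : ZMod 2) (X : W m n p) (Y : W m n q), X ∈ L p → Y ∈ L q → bracket X Y ∈ L (p + q)

/-- `L` is an open subspace of `W(m,n)`. -/
def IsOpenSubspace {m n : ℕ} (L : GradedSubspace m n) : Prop :=
  ∃ N : ℕ, ∀ p, ∀ X ∈ nhd m n N p, X ∈ L p

/-- `L` is a maximal open subalgebra of `W(m,n)`: an open subalgebra that is maximal among the proper
subalgebras (a subalgebra that contains an open one is open). -/
def IsMaximalOpenSubalg {m n : ℕ} (L : GradedSubspace m n) : Prop :=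
  IsSubalg L ∧ IsOpenSubspace L ∧ L ≠ ⊤ ∧ ∀ L', IsSubalg L' → L < L' → L' = ⊤

/-- For the grading of `Λ(n)` with `deg ξ_j = b_j`: the span of all monomials in the `ξ_j` of degree
at least `r`. -/
def grassGE {n : ℕ} (b : Fin n → ℤ) (r : ℤ) : Submodule ℂ (ExteriorAlgebra ℂ (Fin n → ℂ)) :=
  Submodule.span ℂ {w | ∃ l : List (Fin n), r ≤ (l.map b).sum ∧ w = (l.map (grass n)).prod}

/-- For the grading of `Λ(m,n)` with `deg x_i = a_i`, `deg ξ_j = b_j`: the series all of whose monomials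
have degree at least `r`. -/
def lamGE {m n : ℕ} (a : Fin m → ℕ) (b : Fin n → ℤ) (r : ℤ) : Submodule ℂ (Lam m n) where
  carrier := {f | ∀ d : Fin m →₀ ℕ,
    MvPowerSeries.coeff d f ∈ grassGE b (r - ∑ i, (a i : ℤ) * (d i : ℤ))}
  zero_mem' := fun d => by simp
  add_mem' := fun hf hg d => by
    rw [map_add]
    exact Submodule.add_mem _ (hf d) (hg d)
  smul_mem' := fun c f hf d => Submodule.smul_mem _ c (hf d)

/-- The graded subalgebra `∏_{j ≥ 0} W(m,n)_j` of the grading of type `(a₁,…,a_m|b₁,…,b_n)`, in which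
`deg x_i = -deg ∂/∂x_i = a_i` and `deg ξ_j = -deg ∂/∂ξ_j = b_j`. A vector field lies in it if and only
if its coefficient at `∂/∂x_i` (at `∂/∂ξ_j`) only has terms of degree at least `a_i` (at least `b_j`). -/
def gradedSubalg {m n : ℕ} (a : Fin m → ℕ) (b : Fin n → ℤ) : GradedSubspace m n := fun _ =>
  { carrier := {X | ∀ s, X.1 (gen m n s) ∈ lamGE a b (Sum.elim (fun i => (a i : ℤ)) b s)}
    zero_mem' := fun _ => Submodule.zero_mem _
    add_mem' := fun hX hY s => Submodule.add_mem _ (hX s) (hY s)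
    smul_mem' := fun c _ hX s => Submodule.smul_mem _ c (hX s) }

/-- The graded subalgebra of `W(m,n)` of type `(1,…,1|1,…,1,0,…,0)` with `k` zeros. -/
def stdSubalg (m n k : ℕ) : GradedSubspace m n :=
  gradedSubalg (fun _ => 1) (fun j => if (j : ℕ) + k < n then 1 else 0)

/-- `D` is an even continuous derivation of the Lie superalgebra `W(m,n)`, i.e. an even element
of `Der W(m,n)`. -/
def IsEvenDer {m n : ℕ} (D : (p : ZMod 2) → Module.End ℂ (W m n p)) : Prop :=
  (∀ (p q : ZMod 2) (X : W m n p) (Y : W m n q),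
    D (p + q) (bracket X Y) = bracket (D p X) Y + bracket X (D q Y)) ∧
  ∀ N : ℕ, ∃ M : ℕ, ∀ p, ∀ X ∈ nhd m n M p, D p X ∈ nhd m n N p

/-- A continuous linear functional on a homogeneous component of `W(m,n)`. -/
def IsContFunctional {m n : ℕ} {p : ZMod 2} (l : W m n p →ₗ[ℂ] ℂ) : Prop :=
  ∃ N : ℕ, ∀ X ∈ nhd m n N p, l X = 0

/-- `g = exp D`: for every `X` the series `∑_j D^j(X)/j!` converges to `g(X)`, in the product of the
usual topologies of the finite-dimensional quotients of `W(m,n)` (that is, after applying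
any continuous linear functional). In particular `D` is exponentiable. -/
def IsExp {m n : ℕ} (D : (p : ZMod 2) → Module.End ℂ (W m n p))
    (g : (p : ZMod 2) → (W m n p ≃ₗ[ℂ] W m n p)) : Prop :=
  ∀ (p : ZMod 2) (X : W m n p) (l : W m n p →ₗ[ℂ] ℂ), IsContFunctional l →
    HasSum (fun j : ℕ => l ((j.factorial : ℂ)⁻¹ • ((D p) ^ j) X)) (l (g p X))

/-- The group `G` of inner automorphisms of `Der W(m,n)`, acting on `W(m,n)`: it is generated by the
exponentials of the exponentiable even elements of `Der W(m,n)`. -/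
def innerGroup (m n : ℕ) : Subgroup ((p : ZMod 2) → (W m n p ≃ₗ[ℂ] W m n p)) :=
  Subgroup.closure {g | ∃ D, IsEvenDer D ∧ IsExp D g}

/-- The image of `L` under `g`. -/
def conj {m n : ℕ} (g : (p : ZMod 2) → (W m n p ≃ₗ[ℂ] W m n p)) (L : GradedSubspace m n) :
    GradedSubspace m n :=
  fun p => (L p).map (g p).toLinearMap

end

end SuperW

namespace SuperW

noncomputable section

open MvPowerSeries

/-! ### Signs -/

/-! Write 𝔪 for the maximal ideal of Λ = Λ(m,n) and, for a set A of odd indices, I_A for the ideal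
generated by all x_i and by the ξ_j with j ∉ A. The subalgebra L_k is the stabilizer of I_A, where A
consists of the last k indices (`stdSubalg_eq_stab`). The classification thus becomes one of
invariant ideals.

The basic fact is `eq_top_of_even_transitive`: an open subalgebra containing an even field X with
X(x_i)(0) ≠ 0 is all of W, because X g = f can be solved to leading order and so the subalgebra
contains fields of lower and lower order. Hence the ∂/∂x_i-components of a proper open subalgebra
all vanish at the origin.

Every maximal L is conjugate to some L_k. The span ΛL is a subalgebra whose ∂/∂x_i-components still
vanish at the origin, so it is proper and L = ΛL. Take a maximal family of odd fields D_a in L, a ∈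
A, with D_a(ξ_b) = δ_ab (`exists_frame`). The elements of L that kill these ξ_a vanish at the
origin, so they preserve 𝔪. Starting from 𝔪 and imposing stability under one D_a after another gives
an L-invariant ideal J complementary in Λ to the Grassmann algebra on the ξ_a
(`exists_invariant_ideal`). Since L ⊆ stab J ≠ W, maximality gives L = stab J. Subtracting from each
generator of I_A its residue modulo J is the exponential of a nilpotent even field, and it carries
I_A onto J (`exists_conj_stab_ideal`). Exponentials of transvections among the ξ_j then move A to
the last |A| indices (`exists_conj_coordIdeal`).

The stabilizer of I_A is maximal (`isMaximalOpenSubalg_stab_coordIdeal`): a larger proper subalgebra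
still takes values vanishing at the origin on the generators of I_A, by bracketing with ξ_j ∂/∂x_1.
Its values are moreover stable under ∂/∂ξ_a, a ∈ A, and a nonzero element of the Grassmann algebra
on these ξ_a could be differentiated down to a nonzero constant.

For uniqueness, the group G preserves the fields vanishing at the origin
(`mem_nhd_one_iff_of_mem_innerGroup`), so the dimension |A| of the space of odd values at the origin
of stab I_A is an invariant. To leading order a derivation D is ad U, with U the image of the Euler
field (`IsEvenDer.sub_comm_mem`). If U moved the origin, the exponential series of D would diverge
on a suitable power-series field (`IsExp.map_euler_mem`). So U vanishes at the origin, and D and its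
exponential preserve the isotropy subalgebra. -/

theorem zmod_two_cases (p : ZMod 2) : p = 0 ∨ p = 1 := by revert p; decide

theorem zmod_two_one_add_one : (1 + 1 : ZMod 2) = 0 := by decide

theorem zmod_two_add_self (p : ZMod 2) : p + p = 0 := by revert p; decide

theorem sgn_zero_left (q : ZMod 2) : sgn 0 q = 1 := by simp [sgn]

theorem sgn_zero_right (q : ZMod 2) : sgn q 0 = 1 := by simp [sgn]

theorem sgn_one_one : sgn 1 1 = -1 := sgn_values.2.2.2

theorem sgn_comm (p q : ZMod 2) : sgn p q = sgn q p := by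
  rw [sgn, sgn, mul_comm]

theorem sgn_add_left (p q r : ZMod 2) : sgn (p + q) r = sgn p r * sgn q r := by
  rcases zmod_two_cases p with rfl | rfl <;> rcases zmod_two_cases q with rfl | rfl <;>
    rcases zmod_two_cases r with rfl | rfl <;>
    simp [sgn_zero_left, sgn_zero_right, sgn_one_one, zmod_two_one_add_one]

theorem sgn_add_right (p q r : ZMod 2) : sgn p (q + r) = sgn p q * sgn p r := by
  rw [sgn_comm, sgn_add_left, sgn_comm q, sgn_comm r]

theorem sgn_mul_self (p q : ZMod 2) : sgn p q * sgn p q = 1 := by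
  rcases zmod_two_cases p with rfl | rfl <;> rcases zmod_two_cases q with rfl | rfl <;>
    simp [sgn_zero_left, sgn_zero_right, sgn_one_one]

/-! ### The Grassmann algebra -/

/-- The Grassmann algebra on `n` generators. -/
abbrev Gr (n : ℕ) : Type := ExteriorAlgebra ℂ (Fin n → ℂ)

/-- The homogeneous component of the Grassmann algebra of parity `p`. -/
abbrev grPart (n : ℕ) (p : ZMod 2) : Submodule ℂ (Gr n) :=
  CliffordAlgebra.evenOdd (0 : QuadraticForm ℂ (Fin n → ℂ)) p

/-- The product of the generators in a list. -/
def word {n : ℕ} (l : List (Fin n)) : Gr n := (l.map (grass n)).prod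

@[simp] theorem word_nil {n : ℕ} : word ([] : List (Fin n)) = 1 := rfl

@[simp] theorem word_cons {n : ℕ} (j : Fin n) (l : List (Fin n)) :
    word (j :: l) = grass n j * word l := by simp [word]

theorem word_append {n : ℕ} (l l' : List (Fin n)) : word (l ++ l') = word l * word l' := by
  simp [word]

theorem grass_mul_swap {n : ℕ} (i j : Fin n) : grass n i * grass n j = -(grass n j * grass n i) :=
  eq_neg_of_add_eq_zero_left (ExteriorAlgebra.ι_add_mul_swap _ _)

theorem grass_mul_self {n : ℕ} (j : Fin n) : grass n j * grass n j = 0 :=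
  ExteriorAlgebra.ι_sq_zero _

theorem ι_eq_sum_grass {n : ℕ} (v : Fin n → ℂ) :
    ExteriorAlgebra.ι ℂ v = ∑ j, v j • grass n j := by
  conv_lhs => rw [pi_eq_sum_univ' v]
  simp only [map_sum, map_smul, grass]

theorem span_word (n : ℕ) : Submodule.span ℂ (Set.range (word (n := n))) = ⊤ := by
  set S := Submodule.span ℂ (Set.range (word (n := n)))
  have hw : ∀ l, word l ∈ S := fun l => Submodule.subset_span ⟨l, rfl⟩
  have hmul : ∀ a ∈ S, ∀ b ∈ S, a * b ∈ S := by
    intro a ha b hb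
    have h := Submodule.mul_mem_mul ha hb
    rw [Submodule.span_mul_span] at h
    refine Submodule.span_mono ?_ h
    rintro _ ⟨_, ⟨l, rfl⟩, _, ⟨l', rfl⟩, rfl⟩
    exact ⟨l ++ l', word_append l l'⟩
  refine eq_top_iff.mpr fun a _ => ?_
  induction a using ExteriorAlgebra.induction with
  | algebraMap r =>
    rw [Algebra.algebraMap_eq_smul_one]
    exact S.smul_mem r (hw [])
  | ι v =>
    rw [ι_eq_sum_grass]
    exact S.sum_mem fun j _ => S.smul_mem _ (by simpa using hw [j])
  | mul a b ha hb => exact hmul a (ha trivial) b (hb trivial)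
  | add a b ha hb => exact S.add_mem (ha trivial) (hb trivial)

theorem grass_mem (n : ℕ) (j : Fin n) : grass n j ∈ grPart n 1 :=
  CliffordAlgebra.ι_mem_evenOdd_one _ _

theorem one_mem_grPart (n : ℕ) : (1 : Gr n) ∈ grPart n 0 :=
  CliffordAlgebra.one_le_evenOdd_zero _ (Submodule.one_le.mp le_rfl)

theorem grPart_mul {n : ℕ} {p q : ZMod 2} {a b : Gr n} (ha : a ∈ grPart n p)
    (hb : b ∈ grPart n q) : a * b ∈ grPart n (p + q) :=
  CliffordAlgebra.evenOdd_mul_le _ p q (Submodule.mul_mem_mul ha hb)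

theorem word_mem {n : ℕ} (l : List (Fin n)) : word l ∈ grPart n (l.length : ZMod 2) := by
  induction l with
  | nil => simpa using one_mem_grPart n
  | cons j l ih =>
    rw [word_cons, List.length_cons, Nat.cast_add, Nat.cast_one, add_comm]
    exact grPart_mul (grass_mem n j) ih

theorem grPart_disjoint {n : ℕ} {a : Gr n} (p : ZMod 2) (h₀ : a ∈ grPart n p)
    (h₁ : a ∈ grPart n (1 + p)) : a = 0 := by
  have h := (CliffordAlgebra.evenOdd_isCompl (0 : QuadraticForm ℂ (Fin n → ℂ))).disjoint
  rw [Submodule.disjoint_def] at h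
  rcases zmod_two_cases p with rfl | rfl
  · exact h a h₀ (by simpa using h₁)
  · exact h a (by simpa [zmod_two_one_add_one] using h₁) h₀

theorem exists_grPart_add (n : ℕ) (a : Gr n) :
    ∃ b ∈ grPart n 0, ∃ c ∈ grPart n 1, b + c = a := by
  have h := (CliffordAlgebra.evenOdd_isCompl (0 : QuadraticForm ℂ (Fin n → ℂ))).sup_eq_top
  exact Submodule.mem_sup.mp (h ▸ Submodule.mem_top)

/-- The homogeneous component of parity `p` is spanned by the words whose length has parity `p`. -/
theorem grPart_eq_span (n : ℕ) (p : ZMod 2) :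
    grPart n p = Submodule.span ℂ {w | ∃ l : List (Fin n), (l.length : ZMod 2) = p ∧ w = word l} := by
  set S : ZMod 2 → Submodule ℂ (Gr n) := fun p =>
    Submodule.span ℂ {w | ∃ l : List (Fin n), (l.length : ZMod 2) = p ∧ w = word l}
  have hS : ∀ p, S p ≤ grPart n p := fun p => Submodule.span_le.mpr (by
    rintro _ ⟨l, rfl, rfl⟩
    exact word_mem l)
  refine le_antisymm (fun a ha => ?_) (hS p)
  have htop : a ∈ S p ⊔ S (1 + p) := by
    have : Submodule.span ℂ (Set.range (word (n := n))) ≤ S p ⊔ S (1 + p) := by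
      refine Submodule.span_le.mpr ?_
      rintro _ ⟨l, rfl⟩
      by_cases h : (l.length : ZMod 2) = p
      · exact Submodule.mem_sup_left (Submodule.subset_span ⟨l, h, rfl⟩)
      · refine Submodule.mem_sup_right (Submodule.subset_span ⟨l, ?_, rfl⟩)
        revert h
        generalize (l.length : ZMod 2) = q
        clear ha
        revert p q
        decide
    exact this (span_word n ▸ Submodule.mem_top)
  -- The summand `c` has parity `1 + p` as a combination of words and parity `p` as a difference, so
  -- it vanishes.
  obtain ⟨b, hb, c, hc, rfl⟩ := Submodule.mem_sup.mp htop
  have : c ∈ grPart n p := by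
    have := Submodule.sub_mem _ ha (hS p hb)
    rwa [add_sub_cancel_left] at this
  rw [grPart_disjoint p this (hS _ hc), add_zero]
  exact hb

theorem grass_mul_word {n : ℕ} (j : Fin n) (l : List (Fin n)) :
    grass n j * word l = sgn 1 l.length • (word l * grass n j) := by
  induction l with
  | nil => simp [sgn_zero_right]
  | cons i l ih =>
    rw [word_cons, ← mul_assoc, grass_mul_swap, neg_mul, mul_assoc, ih, mul_smul_comm,
      List.length_cons, Nat.cast_add, Nat.cast_one, sgn_add_right, sgn_one_one, mul_neg_one,
      neg_smul, mul_assoc]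

theorem word_mul_word {n : ℕ} (l l' : List (Fin n)) :
    word l * word l' = sgn l.length l'.length • (word l' * word l) := by
  induction l with
  | nil => simp [sgn_zero_left]
  | cons i l ih =>
    rw [word_cons, mul_assoc, ih, mul_smul_comm, ← mul_assoc, grass_mul_word, smul_mul_assoc,
      smul_smul, List.length_cons, Nat.cast_add, Nat.cast_one, sgn_add_left, mul_assoc]

theorem grPart_supercomm {n : ℕ} {p q : ZMod 2} {a b : Gr n} (ha : a ∈ grPart n p)
    (hb : b ∈ grPart n q) : a * b = sgn p q • (b * a) := by
  rw [grPart_eq_span] at ha hb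
  induction ha using Submodule.span_induction with
  | mem a ha =>
    obtain ⟨l, rfl, rfl⟩ := ha
    induction hb using Submodule.span_induction with
    | mem b hb =>
      obtain ⟨l', rfl, rfl⟩ := hb
      exact word_mul_word l l'
    | zero => simp
    | add x y _ _ hx hy => rw [mul_add, add_mul, hx, hy, smul_add]
    | smul c x _ hx => rw [mul_smul_comm, smul_mul_assoc, hx, smul_comm]
  | zero => simp
  | add x y _ _ hx hy => rw [mul_add, add_mul, hx, hy, smul_add]
  | smul c x _ hx => rw [mul_smul_comm, smul_mul_assoc, hx, smul_comm]

/-- The odd derivation `∂/∂ξ_j` of the Grassmann algebra. -/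
def grDer (n : ℕ) (j : Fin n) : Gr n →ₗ[ℂ] Gr n :=
  CliffordAlgebra.contractLeft (Q := 0) (LinearMap.proj j)

theorem grDer_grass_mul {n : ℕ} (j i : Fin n) (a : Gr n) :
    grDer n j (grass n i * a) = (if i = j then 1 else 0 : ℂ) • a - grass n i * grDer n j a := by
  have := CliffordAlgebra.contractLeft_ι_mul (Q := 0) (LinearMap.proj j : Module.Dual ℂ (Fin n → ℂ))
    (Pi.single i 1) a
  simp only [LinearMap.proj_apply, Pi.single_apply, eq_comm (a := j)] at this
  exact this

@[simp] theorem grDer_one {n : ℕ} (j : Fin n) : grDer n j 1 = 0 :=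
  CliffordAlgebra.contractLeft_one (Q := 0) (LinearMap.proj j : Module.Dual ℂ (Fin n → ℂ))

theorem grDer_grass {n : ℕ} (j i : Fin n) : grDer n j (grass n i) = if i = j then 1 else 0 := by
  have := grDer_grass_mul j i 1
  rw [mul_one, grDer_one, mul_zero, sub_zero] at this
  rw [this]
  split_ifs <;> simp

theorem grDer_word_mem {n : ℕ} (j : Fin n) (l : List (Fin n)) :
    grDer n j (word l) ∈ grPart n (1 + l.length) := by
  induction l with
  | nil => simp
  | cons i l ih =>
    rw [word_cons, grDer_grass_mul, List.length_cons, Nat.cast_add, Nat.cast_one, add_comm 1,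
      add_assoc, zmod_two_one_add_one, add_zero]
    refine Submodule.sub_mem _ (Submodule.smul_mem _ _ (word_mem l)) ?_
    have := grPart_mul (grass_mem n i) ih
    rwa [← add_assoc, zmod_two_one_add_one, zero_add] at this

theorem grDer_mem {n : ℕ} (j : Fin n) {p : ZMod 2} {a : Gr n} (ha : a ∈ grPart n p) :
    grDer n j a ∈ grPart n (1 + p) := by
  rw [grPart_eq_span n p] at ha
  have : Submodule.span ℂ {w | ∃ l : List (Fin n), (l.length : ZMod 2) = p ∧ w = word l} ≤
      (grPart n (1 + p)).comap (grDer n j) := by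
    refine Submodule.span_le.mpr ?_
    rintro _ ⟨l, rfl, rfl⟩
    exact grDer_word_mem j l
  exact this ha

theorem grDer_mul {n : ℕ} (j : Fin n) {p : ZMod 2} {a : Gr n} (ha : a ∈ grPart n p) (b : Gr n) :
    grDer n j (a * b) = grDer n j a * b + sgn 1 p • (a * grDer n j b) := by
  rw [grPart_eq_span n p] at ha
  induction ha using Submodule.span_induction with
  | mem a ha =>
    obtain ⟨l, rfl, rfl⟩ := ha
    induction l with
    | nil => simp [sgn_zero_right]
    | cons i l ih =>
      rw [word_cons, mul_assoc, grDer_grass_mul, ih, grDer_grass_mul, List.length_cons,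
        Nat.cast_add, Nat.cast_one, sgn_add_right, sgn_one_one, sub_mul, smul_mul_assoc, mul_add,
        mul_neg_one, neg_smul, mul_smul_comm, mul_assoc, mul_assoc]
      abel
  | zero => simp
  | add x y _ _ hx hy => simp only [add_mul, map_add, hx, hy, smul_add]; abel
  | smul c x _ hx => simp only [smul_mul_assoc, map_smul, hx, smul_add, smul_comm c]

/-! ### Augmentation, nilpotent elements and units of the Grassmann algebra. -/

/-- The augmentation of the Grassmann algebra. -/
abbrev grAug (n : ℕ) : Gr n →ₐ[ℂ] ℂ := ExteriorAlgebra.algebraMapInv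

@[simp] theorem grAug_grass (n : ℕ) (j : Fin n) : grAug n (grass n j) = 0 := by
  simp [grAug, ExteriorAlgebra.algebraMapInv, grass]

/-- A repeated letter can be moved, up to sign, next to its other occurrence, and ξ_j² = 0. -/
theorem word_eq_zero_of_not_nodup {n : ℕ} (l : List (Fin n)) (h : ¬ l.Nodup) : word l = 0 := by
  induction l with
  | nil => simp at h
  | cons j l ih =>
    rw [word_cons]
    by_cases hl : l.Nodup
    · have hj : j ∈ l := by
        by_contra hj
        exact h (List.nodup_cons.mpr ⟨hj, hl⟩)
      obtain ⟨s, t, rfl⟩ := List.append_of_mem hj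
      rw [word_append, word_cons, ← mul_assoc, grass_mul_word, smul_mul_assoc, mul_assoc,
        ← mul_assoc (grass n j), grass_mul_self, zero_mul, mul_zero, smul_zero]
    · rw [ih hl, mul_zero]

theorem word_eq_zero_of_length {n : ℕ} (l : List (Fin n)) (h : n < l.length) : word l = 0 := by
  refine word_eq_zero_of_not_nodup l fun hl => ?_
  have := hl.length_le_card
  rw [Fintype.card_fin] at this
  omega

/-- The span of the words of length at least `r`. -/
def grPow (n r : ℕ) : Submodule ℂ (Gr n) :=
  Submodule.span ℂ {w | ∃ l : List (Fin n), r ≤ l.length ∧ w = word l}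

theorem word_mem_grPow {n r : ℕ} {l : List (Fin n)} (h : r ≤ l.length) : word l ∈ grPow n r :=
  Submodule.subset_span ⟨l, h, rfl⟩

theorem grPow_mul {n r s : ℕ} {a b : Gr n} (ha : a ∈ grPow n r) (hb : b ∈ grPow n s) :
    a * b ∈ grPow n (r + s) := by
  have h := Submodule.mul_mem_mul ha hb
  rw [grPow, grPow, Submodule.span_mul_span] at h
  refine Submodule.span_mono ?_ h
  rintro _ ⟨_, ⟨l, hl, rfl⟩, _, ⟨l', hl', rfl⟩, rfl⟩
  exact ⟨l ++ l', by simp; omega, (word_append l l').symm⟩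

theorem grPow_eq_bot {n r : ℕ} (h : n < r) : grPow n r = ⊥ := by
  refine eq_bot_iff.mpr (Submodule.span_le.mpr ?_)
  rintro _ ⟨l, hl, rfl⟩
  simpa using word_eq_zero_of_length l (by omega)

/-- The generators stand on the right because `Ideal` means left ideal in this noncommutative ring.
-/
theorem exists_eq_add_sum_mul_grass {n : ℕ} (a : Gr n) :
    ∃ g : Fin n → Gr n, a = algebraMap ℂ (Gr n) (grAug n a) + ∑ j, g j * grass n j := by
  have ha : a ∈ Submodule.span ℂ (Set.range (word (n := n))) := span_word n ▸ Submodule.mem_top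
  induction ha using Submodule.span_induction with
  | mem a ha =>
    obtain ⟨l, rfl⟩ := ha
    rcases List.eq_nil_or_concat' l with rfl | ⟨l, j, rfl⟩
    · exact ⟨0, by simp⟩
    · refine ⟨Pi.single j (word l), ?_⟩
      rw [Finset.sum_eq_single j (fun i _ hi => by rw [Pi.single_eq_of_ne hi, zero_mul])
        (fun h => absurd (Finset.mem_univ j) h), word_append, word_cons, word_nil, mul_one,
        map_mul, grAug_grass]
      simp
  | zero => exact ⟨0, by simp⟩
  | add x y _ _ hx hy =>
    obtain ⟨g, hg⟩ := hx
    obtain ⟨h, hh⟩ := hy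
    refine ⟨g + h, ?_⟩
    conv_lhs => rw [hg, hh]
    simp only [map_add, Pi.add_apply, add_mul, Finset.sum_add_distrib]
    abel
  | smul c x _ hx =>
    obtain ⟨g, hg⟩ := hx
    refine ⟨c • g, ?_⟩
    conv_lhs => rw [hg]
    simp only [map_smul, Pi.smul_apply, smul_mul_assoc, smul_add, Finset.smul_sum, smul_eq_mul,
      Algebra.algebraMap_eq_smul_one, smul_smul]

theorem mem_grPow_one_iff {n : ℕ} {a : Gr n} : a ∈ grPow n 1 ↔ grAug n a = 0 := by
  constructor
  · intro ha
    have : grPow n 1 ≤ LinearMap.ker (grAug n).toLinearMap := by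
      refine Submodule.span_le.mpr ?_
      rintro _ ⟨l, hl, rfl⟩
      cases l with
      | nil => simp at hl
      | cons j l => simp
    exact this ha
  · intro h
    obtain ⟨g, hg⟩ := exists_eq_add_sum_mul_grass a
    rw [hg, h, map_zero, zero_add]
    refine Submodule.sum_mem _ fun j _ => ?_
    refine grPow_mul (r := 0) (s := 1) ?_ (by simpa using word_mem_grPow (l := [j]) (r := 1))
    rw [grPow]
    simp only [zero_le, true_and]
    have : {w | ∃ l : List (Fin n), w = word l} = Set.range word := by ext; simp [eq_comm]
    rw [this, span_word]
    trivial

theorem pow_mem_grPow {n : ℕ} {a : Gr n} (h : grAug n a = 0) (r : ℕ) : a ^ r ∈ grPow n r := by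
  induction r with
  | zero => simpa using word_mem_grPow (n := n) (l := []) (r := 0)
  | succ r ih => exact pow_succ a r ▸ grPow_mul ih (mem_grPow_one_iff.mpr h)

theorem isNilpotent_of_grAug_eq_zero {n : ℕ} {a : Gr n} (h : grAug n a = 0) : IsNilpotent a :=
  ⟨n + 1, by simpa [grPow_eq_bot (Nat.lt_succ_self n)] using pow_mem_grPow h (n + 1)⟩

theorem isUnit_of_grAug_ne_zero {n : ℕ} {a : Gr n} (h : grAug n a ≠ 0) : IsUnit a := by
  have h₁ : IsNilpotent (a - algebraMap ℂ (Gr n) (grAug n a)) :=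
    isNilpotent_of_grAug_eq_zero (by simp)
  have h₂ : IsUnit (algebraMap ℂ (Gr n) (grAug n a)) := (isUnit_iff_ne_zero.mpr h).map _
  have := h₁.isUnit_add_left_of_commute h₂ (Algebra.commutes _ _).symm
  rwa [add_sub_cancel] at this

/-! ### Parity in `Λ(m,n)` -/

section Parity

variable {m n : ℕ}

/-- The parity of the indeterminates of `Λ(m,n)`. -/
def par (m n : ℕ) : Fin m ⊕ Fin n → ZMod 2 := Sum.elim (fun _ => 0) (fun _ => 1)

@[simp] theorem par_inl (i : Fin m) : par m n (Sum.inl i) = 0 := rfl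

@[simp] theorem par_inr (j : Fin n) : par m n (Sum.inr j) = 1 := rfl

@[simp] theorem gen_inl (i : Fin m) : gen m n (Sum.inl i) = X i := rfl

@[simp] theorem gen_inr (j : Fin n) : gen m n (Sum.inr j) = C (grass n j) := rfl

theorem C_mem_parityPart {p : ZMod 2} {a : Gr n} (ha : a ∈ grPart n p) :
    (C a : Lam m n) ∈ parityPart m n p := by
  classical
  intro d
  rw [coeff_C]
  split_ifs
  · exact ha
  · exact Submodule.zero_mem _

theorem one_mem_parityPart : (1 : Lam m n) ∈ parityPart m n 0 :=
  C_mem_parityPart (one_mem_grPart n)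

theorem gen_mem_parityPart (s : Fin m ⊕ Fin n) : gen m n s ∈ parityPart m n (par m n s) := by
  classical
  rcases s with i | j
  · intro d
    rw [gen_inl, coeff_X, par_inl]
    split_ifs
    · exact one_mem_grPart n
    · exact Submodule.zero_mem _
  · exact C_mem_parityPart (grass_mem n j)

theorem parityPart_mul {p q : ZMod 2} {f g : Lam m n} (hf : f ∈ parityPart m n p)
    (hg : g ∈ parityPart m n q) : f * g ∈ parityPart m n (p + q) := by
  classical
  intro d
  rw [coeff_mul]
  exact Submodule.sum_mem _ fun x _ => grPart_mul (hf x.1) (hg x.2)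

theorem supercomm {p q : ZMod 2} {f g : Lam m n} (hf : f ∈ parityPart m n p)
    (hg : g ∈ parityPart m n q) : f * g = sgn p q • (g * f) := by
  classical
  ext d
  rw [coeff_mul]
  change _ = sgn p q • coeff d (g * f)
  rw [coeff_mul, Finset.smul_sum]
  refine Finset.sum_nbij' Prod.swap Prod.swap ?_ ?_ ?_ ?_ ?_
  · simp [add_comm]
  · simp [add_comm]
  · simp
  · simp
  · intro x _
    exact grPart_supercomm (hf x.1) (hg x.2)

theorem parityPart_disjoint {f : Lam m n} (p : ZMod 2) (h₀ : f ∈ parityPart m n p)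
    (h₁ : f ∈ parityPart m n (1 + p)) : f = 0 :=
  MvPowerSeries.ext fun d => grPart_disjoint p (h₀ d) (h₁ d)

theorem exists_parityPart_add (f : Lam m n) :
    ∃ g ∈ parityPart m n 0, ∃ h ∈ parityPart m n 1, g + h = f := by
  choose g hg h hh e using fun d => exists_grPart_add n (coeff d f)
  exact ⟨fun d => g d, hg, fun d => h d, hh, MvPowerSeries.ext e⟩

/-- To prove an additive property of all elements, it suffices to treat the homogeneous ones. -/
@[elab_as_elim]
theorem parity_induction {P : Lam m n → Prop} (f : Lam m n)
    (hom : ∀ p, ∀ f ∈ parityPart m n p, P f) (add : ∀ f g, P f → P g → P (f + g)) : P f := by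
  obtain ⟨g, hg, h, hh, rfl⟩ := exists_parityPart_add f
  exact add _ _ (hom 0 g hg) (hom 1 h hh)

theorem parityPart_cast {p q : ZMod 2} (h : p = q) {f : Lam m n} (hf : f ∈ parityPart m n p) :
    f ∈ parityPart m n q := h ▸ hf

end Parity

/-! ### The augmentation -/

section Aug

variable {m n : ℕ}

/-- The evaluation of series at the origin. -/
def aug (m n : ℕ) : Lam m n →ₐ[ℂ] ℂ :=
  { (grAug n).toRingHom.comp (constantCoeff (σ := Fin m) (R := Gr n)) with
    commutes' := fun r => by
      change grAug n (constantCoeff (algebraMap ℂ (Lam m n) r)) = r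
      rw [MvPowerSeries.algebraMap_apply, constantCoeff_C]
      simp }

theorem aug_apply (f : Lam m n) : aug m n f = grAug n (constantCoeff f) := rfl

@[simp] theorem aug_gen (s : Fin m ⊕ Fin n) : aug m n (gen m n s) = 0 := by
  rcases s with i | j
  · simp [aug_apply]
  · simp [aug_apply]

@[simp] theorem aug_C (a : Gr n) : aug m n (C a) = grAug n a := by simp [aug_apply]

theorem smul_eq_C_algebraMap_mul (c : ℂ) (f : Lam m n) :
    c • f = C (algebraMap ℂ (Gr n) c) * f := by
  rw [Algebra.smul_def, MvPowerSeries.algebraMap_apply]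

/-- A series is its constant term plus a combination of the even indeterminates. -/
theorem exists_eq_C_add_sum_mul_X (f : Lam m n) :
    ∃ g : Fin m → Lam m n, f = C (constantCoeff f) + ∑ i, g i * X i := by
  classical
  -- Each nonconstant monomial is assigned to the least index `i` whose variable divides it, so that
  -- the quotients by the `X i` do not overlap.
  have key : ∀ i, ∃ h : Lam m n, ∀ d, coeff d h =
      if ∀ k < i, d k = 0 then coeff (d + Finsupp.single i 1) f else 0 := fun i => ⟨fun d => _, fun d => rfl⟩
  choose g hg using key
  refine ⟨g, ?_⟩
  ext d
  rw [map_add, map_sum]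
  by_cases hd : d = 0
  · subst hd
    simp
  · rw [coeff_C, if_neg hd, zero_add]
    obtain ⟨i, hi, hmin⟩ : ∃ i, d i ≠ 0 ∧ ∀ k < i, d k = 0 := by
      have hne : d.support.Nonempty := Finsupp.support_nonempty_iff.mpr hd
      refine ⟨d.support.min' hne, Finsupp.mem_support_iff.mp (d.support.min'_mem hne),
        fun k hk => ?_⟩
      by_contra h
      exact absurd (d.support.min'_le k (Finsupp.mem_support_iff.mpr h)) (not_le.mpr hk)
    have hle : Finsupp.single i 1 ≤ d := by
      rw [Finsupp.single_le_iff]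
      omega
    rw [Finset.sum_eq_single i]
    · rw [X_def, coeff_mul_monomial, if_pos hle, mul_one, hg, if_pos, tsub_add_cancel_of_le hle]
      intro k hk
      rw [Finsupp.tsub_apply, hmin k hk, zero_tsub]
    · intro k _ hk
      rw [X_def, coeff_mul_monomial]
      split_ifs with hle'
      · rw [mul_one, hg]
        rw [Finsupp.single_le_iff] at hle'
        rw [if_neg]
        intro h
        rcases lt_or_gt_of_ne hk with hlt | hlt
        · have := hmin k hlt
          omega
        · have := h i hlt
          rw [Finsupp.tsub_apply, Finsupp.single_eq_of_ne hlt.ne] at this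
          exact hi this
      · rfl
    · exact fun h => absurd (Finset.mem_univ i) h

theorem exists_eq_aug_add_sum_mul_gen (f : Lam m n) :
    ∃ g : Fin m ⊕ Fin n → Lam m n, f = aug m n f • 1 + ∑ s, g s * gen m n s := by
  obtain ⟨g, hg⟩ := exists_eq_C_add_sum_mul_X f
  obtain ⟨h, hh⟩ := exists_eq_add_sum_mul_grass (constantCoeff f)
  refine ⟨Sum.elim g fun j => C (h j), ?_⟩
  conv_lhs => rw [hg, hh]
  rw [Fintype.sum_sum_type, map_add, map_sum, aug_apply, smul_eq_C_algebraMap_mul, mul_one]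
  simp only [Sum.elim_inl, Sum.elim_inr, gen_inl, gen_inr, map_mul]
  abel

theorem mem_maxIdeal_iff {f : Lam m n} : f ∈ maxIdeal m n ↔ aug m n f = 0 := by
  constructor
  · intro h
    have : maxIdeal m n ≤ RingHom.ker (aug m n) := by
      refine Ideal.span_le.mpr ?_
      rintro _ ⟨s, rfl⟩
      simp [RingHom.mem_ker]
    exact this h
  · intro h
    obtain ⟨g, hg⟩ := exists_eq_aug_add_sum_mul_gen f
    rw [hg, h, zero_smul, zero_add]
    exact Ideal.sum_mem _ fun s _ => Ideal.mul_mem_left _ _ (Ideal.subset_span ⟨s, rfl⟩)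

theorem aug_eq_zero_of_odd {f : Lam m n} (hf : f ∈ parityPart m n 1) : aug m n f = 0 := by
  have h := hf 0
  rw [aug_apply, ← mem_grPow_one_iff]
  rw [coeff_zero_eq_constantCoeff_apply] at h
  have h' : constantCoeff f ∈ grPart n 1 := h
  rw [grPart_eq_span] at h'
  refine Submodule.span_mono ?_ h'
  rintro _ ⟨l, hl, rfl⟩
  refine ⟨l, ?_, rfl⟩
  rcases Nat.eq_zero_or_pos l.length with h0 | h0
  · rw [h0] at hl
    exact absurd hl (by decide)
  · exact h0

theorem gen_mem_maxIdeal (s : Fin m ⊕ Fin n) : gen m n s ∈ maxIdeal m n := by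
  simp [mem_maxIdeal_iff]

theorem maxIdeal_mul_right {f : Lam m n} (hf : f ∈ maxIdeal m n) (g : Lam m n) :
    f * g ∈ maxIdeal m n := by
  rw [mem_maxIdeal_iff] at hf ⊢
  rw [map_mul, hf, zero_mul]

theorem mem_maxIdeal_pow_zero (f : Lam m n) : f ∈ maxIdeal m n ^ 0 := by
  rw [Submodule.pow_zero, Ideal.one_eq_top]
  trivial

theorem maxIdeal_pow_one : maxIdeal m n ^ 1 = maxIdeal m n := Submodule.pow_one _

theorem maxIdeal_pow_le {N M : ℕ} (h : N ≤ M) : maxIdeal m n ^ M ≤ maxIdeal m n ^ N :=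
  Ideal.pow_le_pow_right h

/-- The maximal ideal is the kernel of the augmentation, hence two-sided; absorbing `g` into the
last factor of a product gives the same for its powers. -/
theorem maxIdeal_pow_mul_right {N : ℕ} {f : Lam m n} (hf : f ∈ maxIdeal m n ^ N) (g : Lam m n) :
    f * g ∈ maxIdeal m n ^ N := by
  cases N with
  | zero => exact mem_maxIdeal_pow_zero _
  | succ N =>
    rw [Submodule.pow_succ] at hf ⊢
    refine Submodule.smul_induction_on hf (fun a ha b hb => ?_) fun a b ha hb => ?_
    · rw [smul_eq_mul, mul_assoc]
      exact Ideal.mul_mem_mul ha (maxIdeal_mul_right hb g)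
    · rw [add_mul]
      exact add_mem ha hb

theorem smul_mem_ideal (I : Ideal (Lam m n)) (c : ℂ) {f : Lam m n} (hf : f ∈ I) : c • f ∈ I := by
  rw [smul_eq_C_algebraMap_mul]
  exact I.mul_mem_left _ hf

theorem maxIdeal_pow_mul {N M : ℕ} {f g : Lam m n} (hf : f ∈ maxIdeal m n ^ N)
    (hg : g ∈ maxIdeal m n ^ M) : f * g ∈ maxIdeal m n ^ (N + M) := by
  rcases Nat.eq_zero_or_pos M with rfl | hM
  · exact maxIdeal_pow_mul_right hf g
  · rw [Submodule.pow_add _ hM.ne']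
    exact Ideal.mul_mem_mul hf hg

theorem maxIdeal_pow_mul_gen {N : ℕ} {f : Lam m n} (hf : f ∈ maxIdeal m n ^ N)
    (s : Fin m ⊕ Fin n) : f * gen m n s ∈ maxIdeal m n ^ (N + 1) :=
  maxIdeal_pow_mul hf (by rw [maxIdeal_pow_one]; exact gen_mem_maxIdeal s)

@[elab_as_elim]
theorem maxIdeal_pow_succ_induction {N : ℕ} {P : Lam m n → Prop} {f : Lam m n}
    (hf : f ∈ maxIdeal m n ^ (N + 1)) (zero : P 0)
    (mul : ∀ a ∈ maxIdeal m n ^ N, ∀ s, P (a * gen m n s))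
    (add : ∀ f g, P f → P g → P (f + g)) : P f := by
  rw [Submodule.pow_succ] at hf
  refine Submodule.smul_induction_on hf (fun a ha b hb => ?_) add
  obtain ⟨g, hg⟩ := exists_eq_aug_add_sum_mul_gen b
  rw [mem_maxIdeal_iff.mp hb, zero_smul, zero_add] at hg
  rw [hg, smul_eq_mul, Finset.mul_sum]
  refine Finset.sum_induction _ P add zero fun s _ => ?_
  rw [← mul_assoc]
  exact mul _ (maxIdeal_pow_mul_right ha _) s

/-- The powers are graded ideals because the generators are homogeneous. This is needed because the
signed Leibniz rule applies only when the first factor is homogeneous. -/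
theorem exists_parityPart_add_of_mem_maxIdeal_pow {N : ℕ} {f : Lam m n}
    (hf : f ∈ maxIdeal m n ^ N) :
    ∃ g ∈ parityPart m n 0, ∃ h ∈ parityPart m n 1,
      g ∈ maxIdeal m n ^ N ∧ h ∈ maxIdeal m n ^ N ∧ g + h = f := by
  induction N generalizing f with
  | zero =>
    obtain ⟨g, hg, h, hh, e⟩ := exists_parityPart_add f
    exact ⟨g, hg, h, hh, mem_maxIdeal_pow_zero _, mem_maxIdeal_pow_zero _, e⟩
  | succ N ih =>
    refine maxIdeal_pow_succ_induction hf ?_ (fun a ha s => ?_) ?_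
    · exact ⟨0, Submodule.zero_mem _, 0, Submodule.zero_mem _, Ideal.zero_mem _, Ideal.zero_mem _,
        add_zero 0⟩
    · obtain ⟨g, hg, h, hh, hg', hh', rfl⟩ := ih ha
      have h₀ := parityPart_mul hg (gen_mem_parityPart s)
      have h₁ := parityPart_mul hh (gen_mem_parityPart s)
      have h₀' := maxIdeal_pow_mul_gen hg' s
      have h₁' := maxIdeal_pow_mul_gen hh' s
      rcases zmod_two_cases (par m n s) with hs | hs <;> rw [hs] at h₀ h₁
      · exact ⟨_, h₀, _, h₁, h₀', h₁', (add_mul _ _ _).symm⟩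
      · exact ⟨_, h₁, _, h₀, h₁', h₀', by rw [add_mul, add_comm]⟩
    · rintro f f' ⟨g, hg, h, hh, hg', hh', rfl⟩ ⟨k, hk, l, hl, hk', hl', rfl⟩
      exact ⟨_, Submodule.add_mem _ hg hk, _, Submodule.add_mem _ hh hl, Ideal.add_mem _ hg' hk',
        Ideal.add_mem _ hh' hl', by abel⟩

/-- An induction principle for the powers of the maximal ideal. -/
@[elab_as_elim]
theorem maxIdeal_pow_succ_homogeneous_induction {N : ℕ} {P : Lam m n → Prop} {f : Lam m n}
    (hf : f ∈ maxIdeal m n ^ (N + 1)) (zero : P 0)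
    (mul : ∀ q, ∀ a ∈ parityPart m n q, a ∈ maxIdeal m n ^ N → ∀ s, P (a * gen m n s))
    (add : ∀ f g, P f → P g → P (f + g)) : P f := by
  refine maxIdeal_pow_succ_induction hf zero (fun a ha s => ?_) add
  obtain ⟨g, hg, h, hh, hg', hh', rfl⟩ := exists_parityPart_add_of_mem_maxIdeal_pow ha
  rw [add_mul]
  exact add _ _ (mul 0 g hg hg' s) (mul 1 h hh hh' s)

/-- Elements of nonzero augmentation are invertible, with an inverse of the same parity. -/
theorem exists_even_inverse {u : Lam m n} (hu : u ∈ parityPart m n 0) (h : aug m n u ≠ 0) :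
    ∃ v ∈ parityPart m n 0, v * u = 1 := by
  obtain ⟨w, hw⟩ := isUnit_of_grAug_ne_zero (n := n) (a := constantCoeff u) h
  obtain ⟨g, hg, k, hk, e⟩ := exists_parityPart_add (invOfUnit u w)
  have h₁ : (g + k) * u = 1 := by rw [e]; exact invOfUnit_mul u w hw.symm
  refine ⟨g, hg, ?_⟩
  -- With `g + k` the inverse of `u`, the element `g * u - 1 = -(k * u)` is both even and odd, so
  -- the even part `g` alone inverts `u`.
  have h₂ : g * u - 1 ∈ parityPart m n 0 :=
    Submodule.sub_mem _ (by simpa using parityPart_mul hg hu) one_mem_parityPart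
  have h₃ : g * u - 1 ∈ parityPart m n (1 + 0) := by
    have : g * u - 1 = -(k * u) := by rw [← h₁, add_mul]; abel
    rw [this]
    exact Submodule.neg_mem _ (parityPart_mul hk hu)
  exact sub_eq_zero.mp (parityPart_disjoint 0 h₂ h₃)

end Aug

/-! ### Superderivations of `Λ(m,n)` -/

section Derivations

variable {m n : ℕ}

/-- The Leibniz rule for an operator of parity `p`. -/
def IsLeibniz (p : ZMod 2) (X : Module.End ℂ (Lam m n)) : Prop :=
  ∀ q, ∀ f ∈ parityPart m n q, ∀ g, X (f * g) = X f * g + sgn p q • (f * X g)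

theorem IsLeibniz.map_one {p : ZMod 2} {X : Module.End ℂ (Lam m n)} (hX : IsLeibniz p X) :
    X 1 = 0 := by
  have := hX 0 1 one_mem_parityPart 1
  simpa [sgn_zero_right] using this

theorem IsLeibniz.map_smul_one {p : ZMod 2} {X : Module.End ℂ (Lam m n)} (hX : IsLeibniz p X)
    (c : ℂ) : X (c • 1) = 0 := by rw [map_smul, hX.map_one, smul_zero]

theorem IsLeibniz.even_mul {X : Module.End ℂ (Lam m n)} (hX : IsLeibniz 0 X) (f g : Lam m n) :
    X (f * g) = X f * g + f * X g := by
  refine parity_induction f (fun p f hf => ?_) fun f f' hf hf' => ?_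
  · rw [hX p f hf, sgn_zero_left, one_smul]
  · rw [add_mul, map_add, hf, hf', map_add]
    noncomm_ring

/-- Constants are killed, so only products `a * gen s` matter. There X(a) · gen s gains one order
over what is already known for X(a), and a · X(gen s) has order `N` by hypothesis. No continuity of
`X` is used. -/
theorem IsLeibniz.mem_maxIdeal_pow {p : ZMod 2} {X : Module.End ℂ (Lam m n)} (hX : IsLeibniz p X)
    {N : ℕ} (hN : ∀ s, X (gen m n s) ∈ maxIdeal m n ^ N) (f : Lam m n) :
    X f ∈ maxIdeal m n ^ N := by
  have key : ∀ r ≤ N, ∀ f, X f ∈ maxIdeal m n ^ r := by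
    intro r
    induction r with
    | zero => exact fun _ f => mem_maxIdeal_pow_zero _
    | succ r ih =>
      intro hr f
      have hf : f - aug m n f • 1 ∈ maxIdeal m n ^ (0 + 1) := by
        rw [zero_add, maxIdeal_pow_one, mem_maxIdeal_iff]
        simp
      have h : X (f - aug m n f • 1) ∈ maxIdeal m n ^ (r + 1) := by
        refine maxIdeal_pow_succ_homogeneous_induction (P := fun f => X f ∈ maxIdeal m n ^ (r + 1))
          hf ?_ (fun q a ha _ s => ?_) fun f g hf hg => ?_
        · rw [map_zero]
          exact Ideal.zero_mem _
        · rw [hX q a ha]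
          refine Ideal.add_mem _ (maxIdeal_pow_mul_gen (ih (by omega) a) s) (smul_mem_ideal _ _ ?_)
          exact Ideal.mul_mem_left _ _ (maxIdeal_pow_le hr (hN s))
        · rw [map_add]
          exact Ideal.add_mem _ hf hg
      rwa [map_sub, hX.map_smul_one, sub_zero] at h
  exact key N le_rfl f

/-- An operator satisfying the Leibniz rule that maps the generators to the `N`-th power of the
maximal ideal raises the order by at least `N - 1`. -/
theorem IsLeibniz.mem_maxIdeal_pow_add {p : ZMod 2} {X : Module.End ℂ (Lam m n)}
    (hX : IsLeibniz p X) {N : ℕ} (hN : ∀ s, X (gen m n s) ∈ maxIdeal m n ^ N) {r : ℕ} {f : Lam m n}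
    (hf : f ∈ maxIdeal m n ^ (r + 1)) : X f ∈ maxIdeal m n ^ (r + N) := by
  induction r generalizing f with
  | zero => simpa using hX.mem_maxIdeal_pow hN f
  | succ r ih =>
    refine maxIdeal_pow_succ_homogeneous_induction (P := fun f => X f ∈ maxIdeal m n ^ (r + 1 + N))
      hf ?_ (fun q a ha ha' s => ?_) fun f g hf hg => ?_
    · rw [map_zero]
      exact Ideal.zero_mem _
    · rw [hX q a ha]
      refine Ideal.add_mem _ ?_ (smul_mem_ideal _ _ (maxIdeal_pow_mul ha' (hN s)))
      have := maxIdeal_pow_mul_gen (ih ha') s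
      rwa [add_right_comm] at this
    · rw [map_add]
      exact Ideal.add_mem _ hf hg

theorem IsLeibniz.lower {p : ZMod 2} {X : Module.End ℂ (Lam m n)} (hX : IsLeibniz p X) {r : ℕ}
    {f : Lam m n} (hf : f ∈ maxIdeal m n ^ (r + 1)) : X f ∈ maxIdeal m n ^ r :=
  hX.mem_maxIdeal_pow_add (N := 0) (fun _ => mem_maxIdeal_pow_zero _) hf

/-- Continuity is automatic: the Leibniz rule alone shows that the order drops by at most one. -/
theorem mem_W_iff {p : ZMod 2} {X : Module.End ℂ (Lam m n)} :
    X ∈ W m n p ↔ (∀ q, ∀ f ∈ parityPart m n q, X f ∈ parityPart m n (p + q)) ∧ IsLeibniz p X :=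
  ⟨fun h => ⟨h.1, h.2.1⟩, fun h => ⟨h.1, h.2, fun N => ⟨N + 1, fun _ hf => h.2.lower hf⟩⟩⟩

theorem leibniz_of_mem {p : ZMod 2} {X : Module.End ℂ (Lam m n)} (hX : X ∈ W m n p) :
    IsLeibniz p X := hX.2.1

theorem parity_of_mem {p : ZMod 2} {X : Module.End ℂ (Lam m n)} (hX : X ∈ W m n p) {q : ZMod 2}
    {f : Lam m n} (hf : f ∈ parityPart m n q) : X f ∈ parityPart m n (p + q) := hX.1 q f hf

/-- A multiple of a vector field by a homogeneous series is a vector field. -/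
theorem mulLeft_mul_mem {p q : ZMod 2} {f : Lam m n} (hf : f ∈ parityPart m n q)
    {X : Module.End ℂ (Lam m n)} (hX : X ∈ W m n p) :
    LinearMap.mulLeft ℂ f * X ∈ W m n (q + p) := by
  refine mem_W_iff.mpr ⟨fun r g hg => ?_, fun r g hg h => ?_⟩
  · rw [add_assoc]
    exact parityPart_mul hf (parity_of_mem hX hg)
  · simp only [Module.End.mul_apply, LinearMap.mulLeft_apply]
    rw [leibniz_of_mem hX r g hg, mul_add, mul_smul_comm, ← mul_assoc f g, supercomm hf hg,
      smul_mul_assoc, smul_smul, sgn_add_left, mul_comm (sgn p r), mul_assoc, mul_assoc]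

/-! ### Coordinate vector fields and fields with prescribed coefficients. -/

/-- The coefficientwise extension of an operator on the Grassmann algebra. -/
def coeffMap (T : Gr n →ₗ[ℂ] Gr n) : Module.End ℂ (Lam m n) := T.compLeft (Fin m →₀ ℕ)

theorem coeff_coeffMap (T : Gr n →ₗ[ℂ] Gr n) (f : Lam m n) (d : Fin m →₀ ℕ) :
    coeff d (coeffMap T f) = T (coeff d f) := rfl

/-- The odd vector field `∂/∂ξ_j`. -/
def derOdd (m n : ℕ) (j : Fin n) : Module.End ℂ (Lam m n) := coeffMap (grDer n j)

/-- The even vector field `∂/∂x_i`. -/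
def derEven (m n : ℕ) (i : Fin m) : Module.End ℂ (Lam m n) where
  toFun f := fun d => ((d i : ℂ) + 1) • coeff (d + Finsupp.single i 1) f
  map_add' f g := MvPowerSeries.ext fun d => by
    change (_ : ℂ) • coeff _ (f + g) = (_ : ℂ) • coeff _ f + (_ : ℂ) • coeff _ g
    rw [map_add, smul_add]
  map_smul' c f := MvPowerSeries.ext fun d => by
    change (_ : ℂ) • c • coeff _ f = c • (_ : ℂ) • coeff _ f
    rw [smul_comm]

theorem coeff_derEven (i : Fin m) (f : Lam m n) (d : Fin m →₀ ℕ) :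
    coeff d (derEven m n i f) = ((d i : ℂ) + 1) • coeff (d + Finsupp.single i 1) f := rfl

theorem derOdd_mem (j : Fin n) : derOdd m n j ∈ W m n 1 := by
  classical
  refine mem_W_iff.mpr ⟨fun q f hf d => grDer_mem j (hf d), fun q f hf g => ?_⟩
  ext d
  rw [derOdd, coeff_coeffMap, map_add]
  change _ = _ + sgn 1 q • coeff d (f * coeffMap (grDer n j) g)
  rw [coeff_mul, coeff_mul, coeff_mul, map_sum, Finset.smul_sum, ← Finset.sum_add_distrib]
  exact Finset.sum_congr rfl fun x _ => grDer_mul j (hf x.1) _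

theorem coeff_add_single_X_mul (i : Fin m) (f : Lam m n) (d : Fin m →₀ ℕ) :
    coeff (d + Finsupp.single i 1) (X i * f) = coeff d f := by
  rw [X_def, add_comm, coeff_add_monomial_mul, one_mul]

theorem X_mul_derEven (i : Fin m) (f : Lam m n) (d : Fin m →₀ ℕ) :
    coeff d (X i * derEven m n i f) = (d i : ℂ) • coeff d f := by
  classical
  rw [X_def, coeff_monomial_mul]
  split_ifs with h
  · rw [one_mul, coeff_derEven, tsub_add_cancel_of_le h]
    congr 1
    rw [Finsupp.single_le_iff] at h
    rw [Finsupp.tsub_apply, Finsupp.single_eq_same, Nat.cast_sub h]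
    simp
  · rw [Finsupp.single_le_iff] at h
    have : d i = 0 := by omega
    simp [this]

theorem X_mul_injective (i : Fin m) {f g : Lam m n} (h : X i * f = X i * g) : f = g := by
  ext d
  rw [← coeff_add_single_X_mul i, h, coeff_add_single_X_mul]

/-- After multiplication by `X i`, which is injective, the derivative multiplies the coefficient at
`d` by `d i`; the Leibniz rule is then the additivity of exponents. -/
theorem derEven_mul (i : Fin m) (f g : Lam m n) :
    derEven m n i (f * g) = derEven m n i f * g + f * derEven m n i g := by
  classical
  apply X_mul_injective i
  rw [mul_add, ← mul_assoc, ← mul_assoc, X_mul (φ := f), mul_assoc f]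
  ext d
  rw [X_mul_derEven, map_add, coeff_mul, coeff_mul, coeff_mul, Finset.smul_sum,
    ← Finset.sum_add_distrib]
  refine Finset.sum_congr rfl fun x hx => ?_
  rw [X_mul_derEven, X_mul_derEven, ← Finset.HasAntidiagonal.mem_antidiagonal.mp hx, Finsupp.add_apply,
    Nat.cast_add, add_smul, smul_mul_assoc, mul_smul_comm]

theorem derEven_mem (i : Fin m) : derEven m n i ∈ W m n 0 := by
  refine mem_W_iff.mpr ⟨fun q f hf d => ?_, fun q f hf g => ?_⟩
  · rw [zero_add, coeff_derEven]
    exact Submodule.smul_mem _ _ (hf _)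
  · rw [derEven_mul, sgn_zero_left, one_smul]

/-- The coordinate vector fields. -/
def der (m n : ℕ) : Fin m ⊕ Fin n → Module.End ℂ (Lam m n) :=
  Sum.elim (derEven m n) (derOdd m n)

@[simp] theorem der_inl (i : Fin m) : der m n (Sum.inl i) = derEven m n i := rfl

@[simp] theorem der_inr (j : Fin n) : der m n (Sum.inr j) = derOdd m n j := rfl

theorem der_mem (s : Fin m ⊕ Fin n) : der m n s ∈ W m n (par m n s) := by
  rcases s with i | j
  · exact derEven_mem i
  · exact derOdd_mem j

theorem derOdd_C (j : Fin n) (a : Gr n) : derOdd m n j (C a) = C (grDer n j a) := by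
  classical
  ext d
  rw [derOdd, coeff_coeffMap, coeff_C, coeff_C]
  split_ifs <;> simp

theorem derEven_C (i : Fin m) (a : Gr n) : derEven m n i (C a) = 0 := by
  classical
  ext d
  rw [coeff_derEven, coeff_add_single_C, smul_zero, map_zero]

theorem der_gen (s t : Fin m ⊕ Fin n) : der m n s (gen m n t) = if t = s then 1 else 0 := by
  classical
  rcases s with i | j <;> rcases t with k | l
  · ext d
    rw [der_inl, gen_inl, coeff_derEven, coeff_X]
    by_cases hk : k = i
    · subst hk
      by_cases hd : d = 0
      · simp [hd]
      · simp [hd, coeff_one]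
    · have : d + Finsupp.single i 1 ≠ Finsupp.single k 1 := by
        intro h
        have := DFunLike.congr_fun h i
        simp [hk] at this
      simp [this, hk]
  · simp [derEven_C]
  · ext d
    rw [der_inr, gen_inl, derOdd, coeff_coeffMap, coeff_X, if_neg Sum.inl_ne_inr, map_zero]
    split_ifs <;> simp
  · rw [der_inr, gen_inr, derOdd_C, grDer_grass]
    by_cases h : l = j <;> simp [h]

/-- The vector field with prescribed coefficients. -/
def vectorField (P : Fin m ⊕ Fin n → Lam m n) : Module.End ℂ (Lam m n) :=
  ∑ s, LinearMap.mulLeft ℂ (P s) * der m n s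

theorem vectorField_apply (P : Fin m ⊕ Fin n → Lam m n) (f : Lam m n) :
    vectorField P f = ∑ s, P s * der m n s f := by
  simp [vectorField, LinearMap.sum_apply]

theorem vectorField_gen (P : Fin m ⊕ Fin n → Lam m n) (s : Fin m ⊕ Fin n) :
    vectorField P (gen m n s) = P s := by
  rw [vectorField_apply]
  simp [der_gen]

theorem vectorField_mem {p : ZMod 2} {P : Fin m ⊕ Fin n → Lam m n}
    (hP : ∀ s, P s ∈ parityPart m n (p + par m n s)) : vectorField P ∈ W m n p := by
  refine Submodule.sum_mem _ fun s _ => ?_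
  have := mulLeft_mul_mem (hP s) (der_mem s)
  rwa [add_assoc, zmod_two_add_self, add_zero] at this

end Derivations

/-! ### Graded subspaces as spaces of operators -/

section Carrier

variable {m n : ℕ}

/-- The Lie superbracket of operators of parities `p` and `q`. -/
def sbracket (p q : ZMod 2) (X Y : Module.End ℂ (Lam m n)) : Module.End ℂ (Lam m n) :=
  X * Y - sgn p q • (Y * X)

theorem sbracket_apply (p q : ZMod 2) (X Y : Module.End ℂ (Lam m n)) (f : Lam m n) :
    sbracket p q X Y f = X (Y f) - sgn p q • Y (X f) := rfl

theorem sbracket_even_left (q : ZMod 2) (X Y : Module.End ℂ (Lam m n)) :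
    sbracket 0 q X Y = X * Y - Y * X := by rw [sbracket, sgn_zero_left, one_smul]

theorem sbracket_even_apply (q : ZMod 2) (X Y : Module.End ℂ (Lam m n)) (f : Lam m n) :
    sbracket 0 q X Y f = X (Y f) - Y (X f) := by
  rw [sbracket_apply, sgn_zero_left, one_smul]

theorem sbracket_mem {p q : ZMod 2} {X Y : Module.End ℂ (Lam m n)} (hX : X ∈ W m n p)
    (hY : Y ∈ W m n q) : sbracket p q X Y ∈ W m n (p + q) := bracket_mem hX hY

/-- The operators that make up the component of parity `p` of a graded subspace. -/
def endPart (L : GradedSubspace m n) (p : ZMod 2) : Submodule ℂ (Module.End ℂ (Lam m n)) :=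
  (L p).map (W m n p).subtype

theorem mem_endPart {L : GradedSubspace m n} {p : ZMod 2} {X : Module.End ℂ (Lam m n)} :
    X ∈ endPart L p ↔ ∃ h : X ∈ W m n p, (⟨X, h⟩ : W m n p) ∈ L p := by
  constructor
  · rintro ⟨Y, hY, rfl⟩
    exact ⟨Y.2, hY⟩
  · rintro ⟨h, hX⟩
    exact ⟨_, hX, rfl⟩

theorem coe_mem_endPart {L : GradedSubspace m n} {p : ZMod 2} {X : W m n p} :
    X.1 ∈ endPart L p ↔ X ∈ L p := by
  rw [mem_endPart]
  exact ⟨fun ⟨_, h⟩ => h, fun h => ⟨X.2, h⟩⟩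

theorem endPart_le (L : GradedSubspace m n) (p : ZMod 2) : endPart L p ≤ W m n p := by
  rintro _ ⟨Y, _, rfl⟩
  exact Y.2

theorem endPart_top (p : ZMod 2) : endPart (⊤ : GradedSubspace m n) p = W m n p := by
  refine le_antisymm (endPart_le _ p) fun X hX => mem_endPart.mpr ⟨hX, trivial⟩

theorem le_iff_endPart {L L' : GradedSubspace m n} :
    L ≤ L' ↔ ∀ p, endPart L p ≤ endPart L' p := by
  constructor
  · exact fun h p => Submodule.map_mono (h p)
  · exact fun h p X hX => coe_mem_endPart.mp (h p (coe_mem_endPart.mpr hX))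

theorem ext_endPart {L L' : GradedSubspace m n} (h : ∀ p, endPart L p = endPart L' p) : L = L' :=
  le_antisymm (le_iff_endPart.mpr fun p => (h p).le) (le_iff_endPart.mpr fun p => (h p).ge)

theorem isSubalg_iff {L : GradedSubspace m n} :
    IsSubalg L ↔ ∀ p q, ∀ X ∈ endPart L p, ∀ Y ∈ endPart L q,
      sbracket p q X Y ∈ endPart L (p + q) := by
  constructor
  · rintro h p q _ ⟨X, hX, rfl⟩ _ ⟨Y, hY, rfl⟩
    exact ⟨_, h p q X Y hX hY, rfl⟩
  · intro h p q X Y hX hY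
    exact coe_mem_endPart.mp
      (h p q X.1 (coe_mem_endPart.mpr hX) Y.1 (coe_mem_endPart.mpr hY))

theorem isOpenSubspace_iff {L : GradedSubspace m n} :
    IsOpenSubspace L ↔ ∃ N : ℕ, ∀ p, ∀ X ∈ W m n p,
      (∀ s, X (gen m n s) ∈ maxIdeal m n ^ N) → X ∈ endPart L p := by
  refine exists_congr fun N => forall_congr' fun p => ?_
  exact ⟨fun h X hX hs => mem_endPart.mpr ⟨hX, h _ hs⟩,
    fun h X hX => coe_mem_endPart.mp (h X.1 X.2 hX)⟩

/-- The graded subspace cut out by spaces of operators. -/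
def ofEnd (M : ZMod 2 → Submodule ℂ (Module.End ℂ (Lam m n))) : GradedSubspace m n :=
  fun p => (M p).comap (W m n p).subtype

theorem mem_endPart_ofEnd {M : ZMod 2 → Submodule ℂ (Module.End ℂ (Lam m n))} {p : ZMod 2}
    {X : Module.End ℂ (Lam m n)} : X ∈ endPart (ofEnd M) p ↔ X ∈ W m n p ∧ X ∈ M p := by
  rw [mem_endPart]
  exact ⟨fun ⟨h, h'⟩ => ⟨h, h'⟩, fun ⟨h, h'⟩ => ⟨h, h'⟩⟩

theorem IsMaximalOpenSubalg.eq_of_le {L L' : GradedSubspace m n} (hL : IsMaximalOpenSubalg L)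
    (h' : IsSubalg L') (hle : L ≤ L') (hne : L' ≠ ⊤) : L = L' := by
  rcases eq_or_lt_of_le hle with h | h
  · exact h
  · exact absurd (hL.2.2.2 L' h' h) hne

theorem IsOpenSubspace.mono {L L' : GradedSubspace m n} (hL : IsOpenSubspace L) (hle : L ≤ L') :
    IsOpenSubspace L' := by
  obtain ⟨N, hN⟩ := hL
  exact ⟨N, fun p X hX => hle p (hN p X hX)⟩

end Carrier

/-! ### Transitive subalgebras -/

section Transitive

variable {m n : ℕ}

theorem iterate_lower {p : ZMod 2} {X : Module.End ℂ (Lam m n)} (hX : IsLeibniz p X) {N : ℕ}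
    {f : Lam m n} (hf : f ∈ maxIdeal m n ^ N) (r : ℕ) :
    (X ^ r) f ∈ maxIdeal m n ^ (N - r) := by
  induction r with
  | zero => simpa using hf
  | succ r ih =>
    rw [pow_succ', Module.End.mul_apply]
    rcases Nat.lt_or_ge r N with h | h
    · rw [show N - r = N - (r + 1) + 1 by omega] at ih
      exact hX.lower ih
    · rw [show N - (r + 1) = 0 by omega]
      exact mem_maxIdeal_pow_zero _

theorem iterate_even_parity {X : Module.End ℂ (Lam m n)} (hX : X ∈ W m n 0) {q : ZMod 2}
    {f : Lam m n} (hf : f ∈ parityPart m n q) (r : ℕ) : (X ^ r) f ∈ parityPart m n q := by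
  induction r with
  | zero => simpa using hf
  | succ r ih =>
    rw [pow_succ', Module.End.mul_apply]
    simpa using parity_of_mem hX ih

theorem pow_mem_maxIdeal_pow {y : Lam m n} (hy : y ∈ maxIdeal m n) (r : ℕ) :
    y ^ r ∈ maxIdeal m n ^ r := by
  induction r with
  | zero => exact mem_maxIdeal_pow_zero _
  | succ r ih => rw [pow_succ]; exact maxIdeal_pow_mul ih (by rwa [maxIdeal_pow_one])

theorem pow_mem_parityPart {y : Lam m n} (hy : y ∈ parityPart m n 0) (r : ℕ) :
    y ^ r ∈ parityPart m n 0 := by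
  induction r with
  | zero => exact one_mem_parityPart
  | succ r ih => rw [pow_succ]; simpa using parityPart_mul ih hy

theorem apply_pow_sub_mem {X : Module.End ℂ (Lam m n)} (hX : IsLeibniz 0 X) {y : Lam m n}
    (hy : y ∈ maxIdeal m n) (h : X y - 1 ∈ maxIdeal m n) (r : ℕ) :
    X (y ^ (r + 1)) - ((r : ℂ) + 1) • y ^ r ∈ maxIdeal m n ^ (r + 1) := by
  induction r with
  | zero => simpa [maxIdeal_pow_one] using h
  | succ r ih =>
    rw [pow_succ y (r + 1), hX.even_mul]
    have h₁ : y ^ (r + 1) * (X y - 1) ∈ maxIdeal m n ^ (r + 1 + 1) :=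
      maxIdeal_pow_mul (pow_mem_maxIdeal_pow hy _) (by rwa [maxIdeal_pow_one])
    have h₂ := maxIdeal_pow_mul ih (M := 1) (by rwa [maxIdeal_pow_one] : y ∈ _)
    have := Ideal.add_mem _ h₁ h₂
    convert this using 1
    rw [mul_sub, sub_mul, mul_one, smul_mul_assoc, ← pow_succ]
    push_cast
    module

/-- Leading-order integration along an even vector field that does not vanish at the origin. -/
theorem exists_primitive {X : Module.End ℂ (Lam m n)} (hX : X ∈ W m n 0) {i : Fin m}
    (h : aug m n (X (gen m n (Sum.inl i))) ≠ 0) {N : ℕ} {q : ZMod 2} {f : Lam m n}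
    (hf : f ∈ parityPart m n q) (hf' : f ∈ maxIdeal m n ^ N) :
    ∃ g ∈ parityPart m n q, g ∈ maxIdeal m n ^ (N + 1) ∧ X g - f ∈ maxIdeal m n ^ (N + 1) := by
  have hL := leibniz_of_mem hX
  set c := aug m n (X (gen m n (Sum.inl i)))
  -- Rescaled so that X y ≡ 1 modulo the maximal ideal: `y` is the variable of integration.
  set y : Lam m n := c⁻¹ • gen m n (Sum.inl i)
  have hy : y ∈ maxIdeal m n := smul_mem_ideal _ _ (gen_mem_maxIdeal _)
  have hy₀ : y ∈ parityPart m n 0 := Submodule.smul_mem _ _ (gen_mem_parityPart (Sum.inl i))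
  have hXy : X y - 1 ∈ maxIdeal m n := by
    rw [mem_maxIdeal_iff, map_sub, map_one, map_smul, map_smul, smul_eq_mul]
    change c⁻¹ * c - 1 = 0
    rw [inv_mul_cancel₀ h, sub_self]
  -- Repeated integration by parts, g = y f - y² X(f)/2 + ⋯. The error after `r` steps is a multiple
  -- of y^r X^r(f), and after `N + 1` steps the factor y^(N+1) alone has the required order.
  have key : ∀ r ≤ N + 1, ∃ c : ℂ, ∃ g ∈ parityPart m n q, g ∈ maxIdeal m n ^ (N + 1) ∧
      X g - f - c • (y ^ r * (X ^ r) f) ∈ maxIdeal m n ^ (N + 1) := by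
    intro r
    induction r with
    | zero =>
      refine fun _ => ⟨-1, 0, Submodule.zero_mem _, Ideal.zero_mem _, ?_⟩
      simp
    | succ r ih =>
      intro hr
      obtain ⟨c, g, hg, hg', hc⟩ := ih (by omega)
      have hr₀ : ((r : ℂ) + 1) ≠ 0 := Nat.cast_add_one_ne_zero r
      have hlow := iterate_lower hL hf' r
      have hpar := iterate_even_parity hX hf r
      set F := (X ^ r) f with hF
      set e : ℂ := -(c / (r + 1)) with he
      have hec : e * ((r : ℂ) + 1) = -c := by rw [he, neg_mul, div_mul_cancel₀ _ hr₀]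
      refine ⟨e, g + e • (y ^ (r + 1) * F), ?_, ?_, ?_⟩
      · refine Submodule.add_mem _ hg (Submodule.smul_mem _ _ ?_)
        simpa using parityPart_mul (pow_mem_parityPart hy₀ (r + 1)) hpar
      · refine Ideal.add_mem _ hg' (smul_mem_ideal _ _ ?_)
        have := maxIdeal_pow_mul (pow_mem_maxIdeal_pow hy (r + 1)) hlow
        rwa [show r + 1 + (N - r) = N + 1 by omega] at this
      · have h₁ := maxIdeal_pow_mul (apply_pow_sub_mem hL hy hXy r) hlow
        rw [show r + 1 + (N - r) = N + 1 by omega] at h₁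
        have h₂ := Ideal.add_mem _ hc (smul_mem_ideal _ e h₁)
        convert h₂ using 1
        rw [map_add, map_smul, hL.even_mul, pow_succ' X, Module.End.mul_apply, ← hF, sub_mul,
          smul_mul_assoc, smul_sub, smul_smul, hec]
        module
  obtain ⟨c, g, hg, hg', hc⟩ := key (N + 1) le_rfl
  refine ⟨g, hg, hg', ?_⟩
  have h₁ : c • (y ^ (N + 1) * (X ^ (N + 1)) f) ∈ maxIdeal m n ^ (N + 1) :=
    smul_mem_ideal _ _ (maxIdeal_pow_mul_right (pow_mem_maxIdeal_pow hy (N + 1)) _)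
  have := Ideal.add_mem _ hc h₁
  rwa [sub_add_cancel] at this

/-- An open subalgebra that contains an even vector field with nonzero value at the origin is
the whole algebra. -/
theorem eq_top_of_even_transitive {L : GradedSubspace m n} (hL : IsSubalg L)
    (ho : IsOpenSubspace L) {X : Module.End ℂ (Lam m n)} (hX : X ∈ endPart L 0) {i : Fin m}
    (h : aug m n (X (gen m n (Sum.inl i))) ≠ 0) : L = ⊤ := by
  rw [isSubalg_iff] at hL
  rw [isOpenSubspace_iff] at ho
  obtain ⟨N, hN⟩ := ho
  have hXW := endPart_le _ _ hX
  -- Downward improvement of the order: for `Y` of order `N`, integrate its coefficients along `X`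
  -- to a field Z of order `N + 1`. Both Z and [X, Z] - Y have order `N + 1`, hence lie in `L`, and
  -- therefore so does `Y`.
  induction N with
  | zero =>
    refine ext_endPart fun p => ?_
    rw [endPart_top]
    exact le_antisymm (endPart_le _ _) fun Y hY => hN p Y hY fun s => mem_maxIdeal_pow_zero _
  | succ N ih =>
    refine ih fun p Y hY hs => ?_
    choose g hg hg' hXg using fun s =>
      exists_primitive hXW h (parity_of_mem hY (gen_mem_parityPart s)) (hs s)
    have hZ : vectorField g ∈ W m n p := vectorField_mem hg
    have hZ' : ∀ s, vectorField g (gen m n s) ∈ maxIdeal m n ^ (N + 1) := fun s => by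
      rw [vectorField_gen]
      exact hg' s
    have h₁ : sbracket 0 p X (vectorField g) ∈ endPart L p := by
      simpa using hL 0 p X hX _ (hN p _ hZ hZ')
    have h₂ : sbracket 0 p X (vectorField g) - Y ∈ endPart L p := by
      refine hN p _ (Submodule.sub_mem _ (endPart_le _ _ h₁) hY) fun s => ?_
      rw [LinearMap.sub_apply, sbracket_even_apply, vectorField_gen, sub_right_comm]
      exact Ideal.sub_mem _ (hXg s) ((leibniz_of_mem hZ).mem_maxIdeal_pow hZ' _)
    have := Submodule.sub_mem _ h₁ h₂
    rwa [sub_sub_cancel] at this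

theorem der_inl_aug (i : Fin m) : aug m n (der m n (Sum.inl i) (gen m n (Sum.inl i))) = 1 := by
  rw [der_gen, if_pos rfl, map_one]

end Transitive

/-! ### Maximal subalgebras are modules over `Λ(m,n)` -/

section MulClosure

variable {m n : ℕ}

/-- This is what makes the Λ(m,n)-span of a subalgebra a subalgebra: each term on the right is a
series times `X`, `Y` or their bracket. -/
theorem sbracket_mulLeft {a b p q : ZMod 2} {f g : Lam m n} (hf : f ∈ parityPart m n a)
    (hg : g ∈ parityPart m n b) {X Y : Module.End ℂ (Lam m n)} (hX : X ∈ W m n p)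
    (hY : Y ∈ W m n q) :
    sbracket (a + p) (b + q) (LinearMap.mulLeft ℂ f * X) (LinearMap.mulLeft ℂ g * Y) =
      LinearMap.mulLeft ℂ (f * X g) * Y -
        sgn (a + p) (b + q) • (LinearMap.mulLeft ℂ (g * Y f) * X) +
        sgn p b • (LinearMap.mulLeft ℂ (f * g) * sbracket p q X Y) := by
  ext1 h
  simp only [sbracket_apply, LinearMap.add_apply, LinearMap.sub_apply, LinearMap.smul_apply,
    Module.End.mul_apply, LinearMap.mulLeft_apply, leibniz_of_mem hX b g hg,
    leibniz_of_mem hY a f hf, mul_add, mul_sub, mul_smul_comm, smul_add, smul_sub, smul_smul,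
    ← mul_assoc]
  rw [supercomm hf hg]
  simp only [smul_mul_assoc, smul_smul]
  have e : sgn (a + p) (b + q) * sgn q a = sgn p b * sgn p q * sgn a b := by
    rw [sgn_add_left, sgn_add_right, sgn_add_right, sgn_comm q a]
    linear_combination (sgn a b * sgn p b * sgn p q) * sgn_mul_self a q
  rw [e]
  abel

/-- The module generated by a graded subspace over `Λ(m,n)`. -/
def mulClosure (L : GradedSubspace m n) (p : ZMod 2) : Submodule ℂ (Module.End ℂ (Lam m n)) :=
  Submodule.span ℂ {T | ∃ a q, a + q = p ∧ ∃ f ∈ parityPart m n a, ∃ X ∈ endPart L q,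
    T = LinearMap.mulLeft ℂ f * X}

theorem mulLeft_mul_mem_mulClosure {L : GradedSubspace m n} {a q : ZMod 2} {f : Lam m n}
    (hf : f ∈ parityPart m n a) {X : Module.End ℂ (Lam m n)} (hX : X ∈ endPart L q) :
    LinearMap.mulLeft ℂ f * X ∈ mulClosure L (a + q) :=
  Submodule.subset_span ⟨a, q, rfl, f, hf, X, hX, rfl⟩

theorem mulClosure_le (L : GradedSubspace m n) (p : ZMod 2) : mulClosure L p ≤ W m n p := by
  refine Submodule.span_le.mpr ?_
  rintro _ ⟨a, q, rfl, f, hf, X, hX, rfl⟩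
  exact mulLeft_mul_mem hf (endPart_le _ _ hX)

theorem isSubalg_mulClosure {L : GradedSubspace m n} (hL : IsSubalg L) :
    IsSubalg (ofEnd (mulClosure L)) := by
  rw [isSubalg_iff] at hL ⊢
  intro p q X hX Y hY
  rw [mem_endPart_ofEnd] at hX hY ⊢
  refine ⟨sbracket_mem hX.1 hY.1, ?_⟩
  obtain ⟨_, hX⟩ := hX
  obtain ⟨_, hY⟩ := hY
  refine Submodule.span_induction (p := fun X _ => sbracket p q X Y ∈ mulClosure L (p + q))
    ?_ ?_ ?_ ?_ hX
  · rintro _ ⟨a, p, rfl, f, hf, X, hX, rfl⟩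
    refine Submodule.span_induction (p := fun Y _ => sbracket (a + p) q _ Y ∈ mulClosure L (a + p + q))
      ?_ ?_ ?_ ?_ hY
    · rintro _ ⟨b, q, rfl, g, hg, Y, hY, rfl⟩
      have hXW := endPart_le _ _ hX
      have hYW := endPart_le _ _ hY
      rw [sbracket_mulLeft hf hg hXW hYW]
      refine Submodule.add_mem _ (Submodule.sub_mem _ ?_ (Submodule.smul_mem _ _ ?_))
        (Submodule.smul_mem _ _ ?_)
      · have := mulLeft_mul_mem_mulClosure (parityPart_mul hf (parity_of_mem hXW hg)) hY
        rwa [show a + (p + b) + q = a + p + (b + q) by abel] at this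
      · have := mulLeft_mul_mem_mulClosure (parityPart_mul hg (parity_of_mem hYW hf)) hX
        rwa [show b + (q + a) + p = a + p + (b + q) by abel] at this
      · have := mulLeft_mul_mem_mulClosure (parityPart_mul hf hg) (hL p q X hX Y hY)
        rwa [show a + b + (p + q) = a + p + (b + q) by abel] at this
    · simp [sbracket]
    · intro x y _ _ hx hy
      simp only [sbracket, mul_add, add_mul] at hx hy ⊢
      convert Submodule.add_mem _ hx hy using 1
      module
    · intro c x _ hx
      simp only [sbracket, mul_smul_comm, smul_mul_assoc] at hx ⊢
      convert Submodule.smul_mem _ c hx using 1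
      module
  · simp [sbracket]
  · intro x y _ _ hx hy
    simp only [sbracket, mul_add, add_mul] at hx hy ⊢
    convert Submodule.add_mem _ hx hy using 1
    module
  · intro c x _ hx
    simp only [sbracket, mul_smul_comm, smul_mul_assoc] at hx ⊢
    convert Submodule.smul_mem _ c hx using 1
    module

theorem le_mulClosure (L : GradedSubspace m n) : L ≤ ofEnd (mulClosure L) := by
  refine le_iff_endPart.mpr fun p X hX => mem_endPart_ofEnd.mpr ⟨endPart_le _ _ hX, ?_⟩
  have := mulLeft_mul_mem_mulClosure one_mem_parityPart hX
  rw [zero_add] at this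
  convert this using 1
  ext1 f
  simp

/-- The even elements of a proper open subalgebra vanish at the origin. -/
theorem aug_eq_zero_of_ne_top {L : GradedSubspace m n} (hL : IsSubalg L) (ho : IsOpenSubspace L)
    (hne : L ≠ ⊤) {p : ZMod 2} {X : Module.End ℂ (Lam m n)} (hX : X ∈ endPart L p) (i : Fin m) :
    aug m n (X (gen m n (Sum.inl i))) = 0 := by
  rcases zmod_two_cases p with rfl | rfl
  · by_contra h
    exact hne (eq_top_of_even_transitive hL ho hX h)
  · refine aug_eq_zero_of_odd ?_
    simpa using parity_of_mem (endPart_le _ _ hX) (gen_mem_parityPart (Sum.inl i))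

theorem aug_even_inr {X : Module.End ℂ (Lam m n)} (hX : X ∈ W m n 0) (j : Fin n) :
    aug m n (X (gen m n (Sum.inr j))) = 0 := by
  refine aug_eq_zero_of_odd ?_
  simpa using parity_of_mem hX (gen_mem_parityPart (Sum.inr j))

theorem ne_top_of_aug_eq_zero {L : GradedSubspace m n} (i : Fin m)
    (h : ∀ X ∈ endPart L 0, aug m n (X (gen m n (Sum.inl i))) = 0) : L ≠ ⊤ := by
  rintro rfl
  have := h (der m n (Sum.inl i)) (by rw [endPart_top]; exact der_mem (Sum.inl i))
  rw [der_inl_aug] at this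
  exact one_ne_zero this

/-- Multiplication by series cannot create a nonzero ∂/∂x_i-component at the origin, so the
Λ(m,n)-span of `L` is still proper, and maximality makes it equal to `L`. -/
theorem IsMaximalOpenSubalg.mulLeft_mul_mem (hm : 1 ≤ m) {L : GradedSubspace m n}
    (hL : IsMaximalOpenSubalg L) {a q : ZMod 2} {f : Lam m n} (hf : f ∈ parityPart m n a)
    {X : Module.End ℂ (Lam m n)} (hX : X ∈ endPart L q) :
    LinearMap.mulLeft ℂ f * X ∈ endPart L (a + q) := by
  have hne : ofEnd (mulClosure L) ≠ ⊤ := by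
    refine ne_top_of_aug_eq_zero ⟨0, hm⟩ fun X hX => ?_
    have : mulClosure L 0 ≤ LinearMap.ker ((aug m n).toLinearMap ∘ₗ
        LinearMap.applyₗ (gen m n (Sum.inl ⟨0, hm⟩))) := by
      refine Submodule.span_le.mpr ?_
      rintro _ ⟨a, q, _, f, hf, X, hX, rfl⟩
      have := aug_eq_zero_of_ne_top hL.1 hL.2.1 hL.2.2.1 hX ⟨0, hm⟩
      simp only [SetLike.mem_coe, LinearMap.mem_ker, LinearMap.comp_apply,
        LinearMap.applyₗ_apply_apply, Module.End.mul_apply, LinearMap.mulLeft_apply,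
        AlgHom.toLinearMap_apply, map_mul]
      rw [this, mul_zero]
    exact this (mem_endPart_ofEnd.mp hX).2
  have e := hL.eq_of_le (isSubalg_mulClosure hL.1) (le_mulClosure L) hne
  rw [e, mem_endPart_ofEnd]
  have := mulLeft_mul_mem_mulClosure hf hX
  exact ⟨mulClosure_le _ _ this, this⟩

end MulClosure

/-! ### Grassmann subalgebras -/

section GrAdj

variable {m n : ℕ}

/-- The subalgebra of the Grassmann algebra generated by the `ξ_j` with `j ∈ A`. -/
def grAdj (A : Finset (Fin n)) : Submodule ℂ (Gr n) :=
  Submodule.span ℂ {w | ∃ l : List (Fin n), (∀ j ∈ l, j ∈ A) ∧ w = word l}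

theorem word_mem_grAdj {A : Finset (Fin n)} {l : List (Fin n)} (h : ∀ j ∈ l, j ∈ A) :
    word l ∈ grAdj A := Submodule.subset_span ⟨l, h, rfl⟩

theorem one_mem_grAdj (A : Finset (Fin n)) : (1 : Gr n) ∈ grAdj A :=
  word_mem_grAdj (l := []) (by simp)

theorem grAdj_mono {A B : Finset (Fin n)} (h : A ⊆ B) : grAdj A ≤ grAdj B := by
  refine Submodule.span_mono ?_
  rintro _ ⟨l, hl, rfl⟩
  exact ⟨l, fun j hj => h (hl j hj), rfl⟩

theorem grass_mul_mem_grAdj {A : Finset (Fin n)} {b : Fin n} (hb : b ∈ A) {r : Gr n}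
    (hr : r ∈ grAdj A) : grass n b * r ∈ grAdj A := by
  have : grAdj A ≤ (grAdj A).comap (LinearMap.mulLeft ℂ (grass n b)) := by
    refine Submodule.span_le.mpr ?_
    rintro _ ⟨l, hl, rfl⟩
    rw [SetLike.mem_coe, Submodule.mem_comap, LinearMap.mulLeft_apply, ← word_cons]
    exact word_mem_grAdj (by simpa [hb] using hl)
  exact this hr

theorem exists_of_mem_grAdj_empty {r : Gr n} (hr : r ∈ grAdj (∅ : Finset (Fin n))) :
    ∃ c : ℂ, r = c • 1 := by
  have : grAdj (∅ : Finset (Fin n)) ≤ Submodule.span ℂ {1} := by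
    refine Submodule.span_mono ?_
    rintro _ ⟨l, hl, rfl⟩
    cases l with
    | nil => rfl
    | cons j l => simpa using hl j
  obtain ⟨c, hc⟩ := Submodule.mem_span_singleton.mp (this hr)
  exact ⟨c, hc.symm⟩

theorem exists_of_mem_grAdj_insert [DecidableEq (Fin n)] {A : Finset (Fin n)} {b : Fin n}
    {r : Gr n} (hr : r ∈ grAdj (insert b A)) :
    ∃ r₀ ∈ grAdj A, ∃ r₁ ∈ grAdj A, r = r₀ + grass n b * r₁ := by
  induction hr using Submodule.span_induction with
  | mem r hr =>
    obtain ⟨l, hl, rfl⟩ := hr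
    induction l with
    | nil => exact ⟨1, one_mem_grAdj A, 0, Submodule.zero_mem _, by simp⟩
    | cons j l ih =>
      obtain ⟨r₀, h₀, r₁, h₁, e⟩ := ih fun k hk => hl k (List.mem_cons_of_mem _ hk)
      rcases Finset.mem_insert.mp (hl j List.mem_cons_self) with rfl | hj
      · refine ⟨0, Submodule.zero_mem _, r₀, h₀, ?_⟩
        rw [word_cons, e, mul_add, ← mul_assoc, grass_mul_self, zero_mul, add_zero, zero_add]
      · refine ⟨_, grass_mul_mem_grAdj hj h₀, -(grass n j * r₁),
          Submodule.neg_mem _ (grass_mul_mem_grAdj hj h₁), ?_⟩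
        rw [word_cons, e, mul_add, ← mul_assoc, grass_mul_swap, neg_mul, mul_neg, mul_assoc]
  | zero => exact ⟨0, Submodule.zero_mem _, 0, Submodule.zero_mem _, by simp⟩
  | add x y _ _ hx hy =>
    obtain ⟨r₀, h₀, r₁, h₁, rfl⟩ := hx
    obtain ⟨s₀, k₀, s₁, k₁, rfl⟩ := hy
    exact ⟨_, Submodule.add_mem _ h₀ k₀, _, Submodule.add_mem _ h₁ k₁, by rw [mul_add]; abel⟩
  | smul c x _ hx =>
    obtain ⟨r₀, h₀, r₁, h₁, rfl⟩ := hx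
    exact ⟨_, Submodule.smul_mem _ c h₀, _, Submodule.smul_mem _ c h₁, by
      rw [smul_add, mul_smul_comm]⟩

/-- A vector field that annihilates the `ξ_j` with `j ∈ A` annihilates the subalgebra they
generate. -/
theorem IsLeibniz.map_C_eq_zero {p : ZMod 2} {X : Module.End ℂ (Lam m n)} (hX : IsLeibniz p X)
    {A : Finset (Fin n)} (h : ∀ a ∈ A, X (C (grass n a)) = 0) {r : Gr n} (hr : r ∈ grAdj A) :
    X (C r) = 0 := by
  induction hr using Submodule.span_induction with
  | mem r hr =>
    obtain ⟨l, hl, rfl⟩ := hr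
    induction l with
    | nil => simpa using hX.map_one
    | cons j l ih =>
      rw [word_cons, map_mul, hX 1 _ (C_mem_parityPart (grass_mem n j)),
        h j (hl j List.mem_cons_self), ih fun k hk => hl k (List.mem_cons_of_mem _ hk), zero_mul,
        mul_zero, smul_zero, add_zero]
  | zero => simp
  | add x y _ _ hx hy => rw [map_add, map_add, hx, hy, add_zero]
  | smul c x _ hx =>
    have : (C (c • x) : Lam m n) = c • C x := by
      rw [smul_eq_C_algebraMap_mul, ← map_mul, Algebra.smul_def]
    rw [this, map_smul, hx, smul_zero]

/-- A family of odd vector fields dual to the `ξ_j` with `j ∈ A`. -/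
def IsDual (A : Finset (Fin n)) (D : Fin n → Module.End ℂ (Lam m n)) : Prop :=
  ∀ a ∈ A, ∀ b ∈ A, D a (C (grass n b)) = if b = a then 1 else 0

theorem apply_C_grass_mul {D : Module.End ℂ (Lam m n)} (hD : IsLeibniz 1 D) {b : Fin n}
    (hb : D (C (grass n b)) = 1) {r : Gr n} (hr : D (C r) = 0) :
    D (C (grass n b * r)) = C r := by
  rw [map_mul, hD 1 _ (C_mem_parityPart (grass_mem n b)), hb, hr, mul_zero, smul_zero, add_zero,
    one_mul]

theorem IsDual.mono {A B : Finset (Fin n)} {D : Fin n → Module.End ℂ (Lam m n)}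
    (h : IsDual B D) (hAB : A ⊆ B) : IsDual A D := fun a ha b hb => h a (hAB ha) b (hAB hb)

theorem IsDual.map_C_eq_zero {A : Finset (Fin n)} {D : Fin n → Module.End ℂ (Lam m n)}
    [DecidableEq (Fin n)] {b : Fin n} (h : IsDual (insert b A) D) (hb : b ∉ A)
    (hD : IsLeibniz 1 (D b)) {r : Gr n} (hr : r ∈ grAdj A) : D b (C r) = 0 := by
  refine hD.map_C_eq_zero (fun a ha => ?_) hr
  rw [h b (Finset.mem_insert_self _ _) a (Finset.mem_insert_of_mem ha), if_neg]
  rintro rfl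
  exact hb ha

/-- A space of series vanishing at the origin that is stable under vector fields dual to the `ξ_j`
with `j ∈ A` does not meet the Grassmann subalgebra generated by these `ξ_j`. -/
theorem IsDual.eq_zero_of_mem {A : Finset (Fin n)} {D : Fin n → Module.End ℂ (Lam m n)}
    (h : IsDual A D) (hD : ∀ a ∈ A, IsLeibniz 1 (D a)) {K : Submodule ℂ (Lam m n)}
    (hK : ∀ f ∈ K, aug m n f = 0) (hDK : ∀ a ∈ A, ∀ f ∈ K, D a f ∈ K) {r : Gr n}
    (hr : r ∈ grAdj A) (hrK : (C r : Lam m n) ∈ K) : r = 0 := by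
  classical
  induction A using Finset.induction_on generalizing r with
  | empty =>
    obtain ⟨c, rfl⟩ := exists_of_mem_grAdj_empty hr
    have := hK _ hrK
    rw [aug_C, map_smul, map_one, smul_eq_mul, mul_one] at this
    rw [this, zero_smul]
  | insert b A hb ih =>
    have ih := fun {r} => @ih (h.mono (Finset.subset_insert b A))
      (fun a ha => hD a (Finset.mem_insert_of_mem ha))
      (fun a ha => hDK a (Finset.mem_insert_of_mem ha)) r
    have hbI := Finset.mem_insert_self b A
    -- Applying `D b` to r₀ + ξ_b r₁ leaves r₁, which vanishes by induction; then r₀ does too.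
    obtain ⟨r₀, h₀, r₁, h₁, rfl⟩ := exists_of_mem_grAdj_insert hr
    have e := hDK b hbI _ hrK
    rw [map_add, map_add, h.map_C_eq_zero hb (hD b hbI) h₀, apply_C_grass_mul (hD b hbI)
      (by rw [h b hbI b hbI, if_pos rfl]) (h.map_C_eq_zero hb (hD b hbI) h₁), zero_add] at e
    have h₁' := ih h₁ e
    subst h₁'
    rw [mul_zero, add_zero] at hrK ⊢
    exact ih h₀ hrK

end GrAdj

/-! ### Stabilizers -/

section Stab

variable {m n : ℕ}

/-- The operators that preserve a subspace of `Λ(m,n)`. -/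
def stabEnd (I : Submodule ℂ (Lam m n)) : Submodule ℂ (Module.End ℂ (Lam m n)) where
  carrier := {X | ∀ f ∈ I, X f ∈ I}
  zero_mem' := fun _ _ => I.zero_mem
  add_mem' := fun hX hY f hf => I.add_mem (hX f hf) (hY f hf)
  smul_mem' := fun c _ hX f hf => I.smul_mem c (hX f hf)

/-- The vector fields that preserve a subspace of `Λ(m,n)`. -/
def stab (I : Submodule ℂ (Lam m n)) : GradedSubspace m n := ofEnd fun _ => stabEnd I

theorem mem_endPart_stab {I : Submodule ℂ (Lam m n)} {p : ZMod 2} {X : Module.End ℂ (Lam m n)} :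
    X ∈ endPart (stab I) p ↔ X ∈ W m n p ∧ ∀ f ∈ I, X f ∈ I := mem_endPart_ofEnd

theorem isSubalg_stab (I : Submodule ℂ (Lam m n)) : IsSubalg (stab I) := by
  rw [isSubalg_iff]
  intro p q X hX Y hY
  rw [mem_endPart_stab] at hX hY ⊢
  exact ⟨sbracket_mem hX.1 hY.1, fun f hf =>
    I.sub_mem (hX.2 _ (hY.2 f hf)) (I.smul_mem _ (hY.2 _ (hX.2 f hf)))⟩

end Stab

/-! ### The invariant ideal of a proper open subalgebra -/

section Invariant

variable {m n : ℕ}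

/-- Elimination with coefficients in Λ(m,n), for a maximal `A`. If some `X` in `L` kills every ξ_a
with a ∈ A but X(ξ_b) is nonzero at the origin, then `X` is odd and X(ξ_b) is an even unit. Dividing
by this unit gives Y, and replacing each D_a by D_a - D_a(ξ_b) Y extends the dual family to `b`,
against maximality. -/
theorem exists_frame {L : GradedSubspace m n}
    (hmul : ∀ a q, ∀ f ∈ parityPart m n a, ∀ X ∈ endPart L q,
      LinearMap.mulLeft ℂ f * X ∈ endPart L (a + q))
    (hvan : ∀ p, ∀ X ∈ endPart L p, ∀ i, aug m n (X (gen m n (Sum.inl i))) = 0) :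
    ∃ (A : Finset (Fin n)) (D : Fin n → Module.End ℂ (Lam m n)),
      (∀ a ∈ A, D a ∈ endPart L 1) ∧ IsDual A D ∧
      ∀ p, ∀ X ∈ endPart L p, (∀ a ∈ A, X (C (grass n a)) = 0) → ∀ s, aug m n (X (gen m n s)) = 0 := by
  classical
  obtain ⟨A, ⟨D, hD, hA⟩, hmax⟩ := (Set.toFinite {A : Finset (Fin n) |
    ∃ D : Fin n → Module.End ℂ (Lam m n), (∀ a ∈ A, D a ∈ endPart L 1) ∧ IsDual A D}).exists_maximal
      ⟨∅, 0, by simp, by simp [IsDual]⟩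
  refine ⟨A, D, hD, hA, fun p X hX hXA s => ?_⟩
  have hXW := endPart_le _ _ hX
  rcases s with i | b
  · exact hvan p X hX i
  rcases zmod_two_cases p with rfl | rfl
  · exact aug_even_inr hXW b
  by_contra hne
  have hbA : b ∉ A := fun hb => hne (by rw [gen_inr, hXA b hb, map_zero])
  have hu : X (gen m n (Sum.inr b)) ∈ parityPart m n 0 :=
    parityPart_cast zmod_two_one_add_one (parity_of_mem hXW (gen_mem_parityPart (Sum.inr b)))
  obtain ⟨v, hv, hvu⟩ := exists_even_inverse hu hne
  set Y := LinearMap.mulLeft ℂ v * X with hY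
  have hYL : Y ∈ endPart L 1 := by simpa using hmul 0 1 v hv X hX
  have hYb : Y (C (grass n b)) = 1 := hvu
  have hYA : ∀ a ∈ A, Y (C (grass n a)) = 0 := fun a ha => by
    rw [hY, Module.End.mul_apply, hXA a ha, map_zero]
  refine hbA (hmax (y := insert b A) ⟨fun a => if a = b then Y else
    D a - LinearMap.mulLeft ℂ (D a (C (grass n b))) * Y, fun a ha => ?_, fun a ha c hc => ?_⟩
    (Finset.subset_insert b A) (Finset.mem_insert_self b A))
  · dsimp only
    split_ifs with h
    · exact hYL
    · have haD := hD a (Finset.mem_of_mem_insert_of_ne ha h)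
      have hpar := parityPart_cast zmod_two_one_add_one
        (parity_of_mem (endPart_le _ _ haD) (C_mem_parityPart (m := m) (grass_mem n b)))
      exact Submodule.sub_mem _ haD (by simpa using hmul 0 1 _ hpar Y hYL)
  · dsimp only
    by_cases h : a = b
    · rw [if_pos h, h]
      by_cases hcb : c = b
      · rw [hcb, hYb, if_pos rfl]
      · rw [hYA c (Finset.mem_of_mem_insert_of_ne hc hcb), if_neg hcb]
    · have ha' := Finset.mem_of_mem_insert_of_ne ha h
      rw [if_neg h, LinearMap.sub_apply, Module.End.mul_apply, LinearMap.mulLeft_apply]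
      by_cases hcb : c = b
      · rw [hcb, hYb, mul_one, sub_self, if_neg (Ne.symm h)]
      · have hc' := Finset.mem_of_mem_insert_of_ne hc hcb
        rw [hYA c hc', mul_zero, sub_zero, hA a ha' c hc']

/-- The subideal of elements that a vector field maps into the ideal. -/
def subideal (V : Ideal (Lam m n)) {p : ZMod 2} {D : Module.End ℂ (Lam m n)} (hD : IsLeibniz p D) :
    Ideal (Lam m n) where
  carrier := {f | f ∈ V ∧ D f ∈ V}
  zero_mem' := ⟨V.zero_mem, by rw [map_zero]; exact V.zero_mem⟩
  add_mem' := fun hf hg => ⟨V.add_mem hf.1 hg.1, by rw [map_add]; exact V.add_mem hf.2 hg.2⟩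
  smul_mem' := fun c f hf => ⟨V.mul_mem_left _ hf.1, by
    rw [smul_eq_mul]
    refine parity_induction (P := fun c => D (c * f) ∈ V) c (fun q c hc => ?_) fun c d hc hd => ?_
    · rw [hD q c hc]
      exact V.add_mem (V.mul_mem_left _ hf.1) (smul_mem_ideal _ _ (V.mul_mem_left _ hf.2))
    · rw [add_mul, map_add]
      exact V.add_mem hc hd⟩

/-- Indices enter `B` one at a time, starting from the maximal ideal; `V` is replaced by the
elements of `V` that D_b maps into `V`. To find the residue of f modulo the new ideal, take the
residue r₁ of D_b(f) modulo `V`, then the residue r₀ of f - ξ_b r₁; the answer is r₀ + ξ_b r₁. -/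
theorem exists_invariant_ideal_of_subset {L : GradedSubspace m n} (hL : IsSubalg L)
    {A : Finset (Fin n)} {D : Fin n → Module.End ℂ (Lam m n)} (hD : ∀ a ∈ A, D a ∈ endPart L 1)
    (hA : IsDual A D)
    (hvan : ∀ p, ∀ X ∈ endPart L p, (∀ a ∈ A, X (C (grass n a)) = 0) →
      ∀ s, aug m n (X (gen m n s)) = 0) (B : Finset (Fin n)) (hB : B ⊆ A) :
    ∃ V : Ideal (Lam m n), V ≤ maxIdeal m n ∧
      (∀ p, ∀ X ∈ endPart L p, (∀ a ∈ A, X (C (grass n a)) = 0) → ∀ v ∈ V, X v ∈ V) ∧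
      (∀ b ∈ B, ∀ v ∈ V, D b v ∈ V) ∧
      ∀ q, ∀ f ∈ parityPart m n q, ∃ r ∈ grAdj B, (C r : Lam m n) ∈ parityPart m n q ∧
        f - C r ∈ V := by
  classical
  rw [isSubalg_iff] at hL
  induction B using Finset.induction_on with
  | empty =>
    refine ⟨maxIdeal m n, le_rfl, fun p X hX hXA v hv => ?_, by simp, fun q f hf => ?_⟩
    · have := (leibniz_of_mem (endPart_le _ _ hX)).mem_maxIdeal_pow (N := 1) (fun s => by
        rw [maxIdeal_pow_one, mem_maxIdeal_iff]
        exact hvan p X hX hXA s) v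
      rwa [maxIdeal_pow_one] at this
    · have e : (C (aug m n f • 1) : Lam m n) = aug m n f • 1 := by
        rw [smul_eq_C_algebraMap_mul, mul_one, Algebra.algebraMap_eq_smul_one]
      refine ⟨aug m n f • 1, Submodule.smul_mem _ _ (one_mem_grAdj _), ?_, ?_⟩
      · rcases zmod_two_cases q with rfl | rfl
        · rw [e]
          exact Submodule.smul_mem _ _ one_mem_parityPart
        · rw [aug_eq_zero_of_odd hf, zero_smul, map_zero]
          exact Submodule.zero_mem _
      · rw [e, mem_maxIdeal_iff]
        simp
  | insert b B hb ih =>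
    obtain ⟨V, hVm, hVX, hVD, hVr⟩ := ih ((Finset.subset_insert b B).trans hB)
    have hbA : b ∈ A := hB (Finset.mem_insert_self b B)
    have hBA : ∀ c ∈ B, c ∈ A := fun c hc => hB (Finset.mem_insert_of_mem hc)
    have hDb := hD b hbA
    have hDbL : IsLeibniz 1 (D b) := leibniz_of_mem (endPart_le _ _ hDb)
    have hDA : ∀ a ∈ A, ∀ c ∈ A, ∃ z : ℂ, D a (C (grass n c)) = z • 1 := fun a ha c hc =>
      ⟨if c = a then 1 else 0, by rw [hA a ha c hc]; split_ifs <;> simp⟩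
    -- If `X` takes constant values on the ξ_a, its bracket with D_b kills them, since fields kill
    -- constants. The bracket is thus one of the fields already known to preserve `V`.
    have hbr : ∀ p, ∀ X ∈ endPart L p, (∀ a ∈ A, ∃ z : ℂ, X (C (grass n a)) = z • 1) →
        ∀ v ∈ V, sbracket 1 p (D b) X v ∈ V := by
      intro p X hX hXA v hv
      refine hVX _ _ (hL 1 p _ hDb _ hX) (fun a ha => ?_) v hv
      obtain ⟨z, hz⟩ := hXA a ha
      obtain ⟨w, hw⟩ := hDA b hbA a ha
      rw [sbracket_apply, hz, hw, hDbL.map_smul_one,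
        (leibniz_of_mem (endPart_le _ _ hX)).map_smul_one, smul_zero, sub_zero]
    have hcomm : ∀ p, ∀ X ∈ endPart L p, (∀ a ∈ A, ∃ z : ℂ, X (C (grass n a)) = z • 1) →
        ∀ v ∈ V, X (D b v) ∈ V → D b (X v) ∈ V := by
      intro p X hX hXA v hv hv'
      have := V.add_mem (hbr p X hX hXA v hv) (smul_mem_ideal V (sgn 1 p) hv')
      rwa [sbracket_apply, sub_add_cancel] at this
    refine ⟨subideal V hDbL, fun v hv => hVm hv.1, fun p X hX hXA v hv => ⟨hVX p X hX hXA v hv.1,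
      hcomm p X hX (fun a ha => ⟨0, by rw [hXA a ha, zero_smul]⟩) v hv.1
        (hVX p X hX hXA _ hv.2)⟩, fun c hc v hv => ?_, fun q f hf => ?_⟩
    · rcases Finset.mem_insert.mp hc with rfl | hc
      · refine ⟨hv.2, ?_⟩
        -- D_b is odd, so its square is half of its bracket with itself.
        have := smul_mem_ideal V (2⁻¹ : ℂ) (hbr 1 _ hDb (hDA c hbA) v hv.1)
        rw [sbracket_apply, sgn_one_one, neg_one_smul, sub_neg_eq_add, ← two_smul ℂ,
          smul_smul, inv_mul_cancel₀ two_ne_zero, one_smul] at this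
        exact this
      · exact ⟨hVD c hc v hv.1, hcomm 1 _ (hD c (hBA c hc)) (hDA c (hBA c hc)) v hv.1
          (hVD c hc _ hv.2)⟩
    · have hdual := hA.mono hB
      have hbb : D b (C (grass n b)) = 1 := by rw [hA b hbA b hbA, if_pos rfl]
      obtain ⟨r₁, h₁, hp₁, hV₁⟩ := hVr _ _ (parity_of_mem (endPart_le _ _ hDb) hf)
      have hp : (C (grass n b * r₁) : Lam m n) ∈ parityPart m n q := by
        rw [map_mul]
        have := parityPart_mul (C_mem_parityPart (m := m) (grass_mem n b)) hp₁
        rwa [← add_assoc, zmod_two_one_add_one, zero_add] at this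
      obtain ⟨r₀, h₀, hp₀, hV₀⟩ := hVr q (f - C (grass n b * r₁)) (Submodule.sub_mem _ hf hp)
      refine ⟨r₀ + grass n b * r₁, Submodule.add_mem _
        (grAdj_mono (Finset.subset_insert b B) h₀)
        (grass_mul_mem_grAdj (Finset.mem_insert_self b B)
          (grAdj_mono (Finset.subset_insert b B) h₁)), ?_, ?_, ?_⟩
      · rw [map_add]
        exact Submodule.add_mem _ hp₀ hp
      · rw [map_add, add_comm, ← sub_sub]
        exact hV₀
      · rw [map_sub, map_add, map_add, hdual.map_C_eq_zero hb hDbL h₀,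
          apply_C_grass_mul hDbL hbb (hdual.map_C_eq_zero hb hDbL h₁), zero_add]
        exact hV₁

/-- A subalgebra that is a `Λ(m,n)`-module and whose even elements vanish at the origin
preserves an ideal complementary to a Grassmann subalgebra. -/
theorem exists_invariant_ideal {L : GradedSubspace m n} (hL : IsSubalg L)
    (hmul : ∀ a q, ∀ f ∈ parityPart m n a, ∀ X ∈ endPart L q,
      LinearMap.mulLeft ℂ f * X ∈ endPart L (a + q))
    (hvan : ∀ p, ∀ X ∈ endPart L p, ∀ i, aug m n (X (gen m n (Sum.inl i))) = 0) :
    ∃ (J : Ideal (Lam m n)) (A : Finset (Fin n)), J ≤ maxIdeal m n ∧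
      (∀ p, ∀ X ∈ endPart L p, ∀ v ∈ J, X v ∈ J) ∧
      (∀ q, ∀ f ∈ parityPart m n q, ∃ r ∈ grAdj A, (C r : Lam m n) ∈ parityPart m n q ∧
        f - C r ∈ J) ∧
      ∀ r ∈ grAdj A, (C r : Lam m n) ∈ J → r = 0 := by
  obtain ⟨A, D, hD, hA, hfr⟩ := exists_frame hmul hvan
  obtain ⟨J, hJm, hJX, hJD, hJr⟩ := exists_invariant_ideal_of_subset hL hD hA hfr A subset_rfl
  refine ⟨J, A, hJm, fun p X hX v hv => ?_, hJr, fun r hr hrJ => ?_⟩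
  · have hXW := endPart_le _ _ hX
    -- `T` agrees with `X` on every ξ_a, a ∈ A. It preserves `J` because each D_a does, and X - T
    -- preserves `J` because it kills these ξ_a.
    set T := ∑ a ∈ A, LinearMap.mulLeft ℂ (X (C (grass n a))) * D a with hT
    have hTL : T ∈ endPart L p := by
      refine Submodule.sum_mem _ fun a ha => ?_
      have := hmul _ 1 _ (parity_of_mem hXW (C_mem_parityPart (m := m) (grass_mem n a))) _ (hD a ha)
      rwa [add_assoc, zmod_two_one_add_one, add_zero] at this
    have hTv : T v ∈ J := by
      rw [hT, LinearMap.sum_apply]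
      exact J.sum_mem fun a ha => J.mul_mem_left _ (hJD a ha v hv)
    have hsub : (X - T) v ∈ J := by
      refine hJX p _ (Submodule.sub_mem _ hX hTL) (fun b hb => ?_) v hv
      rw [LinearMap.sub_apply, hT, LinearMap.sum_apply, Finset.sum_eq_single b]
      · rw [Module.End.mul_apply, hA b hb b hb, if_pos rfl, LinearMap.mulLeft_apply, mul_one,
          sub_self]
      · intro a ha hab
        rw [Module.End.mul_apply, hA a ha b hb, if_neg (Ne.symm hab), map_zero]
      · exact fun h => absurd hb h
    have := J.add_mem hsub hTv
    rwa [LinearMap.sub_apply, sub_add_cancel] at this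
  · refine hA.eq_zero_of_mem (fun a ha => leibniz_of_mem (endPart_le _ _ (hD a ha)))
      (K := J.restrictScalars ℂ) (fun f hf => mem_maxIdeal_iff.mp (hJm hf)) hJD hr hrJ

end Invariant

/-! ### Coordinate ideals -/

section CoordIdeal

variable {m n : ℕ}

/-- The projection of the Grassmann algebra that kills the `ξ_j` with `j ∉ A`. -/
def grProj (A : Finset (Fin n)) : Gr n →ₐ[ℂ] Gr n :=
  ExteriorAlgebra.map (LinearMap.pi fun j => if j ∈ A then LinearMap.proj j else 0)

theorem grProj_grass (A : Finset (Fin n)) (j : Fin n) :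
    grProj A (grass n j) = if j ∈ A then grass n j else 0 := by
  rw [grProj, grass, ExteriorAlgebra.map_apply_ι]
  have : (LinearMap.pi fun i => if i ∈ A then (LinearMap.proj i : (Fin n → ℂ) →ₗ[ℂ] ℂ) else 0)
      (Pi.single j 1) = if j ∈ A then Pi.single j 1 else 0 := by
    ext i
    by_cases hij : i = j
    · subst hij
      by_cases hi : i ∈ A <;> simp [hi]
    · by_cases hi : i ∈ A <;> by_cases hj : j ∈ A <;> simp [hi, hj, hij]
  rw [this]
  split_ifs
  · rfl
  · exact map_zero _

theorem grProj_word_of_subset {A : Finset (Fin n)} {l : List (Fin n)} (h : ∀ j ∈ l, j ∈ A) :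
    grProj A (word l) = word l := by
  induction l with
  | nil => simp
  | cons j l ih =>
    rw [word_cons, map_mul, grProj_grass, if_pos (h j List.mem_cons_self),
      ih fun k hk => h k (List.mem_cons_of_mem _ hk)]

theorem grProj_word_of_mem {A : Finset (Fin n)} {l : List (Fin n)} {j : Fin n} (hj : j ∈ l)
    (hA : j ∉ A) : grProj A (word l) = 0 := by
  obtain ⟨s, t, rfl⟩ := List.append_of_mem hj
  rw [word_append, word_cons, map_mul, map_mul, grProj_grass, if_neg hA, zero_mul, mul_zero]

theorem grProj_mem (A : Finset (Fin n)) (a : Gr n) : grProj A a ∈ grAdj A := by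
  have : Submodule.span ℂ (Set.range (word (n := n))) ≤ (grAdj A).comap (grProj A).toLinearMap := by
    refine Submodule.span_le.mpr ?_
    rintro _ ⟨l, rfl⟩
    simp only [SetLike.mem_coe, Submodule.mem_comap, AlgHom.toLinearMap_apply]
    by_cases h : ∀ j ∈ l, j ∈ A
    · rw [grProj_word_of_subset h]
      exact word_mem_grAdj h
    · push Not at h
      obtain ⟨j, hj, hA⟩ := h
      rw [grProj_word_of_mem hj hA]
      exact Submodule.zero_mem _
  exact this (span_word n ▸ Submodule.mem_top)

theorem grProj_of_mem {A : Finset (Fin n)} {a : Gr n} (ha : a ∈ grAdj A) : grProj A a = a := by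
  induction ha using Submodule.span_induction with
  | mem a ha =>
    obtain ⟨l, hl, rfl⟩ := ha
    exact grProj_word_of_subset hl
  | zero => simp
  | add x y _ _ hx hy => rw [map_add, hx, hy]
  | smul c x _ hx => rw [map_smul, hx]

theorem sub_grProj_mem_span (A : Finset (Fin n)) (a : Gr n) :
    a - grProj A a ∈ Ideal.span (grass n '' {j | j ∉ A}) := by
  have ha : a ∈ Submodule.span ℂ (Set.range (word (n := n))) := span_word n ▸ Submodule.mem_top
  induction ha using Submodule.span_induction with
  | mem a ha =>
    obtain ⟨l, rfl⟩ := ha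
    by_cases h : ∀ j ∈ l, j ∈ A
    · rw [grProj_word_of_subset h, sub_self]
      exact Ideal.zero_mem _
    · push Not at h
      obtain ⟨j, hj, hA⟩ := h
      rw [grProj_word_of_mem hj hA, sub_zero]
      obtain ⟨s, t, rfl⟩ := List.append_of_mem hj
      rw [word_append, word_cons, grass_mul_word, mul_smul_comm, ← mul_assoc, ← smul_mul_assoc]
      exact Ideal.mul_mem_left _ _ (Ideal.subset_span ⟨j, hA, rfl⟩)
  | zero => simp
  | add x y _ _ hx hy =>
    rw [map_add, add_sub_add_comm]
    exact Ideal.add_mem _ hx hy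
  | smul c x _ hx =>
    rw [map_smul, ← smul_sub, Algebra.smul_def]
    exact Ideal.mul_mem_left _ _ hx

/-- The ideal generated by the `x_i` and the `ξ_j` with `j ∉ A`. -/
def coordIdeal (m : ℕ) (A : Finset (Fin n)) : Ideal (Lam m n) :=
  RingHom.ker ((grProj A).toRingHom.comp (constantCoeff (σ := Fin m) (R := Gr n)))

theorem mem_coordIdeal {A : Finset (Fin n)} {f : Lam m n} :
    f ∈ coordIdeal m A ↔ grProj A (constantCoeff f) = 0 := Iff.rfl

/-- The indeterminates `x_i` and `ξ_j`, `j ∉ A`. -/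
def coordSet (m : ℕ) (A : Finset (Fin n)) : Set (Fin m ⊕ Fin n) := {s | ∀ j, s = Sum.inr j → j ∉ A}

theorem inl_mem_coordSet (A : Finset (Fin n)) (i : Fin m) : Sum.inl i ∈ coordSet m A :=
  fun _ h => absurd h Sum.inl_ne_inr

theorem inr_mem_coordSet {A : Finset (Fin n)} {j : Fin n} :
    Sum.inr j ∈ coordSet m A ↔ j ∉ A :=
  ⟨fun h => h j rfl, fun h _ hk => Sum.inr_injective hk ▸ h⟩

theorem gen_mem_coordIdeal {A : Finset (Fin n)} {s : Fin m ⊕ Fin n} (hs : s ∈ coordSet m A) :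
    gen m n s ∈ coordIdeal m A := by
  rw [mem_coordIdeal]
  rcases s with i | j
  · simp
  · rw [gen_inr, constantCoeff_C, grProj_grass, if_neg (inr_mem_coordSet.mp hs)]

theorem coordIdeal_eq_span (A : Finset (Fin n)) :
    coordIdeal m A = Ideal.span (gen m n '' coordSet m A) := by
  refine le_antisymm (fun f hf => ?_) (Ideal.span_le.mpr ?_)
  · obtain ⟨g, hg⟩ := exists_eq_C_add_sum_mul_X f
    rw [hg]
    refine Ideal.add_mem _ ?_ (Ideal.sum_mem _ fun i _ => Ideal.mul_mem_left _ _
      (Ideal.subset_span ⟨Sum.inl i, inl_mem_coordSet A i, rfl⟩))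
    have h := sub_grProj_mem_span A (constantCoeff f)
    rw [mem_coordIdeal.mp hf, sub_zero] at h
    have hle : Ideal.span (grass n '' {j | j ∉ A}) ≤
        (Ideal.span (gen m n '' coordSet m A)).comap (C : Gr n →+* Lam m n) := by
      refine Ideal.span_le.mpr ?_
      rintro _ ⟨j, hj, rfl⟩
      exact Ideal.subset_span ⟨Sum.inr j, inr_mem_coordSet.mpr hj, rfl⟩
    exact hle h
  · rintro _ ⟨s, hs, rfl⟩
    exact gen_mem_coordIdeal hs

theorem sub_C_mem_coordIdeal (A : Finset (Fin n)) (f : Lam m n) :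
    f - C (grProj A (constantCoeff f)) ∈ coordIdeal m A := by
  rw [mem_coordIdeal, map_sub, map_sub, constantCoeff_C, grProj_of_mem (grProj_mem A _), sub_self]

theorem coordIdeal_le (A : Finset (Fin n)) : coordIdeal m A ≤ maxIdeal m n := by
  rw [coordIdeal_eq_span]
  refine Ideal.span_le.mpr ?_
  rintro _ ⟨s, _, rfl⟩
  exact gen_mem_maxIdeal s

theorem IsLeibniz.map_mem_coordIdeal {p : ZMod 2} {X : Module.End ℂ (Lam m n)}
    (hX : IsLeibniz p X) {A : Finset (Fin n)}
    (h : ∀ s ∈ coordSet m A, X (gen m n s) ∈ coordIdeal m A) {f : Lam m n}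
    (hf : f ∈ coordIdeal m A) : X f ∈ coordIdeal m A := by
  rw [coordIdeal_eq_span] at hf
  refine Submodule.span_induction (p := fun f _ => f ∈ coordIdeal m A ∧ X f ∈ coordIdeal m A)
    ?_ ?_ ?_ ?_ hf |>.2
  · rintro _ ⟨s, hs, rfl⟩
    exact ⟨gen_mem_coordIdeal hs, h s hs⟩
  · exact ⟨Ideal.zero_mem _, by rw [map_zero]; exact Ideal.zero_mem _⟩
  · exact fun x y _ _ hx hy => ⟨Ideal.add_mem _ hx.1 hy.1, by
      rw [map_add]; exact Ideal.add_mem _ hx.2 hy.2⟩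
  · exact fun c x _ hx => (subideal (coordIdeal m A) hX).mul_mem_left c hx

theorem mem_stab_coordIdeal {A : Finset (Fin n)} {p : ZMod 2} {X : Module.End ℂ (Lam m n)} :
    X ∈ endPart (stab ((coordIdeal m A).restrictScalars ℂ)) p ↔
      X ∈ W m n p ∧ ∀ s ∈ coordSet m A, X (gen m n s) ∈ coordIdeal m A := by
  rw [mem_endPart_stab]
  exact and_congr_right fun hX => ⟨fun h s hs => h _ (gen_mem_coordIdeal hs),
    fun h f hf => (leibniz_of_mem hX).map_mem_coordIdeal h hf⟩

/-! ### Standard subalgebras as stabilizers of coordinate ideals. -/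

/-- The indices of the `ξ_j` of degree zero in the grading with `k` zeros. -/
def zeroSet (n k : ℕ) : Finset (Fin n) := Finset.univ.filter fun j => n ≤ (j : ℕ) + k

theorem mem_zeroSet {n k : ℕ} {j : Fin n} : j ∈ zeroSet n k ↔ n ≤ (j : ℕ) + k := by
  simp [zeroSet]

theorem card_zeroSet {n k : ℕ} (hk : k ≤ n) : (zeroSet n k).card = k := by
  have h : (zeroSet n k).map Fin.valEmbedding = Finset.Ico (n - k) n := by
    ext j
    simp only [Finset.mem_map, mem_zeroSet, Fin.valEmbedding_apply, Finset.mem_Ico]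
    constructor
    · rintro ⟨i, hi, rfl⟩
      have := i.2
      omega
    · rintro ⟨h₁, h₂⟩
      exact ⟨⟨j, h₂⟩, by simp only; omega, rfl⟩
  rw [← Finset.card_map Fin.valEmbedding, h, Nat.card_Ico]
  omega

theorem grassGE_eq_top {n : ℕ} {b : Fin n → ℤ} (hb : ∀ j, 0 ≤ b j) {r : ℤ} (hr : r ≤ 0) :
    grassGE b r = ⊤ := by
  rw [eq_top_iff, ← span_word]
  refine Submodule.span_mono ?_
  rintro _ ⟨l, rfl⟩
  refine ⟨l, hr.trans (List.sum_nonneg ?_), rfl⟩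
  intro x hx
  obtain ⟨j, _, rfl⟩ := List.mem_map.mp hx
  exact hb j

theorem mem_grassGE_one {A : Finset (Fin n)} {a : Gr n} :
    a ∈ grassGE (fun j => if j ∈ A then 0 else 1) 1 ↔ grProj A a = 0 := by
  set b : Fin n → ℤ := fun j => if j ∈ A then 0 else 1
  constructor
  · intro ha
    have : grassGE b 1 ≤ LinearMap.ker (grProj A).toLinearMap := by
      refine Submodule.span_le.mpr ?_
      rintro _ ⟨l, hl, rfl⟩
      have : ∃ j ∈ l, j ∉ A := by
        by_contra h
        push Not at h
        have : (l.map b).sum = 0 := List.sum_eq_zero fun x hx => by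
          obtain ⟨j, hj, rfl⟩ := List.mem_map.mp hx
          exact if_pos (h j hj)
        omega
      obtain ⟨j, hj, hA⟩ := this
      exact grProj_word_of_mem hj hA
    exact this ha
  · intro ha
    have : Submodule.span ℂ (Set.range (word (n := n))) ≤
        (grassGE b 1).comap (LinearMap.id - (grProj A).toLinearMap) := by
      refine Submodule.span_le.mpr ?_
      rintro _ ⟨l, rfl⟩
      simp only [SetLike.mem_coe, Submodule.mem_comap, LinearMap.sub_apply, LinearMap.id_apply,
        AlgHom.toLinearMap_apply]
      by_cases h : ∀ j ∈ l, j ∈ A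
      · rw [grProj_word_of_subset h, sub_self]
        exact Submodule.zero_mem _
      · push Not at h
        obtain ⟨j, hj, hA⟩ := h
        rw [grProj_word_of_mem hj hA, sub_zero]
        refine Submodule.subset_span ⟨l, ?_, rfl⟩
        have h₁ : b j ∈ l.map b := List.mem_map_of_mem hj
        have h₂ := List.single_le_sum (l := l.map b) (fun x hx => by
          obtain ⟨i, _, rfl⟩ := List.mem_map.mp hx
          simp only [b]
          split_ifs <;> simp) _ h₁
        rwa [show b j = 1 from if_neg hA] at h₂
    have h := this (span_word n ▸ Submodule.mem_top : a ∈ _)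
    rw [Submodule.mem_comap, LinearMap.sub_apply, LinearMap.id_apply, AlgHom.toLinearMap_apply, ha,
      sub_zero] at h
    exact h

theorem lamGE_zero {b : Fin n → ℤ} (hb : ∀ j, 0 ≤ b j) (f : Lam m n) :
    f ∈ lamGE (fun _ => 1) b 0 := by
  intro d
  rw [grassGE_eq_top hb]
  · trivial
  · have : 0 ≤ ∑ i, (d i : ℤ) := Finset.sum_nonneg fun i _ => by positivity
    simpa using this

theorem mem_lamGE_one {A : Finset (Fin n)} {f : Lam m n} :
    f ∈ lamGE (fun _ => 1) (fun j => if j ∈ A then 0 else 1) 1 ↔ f ∈ coordIdeal m A := by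
  rw [mem_coordIdeal, ← mem_grassGE_one]
  constructor
  · intro h
    simpa using h 0
  · intro h d
    by_cases hd : d = 0
    · subst hd
      simpa using h
    · rw [grassGE_eq_top]
      · trivial
      · intro j
        split_ifs <;> simp
      · obtain ⟨i, hi⟩ := DFunLike.ne_iff.mp hd
        have h₁ : (d i : ℤ) ≤ ∑ i, (d i : ℤ) :=
          Finset.single_le_sum (f := fun i => (d i : ℤ)) (fun i _ => by positivity)
            (Finset.mem_univ i)
        have h₂ : d i ≠ 0 := hi
        simp only [Nat.cast_one, one_mul]
        omega

/-- The standard subalgebras are the stabilizers of coordinate ideals. -/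
theorem stdSubalg_eq_stab (m n k : ℕ) :
    stdSubalg m n k = stab ((coordIdeal m (zeroSet n k)).restrictScalars ℂ) := by
  have hb : (fun j : Fin n => if (j : ℕ) + k < n then (1 : ℤ) else 0) =
      fun j => if j ∈ zeroSet n k then 0 else 1 := by
    ext j
    by_cases h : (j : ℕ) + k < n
    · rw [if_pos h, if_neg (by rw [mem_zeroSet]; omega)]
    · rw [if_neg h, if_pos (by rw [mem_zeroSet]; omega)]
  refine ext_endPart fun p => ?_
  ext X
  rw [mem_stab_coordIdeal, mem_endPart, ← exists_prop]
  refine exists_congr fun hX => ?_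
  rw [stdSubalg, hb]
  change (∀ s, X (gen m n s) ∈ lamGE _ _ _) ↔ _
  constructor
  · intro h s hs
    rw [← mem_lamGE_one]
    rcases s with i | j
    · exact h (Sum.inl i)
    · have := h (Sum.inr j)
      rwa [Sum.elim_inr, if_neg (inr_mem_coordSet.mp hs)] at this
  · intro h s
    rcases s with i | j
    · exact mem_lamGE_one.mpr (h _ (inl_mem_coordSet _ i))
    · by_cases hj : j ∈ zeroSet n k
      -- All degrees are nonnegative, so a coordinate of degree zero imposes no condition.
      · rw [Sum.elim_inr, if_pos hj]
        exact lamGE_zero (fun j => by split_ifs <;> simp) _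
      · rw [Sum.elim_inr, if_neg hj]
        exact mem_lamGE_one.mpr (h _ (inr_mem_coordSet.mpr hj))

/-! ### Openness and maximality of the stabilizers of coordinate ideals. -/

theorem constantCoeff_mem_grPow {N : ℕ} {f : Lam m n} (hf : f ∈ maxIdeal m n ^ N) :
    constantCoeff f ∈ grPow n N := by
  induction N generalizing f with
  | zero =>
    rw [grPow]
    simp only [zero_le, true_and]
    have : {w | ∃ l : List (Fin n), w = word l} = Set.range word := by ext; simp [eq_comm]
    rw [this, span_word]
    trivial
  | succ N ih =>
    refine maxIdeal_pow_succ_induction hf ?_ (fun a ha s => ?_) fun f g hf hg => ?_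
    · simp
    · rw [map_mul]
      refine grPow_mul (ih ha) (mem_grPow_one_iff.mpr ?_)
      rw [← aug_apply, aug_gen]
    · rw [map_add]
      exact Submodule.add_mem _ hf hg

/-- A series of order `n + 1` has zero constant coefficient in the Grassmann algebra, where words of
length greater than `n` vanish; so it lies in every coordinate ideal. -/
theorem isOpenSubspace_stab_coordIdeal (A : Finset (Fin n)) :
    IsOpenSubspace (stab ((coordIdeal m A).restrictScalars ℂ)) := by
  refine isOpenSubspace_iff.mpr ⟨n + 1, fun p X hX hs => mem_stab_coordIdeal.mpr ⟨hX, fun s _ => ?_⟩⟩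
  have := constantCoeff_mem_grPow (hs s)
  rw [grPow_eq_bot (Nat.lt_succ_self n), Submodule.mem_bot] at this
  rw [mem_coordIdeal, this, map_zero]

theorem isDual_derOdd (A : Finset (Fin n)) : IsDual A (derOdd m n) := fun a _ b _ => by
  rw [derOdd_C, grDer_grass]
  split_ifs <;> simp

/-- The stabilizers of coordinate ideals are maximal open subalgebras. -/
theorem isMaximalOpenSubalg_stab_coordIdeal (hm : 1 ≤ m) (A : Finset (Fin n)) :
    IsMaximalOpenSubalg (stab ((coordIdeal m A).restrictScalars ℂ)) := by
  classical
  set L := stab ((coordIdeal m A).restrictScalars ℂ) with hLdef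
  refine ⟨isSubalg_stab _, isOpenSubspace_stab_coordIdeal A, ?_, fun L' hL' hlt => ?_⟩
  · refine ne_top_of_aug_eq_zero ⟨0, hm⟩ fun X hX => ?_
    exact mem_maxIdeal_iff.mp
      (coordIdeal_le A ((mem_stab_coordIdeal.mp hX).2 _ (inl_mem_coordSet A _)))
  by_contra hne
  have ho := (isOpenSubspace_stab_coordIdeal A).mono hlt.le
  have hle := le_iff_endPart.mp hlt.le
  have hvan := fun p X hX => aug_eq_zero_of_ne_top hL' ho hne (p := p) (X := X) hX
  have hsub := isSubalg_iff.mp hL'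
  -- the values at the origin of the elements of `L'` are those of the elements of `L`
  have haug : ∀ p, ∀ X ∈ endPart L' p, ∀ s ∈ coordSet m A, aug m n (X (gen m n s)) = 0 := by
    intro p X hX s hs
    rcases s with i | j
    · exact hvan p X hX i
    have hXW := endPart_le _ _ hX
    rcases zmod_two_cases p with rfl | rfl
    · exact aug_even_inr hXW j
    set i₀ : Fin m := ⟨0, hm⟩
    -- The bracket of the odd field `X` with ξ_j ∂/∂x_{i₀} is even, and its value on x_{i₀} agrees
    -- at the origin with X(ξ_j); so the vanishing known for the x-components transfers to ξ_j.
    set Y := LinearMap.mulLeft ℂ (gen m n (Sum.inr j)) * der m n (Sum.inl i₀) with hY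
    have hYW : Y ∈ W m n 1 := by
      have := mulLeft_mul_mem (gen_mem_parityPart (m := m) (Sum.inr j)) (der_mem (n := n) (Sum.inl i₀))
      rwa [par_inr, par_inl, add_zero] at this
    have hYL : Y ∈ endPart L 1 := mem_stab_coordIdeal.mpr ⟨hYW, fun s _ => by
      rw [hY, Module.End.mul_apply, LinearMap.mulLeft_apply, der_gen]
      split_ifs
      · rw [mul_one]
        exact gen_mem_coordIdeal hs
      · rw [mul_zero]
        exact Ideal.zero_mem _⟩
    have h := hvan _ _ (hsub 1 1 X hX Y (hle 1 hYL)) i₀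
    rw [sbracket_apply, map_sub, map_smul, hY, Module.End.mul_apply, LinearMap.mulLeft_apply,
      der_gen, if_pos rfl, mul_one, Module.End.mul_apply, LinearMap.mulLeft_apply, map_mul, aug_gen,
      zero_mul, smul_zero, sub_zero] at h
    exact h
  refine not_le_of_gt hlt (le_iff_endPart.mpr fun p X hX => mem_stab_coordIdeal.mpr
    ⟨endPart_le _ _ hX, fun s hs => ?_⟩)
  -- the space of the values at `s` is stable under the `∂/∂ξ_a`
  set ev : Module.End ℂ (Lam m n) →ₗ[ℂ] Lam m n := LinearMap.applyₗ (gen m n s)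
  set K : Submodule ℂ (Lam m n) := (⨆ q, (endPart L' q).map ev) ⊔ (coordIdeal m A).restrictScalars ℂ
    with hK
  have hderL : ∀ a ∈ A, derOdd m n a ∈ endPart L 1 := fun a ha =>
    mem_stab_coordIdeal.mpr ⟨derOdd_mem a, fun t ht => by
      have hta : t ≠ Sum.inr a := fun h => ht a h ha
      have := der_gen (m := m) (n := n) (Sum.inr a) t
      rw [der_inr, if_neg hta] at this
      rw [this]
      exact Ideal.zero_mem _⟩
  have hK₀ : ∀ f ∈ K, aug m n f = 0 := by
    have : K ≤ LinearMap.ker (aug m n).toLinearMap := by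
      refine sup_le (iSup_le fun q => ?_) fun f hf => mem_maxIdeal_iff.mp (coordIdeal_le A hf)
      rintro _ ⟨Y, hY, rfl⟩
      exact haug q Y hY s hs
    exact this
  have hDK : ∀ a ∈ A, ∀ f ∈ K, derOdd m n a f ∈ K := by
    intro a ha
    have : K ≤ K.comap (derOdd m n a) := by
      refine sup_le (iSup_le fun q => ?_) fun f hf => ?_
      · rintro _ ⟨Y, hY, rfl⟩
        have h := hsub 1 q _ (hle 1 (hderL a ha)) Y hY
        have e : sbracket 1 q (derOdd m n a) Y (gen m n s) = derOdd m n a (Y (gen m n s)) := by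
          have hsa : s ≠ Sum.inr a := fun h => hs a h ha
          have := der_gen (m := m) (n := n) (Sum.inr a) s
          rw [der_inr, if_neg hsa] at this
          rw [sbracket_apply, this, map_zero, smul_zero, sub_zero]
        refine Submodule.mem_sup_left (Submodule.mem_iSup_of_mem (1 + q) ⟨_, h, e⟩)
      · exact Submodule.mem_sup_right ((mem_endPart_stab.mp (hderL a ha)).2 f hf)
    exact this
  have hXK : X (gen m n s) ∈ K :=
    Submodule.mem_sup_left (Submodule.mem_iSup_of_mem p ⟨X, hX, rfl⟩)
  -- The residue of the value modulo the coordinate ideal lies in the Grassmann algebra on `A` and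
  -- in `K`, so it is zero.
  have hr := sub_C_mem_coordIdeal A (X (gen m n s))
  have hrK : (C (grProj A (constantCoeff (X (gen m n s)))) : Lam m n) ∈ K := by
    have := K.sub_mem hXK (Submodule.mem_sup_right hr)
    rwa [sub_sub_cancel] at this
  have := (isDual_derOdd A).eq_zero_of_mem (fun a _ => leibniz_of_mem (derOdd_mem a)) hK₀ hDK
    (grProj_mem A _) hrK
  rwa [mem_coordIdeal]

end CoordIdeal

/-! ### Exponentials of nilpotent vector fields -/

section Exp

variable {m n : ℕ}

theorem adEnd_mem {E : Module.End ℂ (Lam m n)} (hE : E ∈ W m n 0) (p : ZMod 2) :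
    ∀ X ∈ W m n p, (LinearMap.mulLeft ℂ E - LinearMap.mulRight ℂ E) X ∈ W m n p := by
  intro X hX
  have := sbracket_mem hE hX
  rwa [zero_add, sbracket_even_left] at this

/-- The inner derivation of `W(m,n)` given by an even vector field. -/
def adW {E : Module.End ℂ (Lam m n)} (hE : E ∈ W m n 0) (p : ZMod 2) : Module.End ℂ (W m n p) :=
  (LinearMap.mulLeft ℂ E - LinearMap.mulRight ℂ E).restrict (adEnd_mem hE p)

theorem coe_adW {E : Module.End ℂ (Lam m n)} (hE : E ∈ W m n 0) {p : ZMod 2} (X : W m n p) :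
    (adW hE p X).1 = E * X.1 - X.1 * E := rfl

theorem isNilpotent_mulLeft_sub_mulRight {A : Type*} [Ring A] [Algebra ℂ A] {E : A}
    (h : IsNilpotent E) : IsNilpotent (LinearMap.mulLeft ℂ E - LinearMap.mulRight ℂ E) := by
  obtain ⟨k, hk⟩ := h
  refine (LinearMap.commute_mulLeft_right E E).isNilpotent_sub ⟨k, ?_⟩ ⟨k, ?_⟩
  · rw [LinearMap.pow_mulLeft, hk, LinearMap.mulLeft_zero_eq_zero]
  · rw [LinearMap.pow_mulRight, hk, LinearMap.mulRight_zero_eq_zero]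

/-- Left and right multiplications commute, so the exponential of their difference factors. -/
theorem exp_mulLeft_sub_mulRight {A : Type*} [Ring A] [Algebra ℂ A] [Module ℚ A] {E : A}
    (h : IsNilpotent E) (X : A) :
    IsNilpotent.exp (LinearMap.mulLeft ℂ E - LinearMap.mulRight ℂ E) X =
      IsNilpotent.exp E * X * IsNilpotent.exp (-E) := by
  obtain ⟨k, hk⟩ := h
  have hk' : (-E) ^ k = 0 := by rw [neg_pow, hk, mul_zero]
  have h₁ : (LinearMap.mulLeft ℂ E) ^ k = 0 := by
    rw [LinearMap.pow_mulLeft, hk, LinearMap.mulLeft_zero_eq_zero]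
  have h₂ : (LinearMap.mulRight ℂ (-E)) ^ k = 0 := by
    rw [LinearMap.pow_mulRight, hk', LinearMap.mulRight_zero_eq_zero]
  have e : LinearMap.mulLeft ℂ E - LinearMap.mulRight ℂ E =
      LinearMap.mulLeft ℂ E + LinearMap.mulRight ℂ (-E) := by
    ext1 x
    simp [sub_eq_add_neg]
  rw [e, IsNilpotent.exp_add_of_commute (LinearMap.commute_mulLeft_right _ _) ⟨k, h₁⟩ ⟨k, h₂⟩,
    IsNilpotent.exp_eq_sum h₁, IsNilpotent.exp_eq_sum h₂, IsNilpotent.exp_eq_sum hk,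
    IsNilpotent.exp_eq_sum hk', Module.End.mul_apply]
  simp only [LinearMap.sum_apply, LinearMap.smul_apply, LinearMap.pow_mulLeft,
    LinearMap.pow_mulRight, LinearMap.mulLeft_apply, LinearMap.mulRight_apply, Finset.sum_mul,
    Finset.mul_sum, smul_mul_assoc, mul_smul_comm, mul_assoc, Finset.smul_sum]
  rw [Finset.sum_comm]
  exact Finset.sum_congr rfl fun _ _ => Finset.sum_congr rfl fun _ _ => smul_comm _ _ _

theorem coe_adW_pow {E : Module.End ℂ (Lam m n)} (hE : E ∈ W m n 0) {p : ZMod 2} (j : ℕ)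
    (X : W m n p) :
    ((adW hE p ^ j) X).1 = ((LinearMap.mulLeft ℂ E - LinearMap.mulRight ℂ E) ^ j) X.1 := by
  induction j with
  | zero => rfl
  | succ j ih =>
    rw [pow_succ', pow_succ', Module.End.mul_apply, Module.End.mul_apply, ← ih]
    rfl

theorem exp_apply_eq_sum {M : Type*} [AddCommGroup M] [Module ℂ M] [Module ℚ M]
    {T : Module.End ℂ M} {k : ℕ} (hk : T ^ k = 0) (x : M) :
    IsNilpotent.exp T x = ∑ j ∈ Finset.range k, (j.factorial : ℂ)⁻¹ • (T ^ j) x := by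
  rw [IsNilpotent.exp_eq_sum hk, LinearMap.sum_apply]
  refine Finset.sum_congr rfl fun j _ => ?_
  rw [LinearMap.smul_apply, ← Rat.cast_smul_eq_qsmul ℂ]
  simp

theorem exp_neg_exp {M : Type*} [AddCommGroup M] [Module ℂ M] [Module ℚ M]
    {T : Module.End ℂ M} (h : IsNilpotent T) (x : M) :
    IsNilpotent.exp (-T) (IsNilpotent.exp T x) = x :=
  LinearMap.congr_fun (IsNilpotent.exp_neg_mul_exp_self h) x

theorem exp_exp_neg {M : Type*} [AddCommGroup M] [Module ℂ M] [Module ℚ M]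
    {T : Module.End ℂ M} (h : IsNilpotent T) (x : M) :
    IsNilpotent.exp T (IsNilpotent.exp (-T) x) = x :=
  LinearMap.congr_fun (IsNilpotent.exp_mul_exp_neg_self h) x

theorem exp_apply_mem {M : Type*} [AddCommGroup M] [Module ℂ M] [Module ℚ M]
    {T : Module.End ℂ M} (hT : IsNilpotent T) {S : Submodule ℂ M} (h : ∀ x ∈ S, T x ∈ S) :
    ∀ x ∈ S, IsNilpotent.exp T x ∈ S := by
  obtain ⟨k, hk⟩ := hT
  intro x hx
  rw [exp_apply_eq_sum hk]
  refine Submodule.sum_mem _ fun j hj => Submodule.smul_mem _ _ ?_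
  clear hj
  induction j with
  | zero => exact hx
  | succ j ih =>
    rw [pow_succ', Module.End.mul_apply]
    exact h _ ih

/-- The automorphism `exp (ad E)` of `W(m,n)` for a nilpotent even vector field `E`. -/
def expAd {E : Module.End ℂ (Lam m n)} (hE : E ∈ W m n 0) (h : IsNilpotent E) (p : ZMod 2) :
    W m n p ≃ₗ[ℂ] W m n p :=
  have hT := isNilpotent_mulLeft_sub_mulRight h
  LinearEquiv.ofLinearMap
    ((IsNilpotent.exp (LinearMap.mulLeft ℂ E - LinearMap.mulRight ℂ E)).restrict
      (exp_apply_mem hT (adEnd_mem hE p)))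
    ((IsNilpotent.exp (-(LinearMap.mulLeft ℂ E - LinearMap.mulRight ℂ E))).restrict
      (exp_apply_mem hT.neg fun X hX => Submodule.neg_mem _ (adEnd_mem hE p X hX)))
    (LinearMap.ext fun X => Subtype.ext (exp_exp_neg hT X.1))
    (LinearMap.ext fun X => Subtype.ext (exp_neg_exp hT X.1))

theorem coe_expAd {E : Module.End ℂ (Lam m n)} (hE : E ∈ W m n 0) (h : IsNilpotent E)
    {p : ZMod 2} (X : W m n p) :
    (expAd hE h p X).1 = IsNilpotent.exp E * X.1 * IsNilpotent.exp (-E) :=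
  exp_mulLeft_sub_mulRight h X.1

theorem isEvenDer_adW {E : Module.End ℂ (Lam m n)} (hE : E ∈ W m n 0) : IsEvenDer (adW hE) := by
  refine ⟨fun p q X Y => Subtype.ext ?_, fun N => ⟨N + 1, fun p X hX s => ?_⟩⟩
  · change E * (X.1 * Y.1 - sgn p q • (Y.1 * X.1)) - (X.1 * Y.1 - sgn p q • (Y.1 * X.1)) * E =
      ((E * X.1 - X.1 * E) * Y.1 - sgn p q • (Y.1 * (E * X.1 - X.1 * E))) +
      (X.1 * (E * Y.1 - Y.1 * E) - sgn p q • ((E * Y.1 - Y.1 * E) * X.1))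
    simp only [mul_sub, sub_mul, smul_sub, mul_smul_comm, smul_mul_assoc, mul_assoc]
    abel
  · rw [coe_adW, LinearMap.sub_apply, Module.End.mul_apply, Module.End.mul_apply]
    exact Ideal.sub_mem _ ((leibniz_of_mem hE).lower (hX s))
      (maxIdeal_pow_le N.le_succ ((leibniz_of_mem X.2).mem_maxIdeal_pow hX _))

theorem isExp_expAd {E : Module.End ℂ (Lam m n)} (hE : E ∈ W m n 0) (h : IsNilpotent E) :
    IsExp (adW hE) (expAd hE h) := by
  intro p X l _
  obtain ⟨k, hk⟩ := isNilpotent_mulLeft_sub_mulRight h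
  have e : expAd hE h p X = ∑ j ∈ Finset.range k, (j.factorial : ℂ)⁻¹ • (adW hE p ^ j) X := by
    refine Subtype.ext ((exp_apply_eq_sum hk X.1).trans ?_)
    rw [AddSubmonoidClass.coe_finsetSum]
    exact Finset.sum_congr rfl fun j _ => congrArg _ (coe_adW_pow hE j X).symm
  rw [e, map_sum]
  refine hasSum_sum_of_ne_finset_zero fun j hj => ?_
  rw [Finset.mem_range, not_lt] at hj
  have e₀ : (adW hE p ^ j) X = 0 := Subtype.ext <| by
    rw [coe_adW_pow, pow_eq_zero_of_le hj hk]
    rfl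
  rw [e₀, smul_zero, map_zero]

theorem expAd_mem_innerGroup {E : Module.End ℂ (Lam m n)} (hE : E ∈ W m n 0)
    (h : IsNilpotent E) : (expAd hE h : (p : ZMod 2) → (W m n p ≃ₗ[ℂ] W m n p)) ∈ innerGroup m n :=
  Subgroup.subset_closure ⟨_, isEvenDer_adW hE, isExp_expAd hE h⟩

/-- On operators exp(ad E) is conjugation by exp E, so it transports stabilizers. Conjugacy of
subalgebras is thereby reduced to moving ideals by automorphisms of Λ(m,n). -/
theorem conj_expAd_stab {E : Module.End ℂ (Lam m n)} (hE : E ∈ W m n 0) (h : IsNilpotent E)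
    (I : Submodule ℂ (Lam m n)) :
    conj (expAd hE h) (stab I) = stab (I.map (IsNilpotent.exp E)) := by
  refine funext fun p => ?_
  ext X
  constructor
  · rintro ⟨Y, hY, rfl⟩
    rintro _ ⟨f, hf, rfl⟩
    refine ⟨Y.1 f, hY f hf, ?_⟩
    change _ = (expAd hE h p Y).1 _
    rw [coe_expAd, Module.End.mul_apply, Module.End.mul_apply, exp_neg_exp h]
  · intro hX
    refine ⟨(expAd hE h p).symm X, fun f hf => ?_, (expAd hE h p).apply_symm_apply X⟩
    obtain ⟨f', hf', e⟩ := hX _ ⟨f, hf, rfl⟩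
    set Y := (expAd hE h p).symm X with hY
    have hXY : expAd hE h p Y = X := (expAd hE h p).apply_symm_apply X
    change Y.1 f ∈ I
    have e' : IsNilpotent.exp E f' = IsNilpotent.exp E (Y.1 f) := by
      rw [e, ← hXY]
      change (expAd hE h p Y).1 _ = _
      rw [coe_expAd, Module.End.mul_apply, Module.End.mul_apply, exp_neg_exp h]
    have := congrArg (fun x => (IsNilpotent.exp (-E) : Module.End ℂ (Lam m n)) x) e'
    beta_reduce at this
    rw [exp_neg_exp h, exp_neg_exp h] at this
    exact this ▸ hf'

theorem conj_one (L : GradedSubspace m n) : conj 1 L = L :=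
  funext fun p => Submodule.map_id (L p)

theorem conj_mul (g h : (p : ZMod 2) → (W m n p ≃ₗ[ℂ] W m n p)) (L : GradedSubspace m n) :
    conj (g * h) L = conj g (conj h L) :=
  funext fun p => Submodule.map_comp (h p).toLinearMap (g p).toLinearMap (L p)

theorem exp_mul_apply {E : Module.End ℂ (Lam m n)} (hE : IsLeibniz 0 E) (h : IsNilpotent E)
    (f g : Lam m n) :
    IsNilpotent.exp E (f * g) = IsNilpotent.exp E f * IsNilpotent.exp E g :=
  Module.End.exp_mul_of_derivation ℂ (Lam m n) E
    (fun x y => by rw [hE.even_mul, add_comm]) h f g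

theorem exp_apply_of_sq {E : Module.End ℂ (Lam m n)} (h : IsNilpotent E) {f : Lam m n}
    (hf : E (E f) = 0) : IsNilpotent.exp E f = f + E f := by
  have := IsNilpotent.exp_smul_eq_sum (M := Lam m n) (a := E) (m := f) (k := 2)
    (by rw [pow_two]; exact hf) h
  rw [Finset.sum_range_succ, Finset.sum_range_one] at this
  simpa using this

theorem exp_apply_of_eq_zero {E : Module.End ℂ (Lam m n)} (h : IsNilpotent E) {f : Lam m n}
    (hf : E f = 0) : IsNilpotent.exp E f = f := by
  rw [exp_apply_of_sq h (by rw [hf, map_zero]), hf, add_zero]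

/-- A multiplicative map sends a coordinate ideal into an ideal that contains the images of its
generators. -/
theorem map_coordIdeal_le {φ : Module.End ℂ (Lam m n)} (hφ : ∀ f g, φ (f * g) = φ f * φ g)
    {A : Finset (Fin n)} {J : Ideal (Lam m n)} (h : ∀ s ∈ coordSet m A, φ (gen m n s) ∈ J)
    {f : Lam m n} (hf : f ∈ coordIdeal m A) : φ f ∈ J := by
  rw [coordIdeal_eq_span] at hf
  refine Submodule.span_induction (p := fun f _ => φ f ∈ J) ?_ ?_ ?_ ?_ hf
  · rintro _ ⟨s, hs, rfl⟩
    exact h s hs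
  · rw [map_zero]
    exact J.zero_mem
  · intro x y _ _ hx hy
    rw [map_add]
    exact J.add_mem hx hy
  · intro c x _ hx
    rw [smul_eq_mul, hφ]
    exact J.mul_mem_left _ hx

/-! ### Transvections -/

/-- The even vector field `ξ_a ∂/∂ξ_b`. -/
def transField (m : ℕ) (a b : Fin n) : Module.End ℂ (Lam m n) :=
  LinearMap.mulLeft ℂ (gen m n (Sum.inr a)) * der m n (Sum.inr b)

theorem transField_mem (a b : Fin n) : transField m a b ∈ W m n 0 := by
  have := mulLeft_mul_mem (gen_mem_parityPart (m := m) (Sum.inr a)) (der_mem (m := m) (Sum.inr b))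
  rwa [par_inr, par_inr, zmod_two_one_add_one] at this

theorem transField_gen (a b : Fin n) (s : Fin m ⊕ Fin n) :
    transField m a b (gen m n s) = if s = Sum.inr b then gen m n (Sum.inr a) else 0 := by
  rw [transField, Module.End.mul_apply, LinearMap.mulLeft_apply, der_gen]
  split_ifs <;> simp

theorem transField_sq {a b : Fin n} (hab : a ≠ b) : transField m a b ^ 2 = 0 := by
  rw [pow_two]
  ext1 f
  have h := leibniz_of_mem (der_mem (m := m) (Sum.inr b)) 1 _
    (gen_mem_parityPart (m := m) (Sum.inr a)) (der m n (Sum.inr b) f)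
  rw [der_gen, if_neg (fun h => hab (Sum.inr_injective h)), zero_mul, zero_add] at h
  simp only [transField, Module.End.mul_apply, LinearMap.mulLeft_apply, LinearMap.zero_apply]
  rw [h, mul_smul_comm, ← mul_assoc, gen_inr, ← map_mul, grass_mul_self, map_zero, zero_mul,
    smul_zero]

theorem isNilpotent_transField {a b : Fin n} (hab : a ≠ b) : IsNilpotent (transField m a b) :=
  ⟨2, transField_sq hab⟩

theorem isNilpotent_neg_transField {a b : Fin n} (hab : a ≠ b) :
    IsNilpotent (-transField m a b) := (isNilpotent_transField hab).neg

theorem exp_transField_gen {a b : Fin n} (hab : a ≠ b) (s : Fin m ⊕ Fin n) :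
    IsNilpotent.exp (transField m a b) (gen m n s) =
      gen m n s + if s = Sum.inr b then gen m n (Sum.inr a) else 0 := by
  rw [exp_apply_of_sq (isNilpotent_transField hab), transField_gen]
  have := LinearMap.congr_fun (transField_sq (m := m) hab) (gen m n s)
  rwa [pow_two] at this

theorem exp_neg_transField_gen {a b : Fin n} (hab : a ≠ b) (s : Fin m ⊕ Fin n) :
    IsNilpotent.exp (-transField m a b) (gen m n s) =
      gen m n s - if s = Sum.inr b then gen m n (Sum.inr a) else 0 := by
  rw [exp_apply_of_sq (isNilpotent_neg_transField hab), LinearMap.neg_apply, transField_gen,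
    sub_eq_add_neg]
  have := LinearMap.congr_fun (transField_sq (m := m) hab) (gen m n s)
  rw [pow_two] at this
  rw [LinearMap.neg_apply, LinearMap.neg_apply, map_neg, neg_neg]
  exact this

/-- The automorphism exp(-ξ_b ∂/∂ξ_a) exp(ξ_a ∂/∂ξ_b) sends ξ_b to ξ_b + (ξ_a - ξ_b) = ξ_a; its
inverse sends ξ_a to ξ_b. The remaining generators of either ideal are fixed. -/
theorem exists_conj_exchange (m : ℕ) {A : Finset (Fin n)} {a b : Fin n} (ha : a ∈ A)
    (hb : b ∉ A) :
    ∃ g ∈ innerGroup m n, stab ((coordIdeal m (insert b (A.erase a))).restrictScalars ℂ) =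
      conj g (stab ((coordIdeal m A).restrictScalars ℂ)) := by
  have hab : a ≠ b := fun h => hb (h ▸ ha)
  set A' := insert b (A.erase a) with hA'
  have h₁ := isNilpotent_transField (m := m) hab
  have h₂ := isNilpotent_neg_transField (m := m) hab.symm
  have m₁ := transField_mem (m := m) a b
  have m₂ := Submodule.neg_mem _ (transField_mem (m := m) b a)
  set φ := IsNilpotent.exp (transField m a b)
  set ψ := IsNilpotent.exp (-transField m b a)
  have hφψ : ∀ f g, (ψ * φ) (f * g) = (ψ * φ) f * (ψ * φ) g := fun f g => by
    simp only [Module.End.mul_apply]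
    rw [exp_mul_apply (leibniz_of_mem m₁) h₁, exp_mul_apply (leibniz_of_mem m₂) h₂]
  have m₁' := Submodule.neg_mem _ m₁
  have m₂' := transField_mem (m := m) b a
  set φ' := IsNilpotent.exp (-transField m a b)
  set ψ' := IsNilpotent.exp (transField m b a)
  have hφψ' : ∀ f g, (φ' * ψ') (f * g) = (φ' * ψ') f * (φ' * ψ') g := fun f g => by
    simp only [Module.End.mul_apply]
    rw [exp_mul_apply (leibniz_of_mem m₂') (isNilpotent_transField hab.symm),
      exp_mul_apply (leibniz_of_mem m₁') (isNilpotent_neg_transField hab)]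
  have hgen : ∀ s ∈ coordSet m A, (ψ * φ) (gen m n s) ∈ coordIdeal m A' := by
    intro s hs
    rw [Module.End.mul_apply, exp_transField_gen hab]
    by_cases hsb : s = Sum.inr b
    · subst hsb
      rw [if_pos rfl, map_add, exp_neg_transField_gen hab.symm, exp_neg_transField_gen hab.symm,
        if_neg (fun h => hab.symm (Sum.inr_injective h)), if_pos rfl, sub_zero, add_sub_cancel]
      refine gen_mem_coordIdeal (inr_mem_coordSet.mpr ?_)
      simp [hA', hab]
    · have hsa : s ≠ Sum.inr a := fun h => hs a h ha
      rw [if_neg hsb, add_zero, exp_neg_transField_gen hab.symm, if_neg hsa, sub_zero]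
      refine gen_mem_coordIdeal fun j hj => ?_
      have h₁ := hs j hj
      have h₂ : j ≠ b := fun h => hsb (h ▸ hj)
      simp [hA', h₁, h₂]
  have hgen' : ∀ s ∈ coordSet m A', (φ' * ψ') (gen m n s) ∈ coordIdeal m A := by
    intro s hs
    rw [Module.End.mul_apply, exp_transField_gen hab.symm]
    by_cases hsa : s = Sum.inr a
    · subst hsa
      rw [if_pos rfl, map_add, exp_neg_transField_gen hab, exp_neg_transField_gen hab,
        if_neg (fun h => hab (Sum.inr_injective h)), if_pos rfl, sub_zero, add_sub_cancel]
      exact gen_mem_coordIdeal (inr_mem_coordSet.mpr hb)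
    · have hsb : s ≠ Sum.inr b := fun h => hs b h (by simp [hA'])
      rw [if_neg hsa, add_zero, exp_neg_transField_gen hab, if_neg hsb, sub_zero]
      refine gen_mem_coordIdeal fun j hj => ?_
      have h₁ := hs j hj
      have h₂ : j ≠ a := fun h => hsa (h ▸ hj)
      simp only [hA', Finset.mem_insert, Finset.mem_erase, not_or, not_and] at h₁
      exact h₁.2 h₂
  refine ⟨expAd m₂ h₂ * expAd m₁ h₁, Subgroup.mul_mem _ (expAd_mem_innerGroup m₂ h₂)
    (expAd_mem_innerGroup m₁ h₁), ?_⟩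
  rw [conj_mul, conj_expAd_stab, conj_expAd_stab, ← Submodule.map_comp]
  congr 1
  refine le_antisymm (fun f hf => ⟨(φ' * ψ') f, map_coordIdeal_le hφψ' hgen' hf, ?_⟩) ?_
  · rintro _ ⟨f, hf, rfl⟩
    exact map_coordIdeal_le hφψ hgen hf
  · change ψ (φ (φ' (ψ' f))) = f
    rw [exp_exp_neg h₁]
    have := exp_exp_neg h₂ f
    rwa [neg_neg] at this

/-- Each exchange trades an element of `A \ B` for one of `B \ A`, lowering the size of `A \ B` by
one. -/
theorem exists_conj_coordIdeal (m : ℕ) (A B : Finset (Fin n)) (h : A.card = B.card) :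
    ∃ g ∈ innerGroup m n, stab ((coordIdeal m A).restrictScalars ℂ) =
      conj g (stab ((coordIdeal m B).restrictScalars ℂ)) := by
  classical
  induction hk : (A \ B).card generalizing A with
  | zero =>
    have hAB : A = B := Finset.eq_of_subset_of_card_le
      (Finset.sdiff_eq_empty_iff_subset.mp (Finset.card_eq_zero.mp hk)) h.ge
    exact ⟨1, Subgroup.one_mem _, by rw [hAB, conj_one]⟩
  | succ k ih =>
    obtain ⟨b, hb⟩ := Finset.card_pos.mp (show 0 < (A \ B).card by omega)
    have hcard : (B \ A).card = (A \ B).card := by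
      have h₁ := Finset.card_sdiff_add_card_inter A B
      have h₂ := Finset.card_sdiff_add_card_inter B A
      rw [Finset.inter_comm] at h₂
      omega
    obtain ⟨a, ha⟩ := Finset.card_pos.mp (show 0 < (B \ A).card by omega)
    rw [Finset.mem_sdiff] at ha hb
    set A' := insert a (A.erase b) with hA'
    have haA : a ∉ A.erase b := fun h => ha.2 (Finset.mem_of_mem_erase h)
    have hA'card : A'.card = B.card := by
      rw [hA', Finset.card_insert_of_notMem haA, Finset.card_erase_of_mem hb.1, ← h]
      have := Finset.card_pos.mpr ⟨b, hb.1⟩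
      omega
    have hk' : (A' \ B).card = k := by
      have : A' \ B = (A \ B).erase b := by
        ext j
        simp only [hA', Finset.mem_sdiff, Finset.mem_insert, Finset.mem_erase]
        constructor
        · rintro ⟨rfl | hj, hjB⟩
          · exact absurd ha.1 hjB
          · exact ⟨hj.1, hj.2, hjB⟩
        · rintro ⟨h₁, h₂, h₃⟩
          exact ⟨Or.inr ⟨h₁, h₂⟩, h₃⟩
      rw [this, Finset.card_erase_of_mem (Finset.mem_sdiff.mpr hb), hk]
      rfl
    obtain ⟨g, hg, e⟩ := ih A' hA'card hk'
    have hba : b ≠ a := fun h => ha.2 (h ▸ hb.1)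
    obtain ⟨g', hg', e'⟩ := exists_conj_exchange m (A := A') (a := a) (b := b)
      (Finset.mem_insert_self _ _) (by simp [hA', hba])
    have hback : insert b (A'.erase a) = A := by
      rw [hA', Finset.erase_insert haA, Finset.insert_erase hb.1]
    rw [hback] at e'
    exact ⟨g' * g, Subgroup.mul_mem _ hg' hg, by rw [e', e, conj_mul]⟩

end Exp

/-! ### Straightening the invariant ideal -/

section Straighten

variable {m n : ℕ}

/-- The span of the words with at least `r` letters in `A`. -/
def grPowAdj (A : Finset (Fin n)) (r : ℕ) : Submodule ℂ (Gr n) :=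
  Submodule.span ℂ {w | ∃ l : List (Fin n), r ≤ l.countP (· ∈ A) ∧ w = word l}

theorem grPowAdj_mul {A : Finset (Fin n)} {r s : ℕ} {a b : Gr n} (ha : a ∈ grPowAdj A r)
    (hb : b ∈ grPowAdj A s) : a * b ∈ grPowAdj A (r + s) := by
  have h := Submodule.mul_mem_mul ha hb
  rw [grPowAdj, grPowAdj, Submodule.span_mul_span] at h
  refine Submodule.span_mono ?_ h
  rintro _ ⟨_, ⟨l, hl, rfl⟩, _, ⟨l', hl', rfl⟩, rfl⟩
  exact ⟨l ++ l', by rw [List.countP_append]; omega, (word_append l l').symm⟩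

theorem grPowAdj_eq_bot {A : Finset (Fin n)} {r : ℕ} (h : n < r) : grPowAdj A r = ⊥ := by
  refine eq_bot_iff.mpr (Submodule.span_le.mpr ?_)
  rintro _ ⟨l, hl, rfl⟩
  have := List.countP_le_length (p := fun j => decide (j ∈ A)) (l := l)
  simpa using word_eq_zero_of_length l (by omega)

/-- Differentiation by ξ_j with j ∉ A only removes letters outside `A`. -/
theorem grDer_word_mem_grPowAdj {A : Finset (Fin n)} {j : Fin n} (hj : j ∉ A) (l : List (Fin n)) :
    grDer n j (word l) ∈ grPowAdj A (l.countP (· ∈ A)) := by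
  induction l with
  | nil => simp
  | cons i l ih =>
    rw [word_cons, grDer_grass_mul]
    refine Submodule.sub_mem _ ?_ ?_
    · split_ifs with h
      · subst h
        rw [one_smul, List.countP_cons_of_neg (by simpa using hj)]
        exact Submodule.subset_span ⟨l, le_rfl, rfl⟩
      · rw [zero_smul]
        exact Submodule.zero_mem _
    · have h₁ : grass n i ∈ grPowAdj A (List.countP (· ∈ A) [i]) :=
        Submodule.subset_span ⟨[i], le_rfl, by simp⟩
      have := grPowAdj_mul h₁ ih
      rwa [← List.countP_append] at this

theorem grPowAdj_mono {A : Finset (Fin n)} {r s : ℕ} (h : r ≤ s) : grPowAdj A s ≤ grPowAdj A r := by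
  refine Submodule.span_mono ?_
  rintro _ ⟨l, hl, rfl⟩
  exact ⟨l, h.trans hl, rfl⟩

theorem grDer_mem_grPowAdj {A : Finset (Fin n)} {j : Fin n} (hj : j ∉ A) {r : ℕ} {a : Gr n}
    (ha : a ∈ grPowAdj A r) : grDer n j a ∈ grPowAdj A r := by
  have : grPowAdj A r ≤ (grPowAdj A r).comap (grDer n j) := by
    refine Submodule.span_le.mpr ?_
    rintro _ ⟨l, hl, rfl⟩
    exact grPowAdj_mono hl (grDer_word_mem_grPowAdj hj l)
  exact this ha

theorem mem_grPowAdj_one {A : Finset (Fin n)} {a : Gr n} (ha : a ∈ grAdj A)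
    (h : grAug n a = 0) : a ∈ grPowAdj A 1 := by
  have : grAdj A ≤ (grPowAdj A 1).comap
      (LinearMap.id - (Algebra.linearMap ℂ (Gr n)) ∘ₗ (grAug n).toLinearMap) := by
    refine Submodule.span_le.mpr ?_
    rintro _ ⟨l, hl, rfl⟩
    cases l with
    | nil => simp
    | cons j l =>
      have e : grAug n (word (j :: l)) = 0 := by simp
      simp only [SetLike.mem_coe, Submodule.mem_comap, LinearMap.sub_apply, LinearMap.id_apply,
        LinearMap.comp_apply, AlgHom.toLinearMap_apply, e, map_zero, sub_zero]
      refine Submodule.subset_span ⟨_, ?_, rfl⟩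
      rw [List.countP_cons_of_pos (by simpa using hl j List.mem_cons_self)]
      omega
  have h' := this ha
  rw [Submodule.mem_comap, LinearMap.sub_apply, LinearMap.id_apply, LinearMap.comp_apply,
    AlgHom.toLinearMap_apply, h, map_zero, sub_zero] at h'
  exact h'

theorem mem_grPowAdj_zero (A : Finset (Fin n)) (a : Gr n) : a ∈ grPowAdj A 0 := by
  rw [grPowAdj]
  simp only [zero_le, true_and]
  have : {w | ∃ l : List (Fin n), w = word l} = Set.range word := by ext; simp [eq_comm]
  rw [this, span_word]
  trivial

/-- Vector fields that shift the coordinates `x_i`, `ξ_j` with `j ∉ A` by elements of the Grassmann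
algebra on the remaining coordinates are nilpotent. -/
theorem isNilpotent_vectorField {A : Finset (Fin n)} {r : Fin m ⊕ Fin n → Gr n}
    (hr : ∀ s, r s ∈ grAdj A) (h₀ : ∀ s, grAug n (r s) = 0) (hA : ∀ a ∈ A, r (Sum.inr a) = 0) :
    IsNilpotent (vectorField fun s => (C (r s) : Lam m n)) := by
  set E := vectorField fun s => (C (r s) : Lam m n) with hE
  -- Each application of `E` multiplies by a Grassmann element on `A` without constant term, adding
  -- a letter of `A`, and its derivatives remove none. More than `n` letters give zero.
  have key : ∀ (k : ℕ) (f : Lam m n), ∀ d, coeff d ((E ^ k) f) ∈ grPowAdj A k := by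
    intro k
    induction k with
    | zero => exact fun f d => mem_grPowAdj_zero A _
    | succ k ih =>
      intro f d
      rw [pow_succ', Module.End.mul_apply, hE, vectorField_apply, map_sum]
      refine Submodule.sum_mem _ fun s _ => ?_
      rw [coeff_C_mul, add_comm k]
      rcases s with i | j
      · refine grPowAdj_mul (mem_grPowAdj_one (hr _) (h₀ _)) ?_
        rw [der_inl, coeff_derEven]
        exact Submodule.smul_mem _ _ (ih f _)
      · by_cases hj : j ∈ A
        · rw [hA j hj, zero_mul]
          exact Submodule.zero_mem _
        · exact grPowAdj_mul (mem_grPowAdj_one (hr _) (h₀ _)) (grDer_mem_grPowAdj hj (ih f d))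
  refine ⟨n + 1, LinearMap.ext fun f => MvPowerSeries.ext fun d => ?_⟩
  have := key (n + 1) f d
  rw [grPowAdj_eq_bot (Nat.lt_succ_self n), Submodule.mem_bot] at this
  rw [this, LinearMap.zero_apply, map_zero]

/-- An ideal complementary to a Grassmann subalgebra is conjugate to a coordinate ideal. -/
theorem exists_conj_stab_ideal {J : Ideal (Lam m n)} {A : Finset (Fin n)} (hJ : J ≤ maxIdeal m n)
    (hJr : ∀ q, ∀ f ∈ parityPart m n q, ∃ r ∈ grAdj A, (C r : Lam m n) ∈ parityPart m n q ∧
      f - C r ∈ J)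
    (hJA : ∀ r ∈ grAdj A, (C r : Lam m n) ∈ J → r = 0) :
    ∃ g ∈ innerGroup m n, stab (J.restrictScalars ℂ) =
      conj g (stab ((coordIdeal m A).restrictScalars ℂ)) := by
  classical
  choose p hpA hpp hpJ using fun s => hJr _ _ (gen_mem_parityPart (m := m) (n := n) s)
  -- With `p s` the residue of the generator modulo `J`, the field `E` kills the Grassmann algebra
  -- on `A`. So its exponential series on a generator stops after the linear term and gives `gen m n
  -- s - C (p s)`, an element of `J`.
  set r : Fin m ⊕ Fin n → Gr n := fun s => if s ∈ coordSet m A then -p s else 0 with hr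
  have hrA : ∀ s, r s ∈ grAdj A := fun s => by
    simp only [hr]
    split_ifs
    · exact Submodule.neg_mem _ (hpA s)
    · exact Submodule.zero_mem _
  have hr₀ : ∀ s, grAug n (r s) = 0 := fun s => by
    have h := mem_maxIdeal_iff.mp (hJ (hpJ s))
    rw [map_sub, aug_gen, aug_C, zero_sub, neg_eq_zero] at h
    simp only [hr]
    split_ifs
    · rw [map_neg, h, neg_zero]
    · rw [map_zero]
  have hrz : ∀ a ∈ A, r (Sum.inr a) = 0 := fun a ha =>
    if_neg fun h => inr_mem_coordSet.mp h ha
  set E := vectorField fun s => (C (r s) : Lam m n) with hEdef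
  have hE : E ∈ W m n 0 := vectorField_mem fun s => by
    rw [zero_add]
    simp only [hr]
    split_ifs
    · rw [map_neg]
      exact Submodule.neg_mem _ (hpp s)
    · rw [map_zero]
      exact Submodule.zero_mem _
  have hnil : IsNilpotent E := isNilpotent_vectorField hrA hr₀ hrz
  have hEC : ∀ a ∈ grAdj A, E (C a) = 0 := fun a ha =>
    (leibniz_of_mem hE).map_C_eq_zero (fun b hb => by
      have := vectorField_gen (fun s => (C (r s) : Lam m n)) (Sum.inr b)
      rw [gen_inr, hrz b hb, map_zero] at this
      exact this) ha
  have hmul := exp_mul_apply (leibniz_of_mem hE) hnil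
  have hgen : ∀ s ∈ coordSet m A, IsNilpotent.exp E (gen m n s) ∈ J := fun s hs => by
    rw [exp_apply_of_sq hnil]
    · rw [hEdef, vectorField_gen]
      simp only [hr, if_pos hs, map_neg, ← sub_eq_add_neg]
      exact hpJ s
    · rw [hEdef, vectorField_gen]
      exact hEC _ (hrA s)
  refine ⟨expAd hE hnil, expAd_mem_innerGroup hE hnil, ?_⟩
  rw [conj_expAd_stab]
  congr 1
  refine le_antisymm (fun f hf => ⟨IsNilpotent.exp (-E) f, ?_, exp_exp_neg hnil f⟩) ?_
  · rintro _ ⟨f, hf, rfl⟩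
    exact map_coordIdeal_le hmul hgen hf
  -- The residue of `h` modulo the coordinate ideal is fixed by exp E, hence lies in `J`, and `J`
  -- meets the Grassmann algebra on `A` only in zero.
  · set h := IsNilpotent.exp (-E) f with hh
    have hmem := sub_C_mem_coordIdeal A h
    have h₁ := map_coordIdeal_le hmul hgen hmem
    rw [map_sub, exp_apply_of_eq_zero hnil (hEC _ (grProj_mem A _)), exp_exp_neg hnil] at h₁
    exact hJA _ (grProj_mem A _) (by simpa using J.sub_mem hf h₁)

/-- Every maximal open subalgebra is conjugate to a standard one. -/
theorem exists_conj_stdSubalg (hm : 1 ≤ m) {L : GradedSubspace m n}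
    (hL : IsMaximalOpenSubalg L) :
    ∃ k ≤ n, ∃ g ∈ innerGroup m n, L = conj g (stdSubalg m n k) := by
  obtain ⟨J, A, hJm, hJL, hJr, hJA⟩ := exists_invariant_ideal hL.1
    (fun a q f hf X hX => hL.mulLeft_mul_mem hm hf hX)
    (fun p X hX => aug_eq_zero_of_ne_top hL.1 hL.2.1 hL.2.2.1 hX)
  have hLJ : L = stab (J.restrictScalars ℂ) := by
    refine hL.eq_of_le (isSubalg_stab _) (le_iff_endPart.mpr fun p X hX =>
      mem_endPart_stab.mpr ⟨endPart_le _ _ hX, hJL p X hX⟩) fun htop => ?_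
    set i : Fin m := ⟨0, hm⟩
    -- The stabilizer is proper: ∂/∂x_i sends `gen m n (Sum.inl i) - C r`, which lies in `J`, to 1.
    obtain ⟨r, _, _, hr⟩ := hJr _ _ (gen_mem_parityPart (m := m) (n := n) (Sum.inl i))
    have hd : der m n (Sum.inl i) ∈ endPart (stab (J.restrictScalars ℂ)) 0 := by
      rw [htop, endPart_top]
      exact der_mem (Sum.inl i)
    have h := mem_maxIdeal_iff.mp (hJm ((mem_endPart_stab.mp hd).2 _ hr))
    rw [map_sub, der_gen, if_pos rfl, der_inl, derEven_C, sub_zero, map_one] at h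
    exact one_ne_zero h
  obtain ⟨g, hg, e⟩ := exists_conj_stab_ideal hJm hJr hJA
  have hcard : A.card ≤ n := by simpa using A.card_le_univ
  obtain ⟨g', hg', e'⟩ := exists_conj_coordIdeal m A (zeroSet n A.card) (card_zeroSet hcard).symm
  refine ⟨A.card, hcard, g * g', Subgroup.mul_mem _ hg hg', ?_⟩
  rw [hLJ, e, e', conj_mul, stdSubalg_eq_stab]

end Straighten

/-! ### Inner automorphisms preserve the isotropy subalgebra of the origin -/

section Isotropy

variable {m n : ℕ}

theorem nhd_mono {N M : ℕ} (h : N ≤ M) (p : ZMod 2) : nhd m n M p ⊆ nhd m n N p :=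
  fun _ hX s => maxIdeal_pow_le h (hX s)

/-- The commutator of an even vector field with a homogeneous one. -/
def comm {p : ZMod 2} (U : W m n 0) (X : W m n p) : W m n p :=
  ⟨U.1 * X.1 - X.1 * U.1, adEnd_mem U.2 p X.1 X.2⟩

theorem comm_apply {p : ZMod 2} (U : W m n 0) (X : W m n p) (f : Lam m n) :
    (comm U X).1 f = U.1 (X.1 f) - X.1 (U.1 f) := rfl

theorem comm_lower {p : ZMod 2} (U : W m n 0) {X : W m n p} {N : ℕ} (hX : X ∈ nhd m n (N + 1) p) :
    comm U X ∈ nhd m n N p := fun s =>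
  Ideal.sub_mem _ ((leibniz_of_mem U.2).lower (hX s))
    (maxIdeal_pow_le N.le_succ ((leibniz_of_mem X.2).mem_maxIdeal_pow hX _))

/-- The bracket of an even field with one of parity `p` has type `W m n (0 + p)`; comparing
underlying operators avoids transport along `0 + p = p`. -/
theorem coe_map_cast {D : (p : ZMod 2) → Module.End ℂ (W m n p)} {p q : ZMod 2} (h : p = q)
    {X : W m n p} {Y : W m n q} (hXY : X.1 = Y.1) : (D p X).1 = (D q Y).1 := by
  subst h
  obtain rfl : X = Y := Subtype.ext hXY
  rfl

theorem coe_bracket_even {p : ZMod 2} (U : W m n 0) (X : W m n p) :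
    (bracket U X).1 = (comm U X).1 := sbracket_even_left p U.1 X.1

theorem IsEvenDer.map_comm {D : (p : ZMod 2) → Module.End ℂ (W m n p)} (hD : IsEvenDer D)
    {p : ZMod 2} (U : W m n 0) (X : W m n p) :
    (D p (comm U X)).1 = (comm (D 0 U) X).1 + (comm U (D p X)).1 := by
  rw [← coe_map_cast (zero_add p) (coe_bracket_even U X), hD.1]
  change (bracket (D 0 U) X).1 + (bracket U (D p X)).1 = _
  rw [coe_bracket_even, coe_bracket_even]

/-! ### Derivations of W(m,n) to leading order. -/

/-- The Euler vector field. -/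
def euler (m n : ℕ) : W m n 0 :=
  ⟨vectorField (gen m n), vectorField_mem fun s => by
    rw [zero_add]
    exact gen_mem_parityPart s⟩

theorem euler_gen (s : Fin m ⊕ Fin n) : (euler m n).1 (gen m n s) = gen m n s :=
  vectorField_gen _ s

theorem euler_sub_mem {r : ℕ} {f : Lam m n} (hf : f ∈ maxIdeal m n ^ r) :
    (euler m n).1 f - (r : ℂ) • f ∈ maxIdeal m n ^ (r + 1) := by
  have he := leibniz_of_mem (euler m n).2
  induction r generalizing f with
  | zero =>
    rw [Nat.cast_zero, zero_smul, sub_zero, zero_add]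
    refine he.mem_maxIdeal_pow (fun s => ?_) f
    rw [euler_gen, maxIdeal_pow_one]
    exact gen_mem_maxIdeal s
  | succ r ih =>
    refine maxIdeal_pow_succ_homogeneous_induction
      (P := fun f => (euler m n).1 f - ((r + 1 : ℕ) : ℂ) • f ∈ maxIdeal m n ^ (r + 1 + 1))
      hf ?_ (fun q a _ ha s => ?_) fun f g hf hg => ?_
    · rw [map_zero, smul_zero, sub_zero]
      exact Ideal.zero_mem _
    · have h := maxIdeal_pow_mul_gen (ih ha) s
      rw [he.even_mul, euler_gen, Nat.cast_succ, add_smul, one_smul, ← smul_mul_assoc]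
      rw [sub_mul] at h
      convert h using 1
      abel
    · rw [map_add, smul_add, add_sub_add_comm]
      exact Ideal.add_mem _ hf hg

/-- A field with coefficients of order `r` has degree `r - 1`, since each ∂/∂x_i and ∂/∂ξ_j has
degree -1. -/
theorem comm_euler_sub_mem {p : ZMod 2} {X : W m n p} {r : ℕ} (hX : X ∈ nhd m n r p)
    (s : Fin m ⊕ Fin n) :
    (comm (euler m n) X).1 (gen m n s) - ((r : ℂ) - 1) • X.1 (gen m n s) ∈
      maxIdeal m n ^ (r + 1) := by
  have h := euler_sub_mem (hX s)
  rw [comm_apply, euler_gen, sub_smul, one_smul]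
  convert h using 1
  abel

/-- To leading order, a derivation of `W(m,n)` acts as the commutator with the image of the Euler
field. -/
theorem IsEvenDer.sub_comm_mem {D : (p : ZMod 2) → Module.End ℂ (W m n p)} (hD : IsEvenDer D)
    {p : ZMod 2} {N : ℕ} {X : W m n p} (hX : X ∈ nhd m n N p) (s : Fin m ⊕ Fin n) :
    (D p X).1 (gen m n s) - (comm (D 0 (euler m n)) X).1 (gen m n s) ∈ maxIdeal m n ^ N := by
  set U := D 0 (euler m n) with hU
  suffices key : ∀ j, N ≤ j → ∀ X ∈ nhd m n j p, ∀ s,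
      (D p X).1 (gen m n s) - (comm U X).1 (gen m n s) ∈ maxIdeal m n ^ N from
    key N le_rfl X hX s
  clear hX s X
  induction N with
  | zero => exact fun _ _ _ _ _ => mem_maxIdeal_pow_zero _
  | succ N ih =>
    obtain ⟨M, hM⟩ := hD.2 (N + 1)
    -- Descending induction on the order `j`: for large `j` continuity of `D` suffices, and `t`
    -- bounds the distance still to go.
    have key : ∀ t j, N + 1 ≤ j → max M (N + 2) ≤ j + t → ∀ X ∈ nhd m n j p, ∀ s,
        (D p X).1 (gen m n s) - (comm U X).1 (gen m n s) ∈ maxIdeal m n ^ (N + 1) := by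
      intro t
      induction t with
      | zero =>
        intro j _ hj X hX s
        rw [add_zero, max_le_iff] at hj
        exact Ideal.sub_mem _ (hM p X (nhd_mono hj.1 p hX) s)
          (comm_lower U (nhd_mono hj.2 p hX) s)
      | succ t iht =>
        intro j hNj hj X hX s
        obtain ⟨i, rfl⟩ : ∃ i, j = i + 1 := ⟨j - 1, by omega⟩
        have hDX : D p X ∈ nhd m n N p := fun s => by
          have h₁ := ih (i + 1) (by omega) X hX s
          have h₂ := comm_lower U (nhd_mono hNj p hX) s
          have := Ideal.add_mem _ h₁ h₂
          rwa [sub_add_cancel] at this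
        let X' : W m n p := ⟨(comm (euler m n) X).1 - (i : ℂ) • X.1,
          Submodule.sub_mem _ (comm (euler m n) X).2 (Submodule.smul_mem _ _ X.2)⟩
        have hX' : X' ∈ nhd m n (i + 2) p := fun s => by
          have := comm_euler_sub_mem hX s
          rwa [Nat.cast_succ, add_sub_cancel_right] at this
        have hDX' : ∀ s, (D p X').1 (gen m n s) ∈ maxIdeal m n ^ (N + 1) := fun s => by
          have h₁ := iht (i + 2) (by omega) (by omega) X' hX' s
          have h₂ := comm_lower U (nhd_mono (show N + 2 ≤ i + 2 by omega) p hX') s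
          have := Ideal.add_mem _ h₁ h₂
          rwa [sub_add_cancel] at this
        have e : comm (euler m n) X = (i : ℂ) • X + X' := Subtype.ext <| by
          change _ = (i : ℂ) • X.1 + ((comm (euler m n) X).1 - (i : ℂ) • X.1)
          rw [add_sub_cancel]
        have h₁ : ∀ s, (i : ℂ) • (D p X).1 (gen m n s) + (D p X').1 (gen m n s) =
            (comm U X).1 (gen m n s) + (comm (euler m n) (D p X)).1 (gen m n s) := fun s => by
          have := hD.map_comm (euler m n) X
          rw [e, map_add, map_smul] at this
          exact LinearMap.congr_fun this (gen m n s)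
        -- Write e for the Euler field and apply `D` to [e, X] = iX + X'. Modulo order `N + 1`,
        -- D(X') is negligible and [e, D X] is (N - 1) D X, which gives (i + 1 - N) D X ≡ [U, X].
        -- For i = N this is the claim; for i > N the bracket is itself negligible and the factor is
        -- nonzero.
        have h₂ : ∀ s, ((i : ℂ) + 1 - N) • (D p X).1 (gen m n s) - (comm U X).1 (gen m n s) ∈
            maxIdeal m n ^ (N + 1) := fun s => by
          have h₃ := Ideal.sub_mem _ (comm_euler_sub_mem hDX s) (hDX' s)
          convert h₃ using 1
          have := h₁ s
          rw [← sub_eq_iff_eq_add'.mpr this.symm]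
          module
        rcases eq_or_lt_of_le hNj with h | h
        · have hi : i = N := by omega
          have := h₂ s
          rwa [hi, add_sub_cancel_left, one_smul] at this
        · have hU' : ∀ s, (comm U X).1 (gen m n s) ∈ maxIdeal m n ^ (N + 1) :=
            comm_lower U (nhd_mono (show N + 2 ≤ i + 1 by omega) p hX)
          refine Ideal.sub_mem _ ?_ (hU' s)
          have h₃ := Ideal.add_mem _ (h₂ s) (hU' s)
          rw [sub_add_cancel] at h₃
          have hne : (i : ℂ) + 1 - N ≠ 0 := by
            rw [sub_ne_zero]
            exact_mod_cast (show i + 1 ≠ N by omega)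
          have := smul_mem_ideal _ ((i : ℂ) + 1 - N)⁻¹ h₃
          rwa [inv_smul_smul₀ hne] at this
    exact fun j hj => key (max M (N + 2)) j hj (by omega)

theorem IsEvenDer.lower {D : (p : ZMod 2) → Module.End ℂ (W m n p)} (hD : IsEvenDer D)
    {p : ZMod 2} {N : ℕ} {X : W m n p} (hX : X ∈ nhd m n (N + 1) p) : D p X ∈ nhd m n N p :=
  fun s => by
    have := Ideal.add_mem _ (maxIdeal_pow_le N.le_succ (hD.sub_comm_mem hX s))
      (comm_lower (D 0 (euler m n)) hX s)
    rwa [sub_add_cancel] at this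

theorem IsEvenDer.pow_lower {D : (p : ZMod 2) → Module.End ℂ (W m n p)} (hD : IsEvenDer D)
    {p : ZMod 2} {N : ℕ} (j : ℕ) {X : W m n p} (hX : X ∈ nhd m n (N + j) p) :
    (D p ^ j) X ∈ nhd m n N p := by
  induction j generalizing X with
  | zero => exact hX
  | succ j ih =>
    rw [pow_succ, Module.End.mul_apply]
    exact ih (hD.lower hX)

/-- The constant terms of the coefficients of a vector field. -/
def augMap (m n : ℕ) (p : ZMod 2) : W m n p →ₗ[ℂ] (Fin m ⊕ Fin n → ℂ) where
  toFun X s := aug m n (X.1 (gen m n s))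
  map_add' X Y := funext fun s => map_add (aug m n) (X.1 (gen m n s)) (Y.1 (gen m n s))
  map_smul' c X := funext fun s => map_smul (aug m n) c (X.1 (gen m n s))

theorem mem_nhd_one_iff {p : ZMod 2} {X : W m n p} : X ∈ nhd m n 1 p ↔ augMap m n p X = 0 := by
  rw [funext_iff]
  refine forall_congr' fun s => ?_
  rw [maxIdeal_pow_one, mem_maxIdeal_iff]
  rfl

/-- The evaluation of a coefficient of a vector field at the origin. -/
def augFun {m n : ℕ} (p : ZMod 2) (s : Fin m ⊕ Fin n) : W m n p →ₗ[ℂ] ℂ :=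
  LinearMap.proj s ∘ₗ augMap m n p

theorem augFun_eq_zero {p : ZMod 2} (s : Fin m ⊕ Fin n) {X : W m n p} (hX : X ∈ nhd m n 1 p) :
    augFun p s X = 0 := congrFun (mem_nhd_one_iff.mp hX) s

theorem isContFunctional_augFun (p : ZMod 2) (s : Fin m ⊕ Fin n) :
    IsContFunctional (augFun p s) := ⟨1, fun _ hX => augFun_eq_zero s hX⟩

/-! ### Divergence of exponentials that move the origin. -/

/-- The power series `∑ a_r x_i^r`. -/
def ser (n : ℕ) (i : Fin m) (a : ℕ → ℂ) : Lam m n := fun d =>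
  if d = Finsupp.single i (d i) then algebraMap ℂ (Gr n) (a (d i)) else 0

theorem coeff_ser (i : Fin m) (a : ℕ → ℂ) (d : Fin m →₀ ℕ) :
    coeff d (ser n i a) =
      if d = Finsupp.single i (d i) then algebraMap ℂ (Gr n) (a (d i)) else 0 := rfl

theorem ser_mem_parityPart (i : Fin m) (a : ℕ → ℂ) : ser n i a ∈ parityPart m n 0 := fun d => by
  rw [coeff_ser]
  split_ifs
  · rw [Algebra.algebraMap_eq_smul_one]
    exact Submodule.smul_mem _ _ (one_mem_grPart n)
  · exact Submodule.zero_mem _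

theorem ser_eq (i : Fin m) (a : ℕ → ℂ) :
    ser n i a = a 0 • 1 + X i * ser n i fun r => a (r + 1) := by
  classical
  refine MvPowerSeries.ext fun d => ?_
  have h : coeff d (a 0 • (1 : Lam m n)) = a 0 • coeff d (1 : Lam m n) := rfl
  rw [map_add, h, coeff_one, X_def, coeff_monomial_mul, coeff_ser]
  by_cases hd : Finsupp.single i 1 ≤ d
  · obtain ⟨c, rfl⟩ := exists_add_of_le hd
    have h₀ : Finsupp.single i 1 + c ≠ 0 := fun h => by
      have := DFunLike.congr_fun h i
      simp at this
    rw [if_pos hd, if_neg h₀, smul_zero, zero_add, one_mul, add_tsub_cancel_left, coeff_ser,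
      Finsupp.add_apply, Finsupp.single_eq_same, Finsupp.single_add, add_comm 1 (c i)]
    exact if_congr (add_right_inj _) rfl rfl
  · rw [if_neg hd, add_zero]
    rw [Finsupp.single_le_iff] at hd
    have hi : d i = 0 := by omega
    rw [hi, Finsupp.single_zero, Algebra.algebraMap_eq_smul_one]
    split_ifs <;> simp

theorem ser_sub_mem (i : Fin m) (j : ℕ) (a : ℕ → ℂ) :
    ser n i a - ∑ r ∈ Finset.range j, a r • (X i : Lam m n) ^ r ∈ maxIdeal m n ^ j := by
  induction j generalizing a with
  | zero => exact mem_maxIdeal_pow_zero _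
  | succ j ih =>
    have h₁ : (X i : Lam m n) ∈ maxIdeal m n ^ 1 := by
      rw [maxIdeal_pow_one]
      exact gen_mem_maxIdeal (Sum.inl i)
    have h := maxIdeal_pow_mul h₁ (ih fun r => a (r + 1))
    rw [add_comm 1 j] at h
    convert h using 1
    rw [ser_eq, Finset.sum_range_succ', mul_sub, Finset.mul_sum, pow_zero]
    simp only [mul_smul_comm, ← pow_succ']
    abel

/-- A triangular system of linear equations has a solution. -/
def triangularSolution (b : ℕ → ℕ → ℂ) (t : ℕ → ℂ) (j : ℕ) : ℂ :=
  (t j - ∑ r : Fin j, triangularSolution b t r * b j r) / b j j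
termination_by j
decreasing_by exact r.2

theorem sum_triangularSolution {b : ℕ → ℕ → ℂ} (hb : ∀ j, b j j ≠ 0) (t : ℕ → ℂ) (j : ℕ) :
    ∑ r ∈ Finset.range (j + 1), triangularSolution b t r * b j r = t j := by
  rw [Finset.sum_range_succ, triangularSolution.eq_1 b t j, div_mul_cancel₀ _ (hb j),
    Finset.sum_range fun r => triangularSolution b t r * b j r, add_sub_cancel]

/-- The vector field `f ∂/∂x_i`. -/
def evenField (i : Fin m) {f : Lam m n} (hf : f ∈ parityPart m n 0) : W m n 0 :=
  ⟨LinearMap.mulLeft ℂ f * der m n (Sum.inl i), by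
    have := mulLeft_mul_mem hf (der_mem (n := n) (Sum.inl i))
    rwa [par_inl, add_zero] at this⟩

/-- The vector field `x_i^r ∂/∂x_i`. -/
def powField (n : ℕ) (i : Fin m) (r : ℕ) : W m n 0 :=
  evenField i (pow_mem_parityPart (gen_mem_parityPart (n := n) (Sum.inl i)) r)

theorem powField_apply (i : Fin m) (r : ℕ) (g : Lam m n) :
    (powField n i r).1 g = X i ^ r * derEven m n i g := rfl

theorem X_pow_mem (i : Fin m) (r : ℕ) : (X i : Lam m n) ^ r ∈ maxIdeal m n ^ r :=
  pow_mem_maxIdeal_pow (gen_mem_maxIdeal (Sum.inl i)) r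

theorem powField_mem_nhd (i : Fin m) (r : ℕ) : powField n i r ∈ nhd m n r 0 := fun _ =>
  maxIdeal_pow_mul_right (X_pow_mem i r) _

theorem derEven_gen (i : Fin m) (s : Fin m ⊕ Fin n) :
    derEven m n i (gen m n s) = if s = Sum.inl i then 1 else 0 := der_gen (Sum.inl i) s

theorem augFun_powField_zero (i : Fin m) : augFun 0 (Sum.inl i) (powField n i 0) = 1 := by
  change aug m n ((powField n i 0).1 _) = 1
  rw [powField_apply, derEven_gen, if_pos rfl, pow_zero, mul_one, map_one]

/-- The leading term of the commutator with `x_i^(r+1) ∂/∂x_i`. -/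
theorem comm_powField_sub_mem (U : W m n 0) (i : Fin m) (r : ℕ) (s : Fin m ⊕ Fin n) :
    (comm U (powField n i (r + 1))).1 (gen m n s) -
      (((r + 1 : ℕ) : ℂ) * augFun 0 (Sum.inl i) U) • (powField n i r).1 (gen m n s) ∈
      maxIdeal m n ^ (r + 1) := by
  have hU := leibniz_of_mem U.2
  have hpow : U.1 (X i ^ (r + 1)) - (((r + 1 : ℕ) : ℂ) * augFun 0 (Sum.inl i) U) • X i ^ r ∈
      maxIdeal m n ^ (r + 1) := by
    induction r with
    | zero =>
      rw [zero_add, pow_one, pow_zero, Nat.cast_one, one_mul, maxIdeal_pow_one, mem_maxIdeal_iff,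
        map_sub, map_smul, map_one, smul_eq_mul, mul_one, sub_eq_zero]
      rfl
    | succ r ih =>
      have h₁ := maxIdeal_pow_mul_gen ih (Sum.inl i)
      have h₂ : U.1 (X i) - augFun 0 (Sum.inl i) U • 1 ∈ maxIdeal m n ^ 1 := by
        rw [maxIdeal_pow_one, mem_maxIdeal_iff, map_sub, map_smul, map_one, smul_eq_mul, mul_one,
          sub_eq_zero]
        rfl
      have h₃ := Ideal.add_mem _ h₁ (maxIdeal_pow_mul (X_pow_mem i (r + 1)) h₂)
      rw [pow_succ _ (r + 1), hU.even_mul]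
      convert h₃ using 1
      rw [gen_inl, sub_mul, mul_sub, smul_mul_assoc, ← pow_succ, mul_smul_comm, mul_one]
      push_cast
      module
  rw [comm_apply, powField_apply, powField_apply, powField_apply, derEven_gen]
  rw [sub_right_comm]
  refine Ideal.sub_mem _ ?_ (maxIdeal_pow_mul_right (X_pow_mem i (r + 1)) _)
  split_ifs
  · rwa [mul_one, mul_one]
  · rw [mul_zero, mul_zero, map_zero, smul_zero, sub_zero]
    exact Ideal.zero_mem _

/-- An exponentiable derivation maps the Euler field to a vector field that vanishes at the
origin. -/
theorem IsExp.map_euler_mem {D : (p : ZMod 2) → Module.End ℂ (W m n p)} (hD : IsEvenDer D)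
    {g : (p : ZMod 2) → (W m n p ≃ₗ[ℂ] W m n p)} (hg : IsExp D g) :
    D 0 (euler m n) ∈ nhd m n 1 0 := by
  set U := D 0 (euler m n) with hU
  refine mem_nhd_one_iff.mpr (funext fun s => ?_)
  rcases s with i | j
  swap
  · exact aug_even_inr U.2 j
  change augFun 0 (Sum.inl i) U = 0
  set l := augFun (m := m) (n := n) 0 (Sum.inl i) with hl
  by_contra hc
  -- `D` sends x_i^(j+1) ∂/∂x_i to (j + 1) l(U) x_i^j ∂/∂x_i up to a field of order `j + 1`; the
  -- remaining `j` applications of `D` leave that error of order 1, where `l` vanishes.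
  have hstep : ∀ r (j : ℕ), j = r → l ((D 0 ^ (j + 1)) (powField n i (r + 1))) =
      (((r + 1 : ℕ) : ℂ) * l U) * l ((D 0 ^ j) (powField n i r)) := by
    rintro r j rfl
    set c := ((j + 1 : ℕ) : ℂ) * l U
    let Y : W m n 0 := D 0 (powField n i (j + 1)) + (-c) • powField n i j
    have hY : Y ∈ nhd m n (1 + j) 0 := fun s => by
      have h := Ideal.add_mem _ (hD.sub_comm_mem (powField_mem_nhd (n := n) i (j + 1)) s)
        (comm_powField_sub_mem U i j s)
      rw [sub_add_sub_cancel] at h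
      rw [add_comm 1 j]
      convert h using 1
      change (D 0 (powField n i (j + 1))).1 _ + (-c) • (powField n i j).1 _ = _
      rw [neg_smul, ← sub_eq_add_neg]
    have h := augFun_eq_zero (Sum.inl i) (hD.pow_lower j hY)
    rw [map_add, map_smul, map_add, map_smul, ← Module.End.mul_apply, ← pow_succ, smul_eq_mul,
      neg_mul, ← sub_eq_add_neg, sub_eq_zero] at h
    exact h
  have hdiag : ∀ j, l ((D 0 ^ j) (powField n i j)) = j.factorial * l U ^ j := by
    intro j
    induction j with
    | zero =>
      rw [pow_zero, Module.End.one_apply, hl, augFun_powField_zero]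
      simp
    | succ j ih =>
      rw [hstep j j rfl, ih, Nat.factorial_succ]
      push_cast
      ring
  set b : ℕ → ℕ → ℂ := fun j r => l ((D 0 ^ j) (powField n i r)) with hb
  have hb₀ : ∀ j, b j j ≠ 0 := fun j => by
    rw [hb]
    simp only [hdiag]
    exact mul_ne_zero (Nat.cast_ne_zero.mpr j.factorial_ne_zero) (pow_ne_zero j hc)
  -- D^j followed by `l` sees only the terms with r ≤ j, and the diagonal j! l(U)^j is nonzero. So
  -- the coefficients of `Z` can be chosen to make l(D^j Z) = j!; every term of the exponential
  -- series is then 1, and the series diverges.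
  set a := triangularSolution b fun j => (j.factorial : ℂ) with ha
  set Z := evenField i (ser_mem_parityPart (n := n) i a) with hZ
  have hterm : ∀ j, l ((D 0 ^ j) Z) = j.factorial := by
    intro j
    let S : W m n 0 := ∑ r ∈ Finset.range (j + 1), a r • powField n i r
    let Y : W m n 0 := Z + (-1 : ℂ) • S
    have hS : ∀ f, S.1 f = (∑ r ∈ Finset.range (j + 1), a r • (X i : Lam m n) ^ r) *
        derEven m n i f := fun f => by
      have : S.1 = ∑ r ∈ Finset.range (j + 1), a r • (powField n i r).1 :=
        AddSubmonoidClass.coe_finsetSum _ _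
      rw [this, LinearMap.sum_apply, Finset.sum_mul]
      refine Finset.sum_congr rfl fun r _ => ?_
      rw [LinearMap.smul_apply, powField_apply, smul_mul_assoc]
    have hY : Y ∈ nhd m n (1 + j) 0 := fun s => by
      have h := maxIdeal_pow_mul_right (ser_sub_mem (n := n) i (j + 1) a)
        (derEven m n i (gen m n s))
      rw [add_comm 1 j]
      convert h using 1
      change Z.1 _ + (-1 : ℂ) • S.1 _ = _
      rw [hS, sub_mul, neg_one_smul, ← sub_eq_add_neg]
      rfl
    have h := augFun_eq_zero (Sum.inl i) (hD.pow_lower j hY)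
    rw [map_add, map_smul, map_add, map_smul, neg_one_smul, ← sub_eq_add_neg, sub_eq_zero] at h
    rw [hl, h, map_sum, map_sum]
    have := sum_triangularSolution hb₀ (fun j => (j.factorial : ℂ)) j
    rw [← ha] at this
    rw [← this]
    refine Finset.sum_congr rfl fun r _ => ?_
    rw [map_smul, map_smul, smul_eq_mul]
  have hsum := (hg 0 Z l (isContFunctional_augFun 0 _)).summable
  have hone : (fun j : ℕ => l ((j.factorial : ℂ)⁻¹ • (D 0 ^ j) Z)) = fun _ => (1 : ℂ) :=
    funext fun j => by
      rw [map_smul, hterm, smul_eq_mul, inv_mul_cancel₀ (Nat.cast_ne_zero.mpr j.factorial_ne_zero)]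
  rw [hone, summable_const_iff] at hsum
  exact one_ne_zero hsum

/-- The image of the Euler field vanishes at the origin, so its commutator preserves the fields
vanishing there, and by the leading-order formula so does `D`. Every term of the exponential series
then has value zero at the origin. -/
theorem IsExp.map_mem_nhd_one {D : (p : ZMod 2) → Module.End ℂ (W m n p)} (hD : IsEvenDer D)
    {g : (p : ZMod 2) → (W m n p ≃ₗ[ℂ] W m n p)} (hg : IsExp D g) {p : ZMod 2} {X : W m n p}
    (hX : X ∈ nhd m n 1 p) : g p X ∈ nhd m n 1 p := by
  have hU := hg.map_euler_mem hD
  have hDX : ∀ X ∈ nhd m n 1 p, D p X ∈ nhd m n 1 p := fun X hX s => by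
    have h : (comm (D 0 (euler m n)) X).1 (gen m n s) ∈ maxIdeal m n ^ 1 :=
      Ideal.sub_mem _ ((leibniz_of_mem (D 0 (euler m n)).2).mem_maxIdeal_pow hU _)
        ((leibniz_of_mem X.2).mem_maxIdeal_pow hX _)
    have := Ideal.add_mem _ (hD.sub_comm_mem hX s) h
    rwa [sub_add_cancel] at this
  have hpow : ∀ j : ℕ, (D p ^ j) X ∈ nhd m n 1 p := fun j => by
    induction j with
    | zero => exact hX
    | succ j ih =>
      rw [pow_succ', Module.End.mul_apply]
      exact hDX _ ih
  refine mem_nhd_one_iff.mpr (funext fun s => ?_)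
  have h := hg p X (augFun p s) (isContFunctional_augFun p s)
  have h₀ : (fun j : ℕ => augFun p s ((j.factorial : ℂ)⁻¹ • (D p ^ j) X)) = fun _ => 0 :=
    funext fun j => by rw [map_smul, augFun_eq_zero s (hpow j), smul_zero]
  rw [h₀] at h
  exact h.unique hasSum_zero

/-- A linear automorphism that maps the kernel of a map of finite rank into itself maps it onto
itself. -/
theorem map_eq_zero_of_finite {V F : Type*} [AddCommMonoid V] [Module ℂ V] [AddCommGroup F]
    [Module ℂ F] [FiniteDimensional ℂ F] (T : V →ₗ[ℂ] F) (g : V ≃ₗ[ℂ] V)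
    (h : ∀ x, T x = 0 → T (g x) = 0) {x : V} (hx : T (g x) = 0) : T x = 0 := by
  let : AddCommGroup V := Module.addCommMonoidToAddCommGroup ℂ
  have hle : LinearMap.ker T ≤ (LinearMap.ker T).comap g.toLinearMap := h
  set q := (LinearMap.ker T).mapQ (LinearMap.ker T) g.toLinearMap hle with hq
  have : FiniteDimensional ℂ (V ⧸ LinearMap.ker T) :=
    Module.Finite.equiv T.quotKerEquivRange.symm
  have hsurj : Function.Surjective q := fun y => by
    obtain ⟨y, rfl⟩ := Submodule.mkQ_surjective _ y
    exact ⟨Submodule.Quotient.mk (g.symm y), by simp [hq]⟩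
  have hinj := LinearMap.injective_iff_surjective.mpr hsurj
  have h₀ : q (Submodule.Quotient.mk x) = 0 := by
    rw [hq, Submodule.mapQ_apply, Submodule.Quotient.mk_eq_zero]
    exact hx
  have := hinj (h₀.trans (map_zero q).symm)
  rwa [Submodule.Quotient.mk_eq_zero] at this

/-- A generator maps the isotropy subalgebra into itself; finite codimension upgrades this to an
equivalence without knowing that the inverse is an exponential. -/
theorem mem_nhd_one_iff_of_mem_innerGroup {g : (p : ZMod 2) → (W m n p ≃ₗ[ℂ] W m n p)}
    (hg : g ∈ innerGroup m n) : ∀ {p : ZMod 2} {X : W m n p},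
      g p X ∈ nhd m n 1 p ↔ X ∈ nhd m n 1 p := by
  induction hg using Subgroup.closure_induction with
  | mem g h =>
    obtain ⟨D, hD, hg⟩ := h
    refine fun {p X} => ⟨fun hX => ?_, hg.map_mem_nhd_one hD⟩
    rw [mem_nhd_one_iff] at hX ⊢
    exact map_eq_zero_of_finite (augMap m n p) (g p) (fun x hx =>
      mem_nhd_one_iff.mp (hg.map_mem_nhd_one hD (mem_nhd_one_iff.mpr hx))) hX
  | one => exact Iff.rfl
  | mul g h _ _ ihg ihh => exact ihg.trans ihh
  | inv g _ ih =>
    intro p X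
    rw [← ih]
    change g p ((g p).symm X) ∈ _ ↔ _
    rw [LinearEquiv.apply_symm_apply]

/-! ### The number of zeros is an invariant -/

/-- The constant terms of the coefficients at `∂/∂ξ_j`, `j ∈ A`. -/
def oddAugMap (m : ℕ) (A : Finset (Fin n)) : W m n 1 →ₗ[ℂ] (A → ℂ) :=
  LinearMap.pi fun j => augFun 1 (Sum.inr j.1)

/-- In the stabilizer the values on the generators of the coordinate ideal vanish at the origin, so
only the ξ_j with j ∈ A are left to test. -/
theorem oddAugMap_eq_zero_iff {A : Finset (Fin n)} {X : W m n 1}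
    (hX : X ∈ stab ((coordIdeal m A).restrictScalars ℂ) 1) :
    oddAugMap m A X = 0 ↔ X ∈ nhd m n 1 1 := by
  constructor
  · intro h
    refine mem_nhd_one_iff.mpr (funext fun s => ?_)
    by_cases hs : s ∈ coordSet m A
    · exact mem_maxIdeal_iff.mp (coordIdeal_le A
        ((mem_stab_coordIdeal.mp (coe_mem_endPart.mpr hX)).2 s hs))
    · rcases s with i | j
      · exact absurd (inl_mem_coordSet A i) hs
      · rw [inr_mem_coordSet, not_not] at hs
        exact congrFun h ⟨j, hs⟩
  · exact fun h => funext fun j => augFun_eq_zero _ h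

theorem exists_oddAugMap_eq (m : ℕ) (A : Finset (Fin n)) (v : A → ℂ) :
    ∃ X ∈ stab ((coordIdeal m A).restrictScalars ℂ) 1, oddAugMap m A X = v := by
  classical
  let P : Fin m ⊕ Fin n → Lam m n :=
    Sum.elim (fun _ => 0) fun j => if h : j ∈ A then v ⟨j, h⟩ • 1 else 0
  have hP : vectorField P ∈ W m n 1 := vectorField_mem fun s => by
    rcases s with i | j
    · exact Submodule.zero_mem _
    · rw [par_inr, zmod_two_one_add_one]
      simp only [P, Sum.elim_inr]
      split_ifs
      · exact Submodule.smul_mem _ _ one_mem_parityPart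
      · exact Submodule.zero_mem _
  refine ⟨⟨_, hP⟩, coe_mem_endPart.mp (mem_stab_coordIdeal.mpr ⟨hP, fun s hs => ?_⟩),
    funext fun j => ?_⟩
  · rw [vectorField_gen]
    rcases s with i | j
    · exact Ideal.zero_mem _
    · simp only [P, Sum.elim_inr, dif_neg (inr_mem_coordSet.mp hs)]
      exact Ideal.zero_mem _
  · change aug m n (vectorField P _) = _
    rw [vectorField_gen]
    simp [P]

/-- Both targets are the quotient of `L` by the common kernel. -/
theorem finrank_eq_of_ker_eq {V F F' : Type*} [AddCommMonoid V] [Module ℂ V] [AddCommGroup F]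
    [Module ℂ F] [AddCommGroup F'] [Module ℂ F'] (L : Submodule ℂ V) (T : V →ₗ[ℂ] F)
    (T' : V →ₗ[ℂ] F') (hT : ∀ y, ∃ x ∈ L, T x = y) (hT' : ∀ y, ∃ x ∈ L, T' x = y)
    (h : ∀ x ∈ L, T x = 0 ↔ T' x = 0) : Module.finrank ℂ F = Module.finrank ℂ F' := by
  let : AddCommGroup V := Module.addCommMonoidToAddCommGroup ℂ
  have hker : LinearMap.ker (T.domRestrict L) = LinearMap.ker (T'.domRestrict L) := by
    ext x
    exact h x.1 x.2
  have hs : Function.Surjective (T.domRestrict L) := fun y => by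
    obtain ⟨x, hx, e⟩ := hT y
    exact ⟨⟨x, hx⟩, e⟩
  have hs' : Function.Surjective (T'.domRestrict L) := fun y => by
    obtain ⟨x, hx, e⟩ := hT' y
    exact ⟨⟨x, hx⟩, e⟩
  exact LinearEquiv.finrank_eq (((T.domRestrict L).quotKerEquivOfSurjective hs).symm.trans
    ((Submodule.quotEquivOfEq _ _ hker).trans
      ((T'.domRestrict L).quotKerEquivOfSurjective hs')))

/-- Stabilizers of coordinate ideals that are conjugate under the group of inner automorphisms
belong to sets of coordinates of the same cardinality. -/
theorem card_eq_of_conj {A B : Finset (Fin n)} {g : (p : ZMod 2) → (W m n p ≃ₗ[ℂ] W m n p)}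
    (hg : g ∈ innerGroup m n)
    (h : stab ((coordIdeal m B).restrictScalars ℂ) =
      conj g (stab ((coordIdeal m A).restrictScalars ℂ))) : A.card = B.card := by
  have hmem : ∀ {X : W m n 1}, X ∈ stab ((coordIdeal m A).restrictScalars ℂ) 1 →
      g 1 X ∈ stab ((coordIdeal m B).restrictScalars ℂ) 1 := fun {X} hX => by
    rw [h]
    exact ⟨X, hX, rfl⟩
  -- On the stabilizer for `A`, both this map and `oddAugMap m A` are surjective with kernel the odd
  -- fields vanishing at the origin, so their targets have equal dimension.
  set T : W m n 1 →ₗ[ℂ] (B → ℂ) := oddAugMap m B ∘ₗ (g 1).toLinearMap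
  have hT : ∀ v, ∃ X ∈ stab ((coordIdeal m A).restrictScalars ℂ) 1, T X = v := fun v => by
    obtain ⟨Y, hY, e⟩ := exists_oddAugMap_eq m B v
    rw [h] at hY
    obtain ⟨X, hX, rfl⟩ := hY
    exact ⟨X, hX, e⟩
  have := finrank_eq_of_ker_eq _ (oddAugMap m A) T (exists_oddAugMap_eq m A) hT fun X hX => by
    rw [oddAugMap_eq_zero_iff hX]
    exact (mem_nhd_one_iff_of_mem_innerGroup hg).symm.trans
      (oddAugMap_eq_zero_iff (hmem hX)).symm
  simpa using this

end Isotropy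

end

end SuperW

theorem theorem2 (m n : ℕ) (hm : 1 ≤ m) :
    (∀ k : ℕ, k ≤ n → SuperW.IsMaximalOpenSubalg (SuperW.stdSubalg m n k)) ∧
    ∀ L : SuperW.GradedSubspace m n, SuperW.IsMaximalOpenSubalg L →
      ∃! k : ℕ, k ≤ n ∧ ∃ g ∈ SuperW.innerGroup m n, L = SuperW.conj g (SuperW.stdSubalg m n k) := by
  refine ⟨fun k _ => ?_, fun L hL => ?_⟩
  · rw [SuperW.stdSubalg_eq_stab]
    exact SuperW.isMaximalOpenSubalg_stab_coordIdeal hm _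
  · obtain ⟨k, hk, g, hg, e⟩ := SuperW.exists_conj_stdSubalg hm hL
    refine ⟨k, ⟨hk, g, hg, e⟩, ?_⟩
    rintro k' ⟨hk', g', hg', e'⟩
    have h : SuperW.stdSubalg m n k = SuperW.conj (g⁻¹ * g') (SuperW.stdSubalg m n k') := by
      rw [SuperW.conj_mul, ← e', e, ← SuperW.conj_mul, inv_mul_cancel, SuperW.conj_one]
    rw [SuperW.stdSubalg_eq_stab, SuperW.stdSubalg_eq_stab] at h
    have := SuperW.card_eq_of_conj (Subgroup.mul_mem _ (Subgroup.inv_mem _ hg) hg') h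
    rwa [SuperW.card_zeroSet hk, SuperW.card_zeroSet hk'] at this
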